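/- Let $0<\rho<1$, $\chi=\rho(1-\rho)$ and $w,s,\sigma\in\mathbb R$. **The kernel.** For integers $m,d$ with $|d|<m$ let $T_+,T_-$ be the integral operators on functions on $\mathbb R$ with kernels $e^{-(x-y)/2}\mathbf 1_{x>y}$ and $e^{-(y-x)/2}\mathbf 1_{y>x}$, so that $T_+^{-1}=\tfrac12+\tfrac{d}{dx}$ and $T_-^{-1}=\tfrac12-\tfrac{d}{dx}$. Put $L=T_+^{m+d}T_-^{-(m-d)}$, $R=T_+^{-(m+d)}T_-^{m-d}$ and $K_{m,d}=LP_-R$, where $P_-$ is the projection onto $(-\infty,0)$. Only $K_{m,d}(x,y)$ with $x,y>0$ is used: $$K_{m,d}(x,y)=\int_{-\infty}^0 L(x,v)R(v,y)\,dv,$$ $$L(x,v)=\frac{e^{(\frac12-\rho)(x-v)}}{-2\pi i}\oint_{\Gamma_{1-\rho}}e^{-z(x-v)}\frac{(z+\rho)^{m-d}}{(1-\rho-z)^{m+d}}\,dz\quad(x>v),$$ $$R(v,y)=\frac{e^{(\frac12-\rho)(v-y)}}{2\pi i}\oint_{\Gamma_{-\rho}}e^{z(y-v)}\frac{(1-\rho-z)^{m+d}}{(\rho+z)^{m-d}}\,dz\quad(v<y),$$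 with $\Gamma_p$ a small anticlockwise circle around $p$. **The function $G_0$.** Let $\psi_a(x)=e^{-ax}$, let $P_u$ be the projection onto $[u,\infty)$, $u>0$, and let $$Z_{a,b}=\frac1{a+b}\Big(\frac{1-2a}{1+2a}\Big)^m\Big(\frac{1-2b}{1+2b}\Big)^m\Big(\tfrac14-a^2\Big)^{-d}\Big(\tfrac14-b^2\Big)^{d}.$$ For $0<a,b<\frac12$ define $G^{a,b}(u)$ by $$(a+b)\,G^{a,b}(u)=1-\frac1{Z_{a,b}}\big\langle\psi_a,(1-K_{m,d})P_u(1-P_uK_{m,d}P_u)^{-1}P_u(1-K_{m,d})\psi_b\big\rangle_{L^2(\mathbb R)},$$ extend $(a,b)\mapsto G^{a,b}(u)$ real analytically to $(-\frac12,\frac12)^2$, and put $G_0(u)=\lim_{b\to-a}G^{a,b}(u)$ with $a=\frac12-\rho$. **Edge scaling.** For all large $t$ let $m=m(t)$ and $d=d(t)$ be integers such that $$\big|2m-\lfloor(1-2\chi)t+2w(1-2\rho)\chi^{1/3}t^{2/3}-2\sigma\chi^{2/3}t^{1/3}\rfloor\big|\le1,\qquad\big|2d-\lfloor(1-2\rho)t+2w\chi^{1/3}t^{2/3}\rfloor\big|\le1$$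 (so $2m$ and $2d$ equal these integer parts whenever the latter are even), and let $u(t)=t+(s-\sigma)\chi^{-1/3}t^{1/3}$. For $\sigma=0$ this is $u(t)=t+s\chi^{-1/3}t^{1/3}$. **Limit functions.** Let $\mathrm{Ai}$ be the Airy function, $K_{\mathrm{Ai},q}(x,y)=\int_0^\infty\mathrm{Ai}(q+z+x)\mathrm{Ai}(q+z+y)\,dz$, and $P_0$ the projection onto $[0,\infty)$. Let $$\varphi_{w,s}(z)=\mathrm{Ai}(w^2+s+z)\,e^{w(w^2+s+z)}e^{-\frac13w^3},\qquad S_{w,s}=s+\int_0^\infty\!\!\int_0^\infty\varphi_{w,s}(x+y)\,dy\,dx,$$ $$\Phi_{w,s}(\xi)=e^{w\xi}\int_0^\infty\varphi_{-w,s}(y+\xi)\Big(1-\int_0^\infty\varphi_{w,s}(x+y)\,dx\Big)dy,\qquad\Psi_{w,s}(\xi)=e^{-w\xi}\Big(1-\int_0^\infty\varphi_{w,s}(x+\xi)\,dx\Big).$$ For $w>0$ let $$\widehat\Phi_{w,s}(x)=\int_{-\infty}^0e^{wz}K_{\mathrm{Ai},s}(z,x)e^{ws}\,dz,\qquad\widehat\Psi_{w,s}(y)=\int_{-\infty}^0e^{wz}\mathrm{Ai}(y+z+s)\,dz,$$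 $$g(s,w)=e^{-\frac13w^3}\Big[\int_{-\infty}^0\!\int_{-\infty}^0e^{w(x+y+s)}\mathrm{Ai}(x+y+s)\,dy\,dx+\int_0^\infty\widehat\Phi_{w,s}(x)\,\big((1-P_0K_{\mathrm{Ai},s}P_0)^{-1}\widehat\Psi_{w,s}\big)(x)\,dx\Big],$$ and put $g(s,-w)=g(s,w)$, $g(s,0)=\lim_{v\downarrow0}g(s,v)$. For functions $f\notin L^2$ (which happens for $\Psi_{0,s}$) the resolvent $(1-K)^{-1}f$ means $f+(1-K)^{-1}Kf$. **Theorem.** For all large $t$ the analytic extension that defines $G_0(u(t))$ exists, and $$\lim_{t\to\infty}\chi^{1/3}t^{-1/3}\,G_0(u(t))=S_{|w|,s}+\int_0^\infty\Phi_{|w|,s}(z)\big((1-P_0K_{\mathrm{Ai},w^2+s}P_0)^{-1}\Psi_{|w|,s}\big)(z)\,dz=g(s+w^2,w).$$ Moreover $v\mapsto g(s+w^2,v)$ is continuous at $v=0$; in particular the limit defining $g(s+w^2,0)$ exists. -/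

import Mathlib

open Set Filter Topology MeasureTheory

noncomputable section

namespace StationaryTASEP

/-! ### Integral operators and resolvents on `L²(ν)` -/

open Classical in
/-- The bounded operator on `L²(ν)` with integral kernel `k`, i.e. the (unique) bounded operator `T`
with `(T f)(x) = ∫ k(x,y) f(y) dν(y)` for `ν`-almost every `x` and all `f ∈ L²(ν)`
(and `0` if the kernel does not define a bounded operator). -/
def kernelOp (ν : Measure ℝ) (k : ℝ → ℝ → ℝ) : Lp ℝ 2 ν →L[ℝ] Lp ℝ 2 ν :=
  if h : ∃ T : Lp ℝ 2 ν →L[ℝ] Lp ℝ 2 ν,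
      ∀ f : Lp ℝ 2 ν, (T f : ℝ → ℝ) =ᵐ[ν] fun x => ∫ y, k x y * f y ∂ν
  then h.choose else 0

open Classical in
/-- The class in `L²(ν)` of a square integrable function. -/
def toL2 (ν : Measure ℝ) (f : ℝ → ℝ) : Lp ℝ 2 ν :=
  if h : MemLp f 2 ν then h.toLp f else 0

/-- `(1 - K)⁻¹ g = g + (1 - K)⁻¹ (K g)`, where `K` is the operator on `L²(ν)` with kernel `k` and
`(1 - K)⁻¹` is the inverse in the algebra of bounded operators on `L²(ν)`.  For `g ∈ L²(ν)` this is
just the resolvent applied to `g`; written in this way it also makes sense for functions `g` outside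
`L²(ν)` (for instance bounded ones) for which `K g` is in `L²(ν)`. -/
def resolventApply (ν : Measure ℝ) (k : ℝ → ℝ → ℝ) (g : ℝ → ℝ) (x : ℝ) : ℝ :=
  g x + (Ring.inverse (1 - kernelOp ν k) (toL2 ν fun x' => ∫ y, k x' y * g y ∂ν) : Lp ℝ 2 ν) x

/-- The pairing `⟨f, (1 - K)⁻¹ g⟩ = ∫ f(x) ((1 - K)⁻¹ g)(x) dν(x)`. -/
def resolventPairing (ν : Measure ℝ) (k : ℝ → ℝ → ℝ) (f g : ℝ → ℝ) : ℝ :=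
  ∫ x, f x * resolventApply ν k g x ∂ν

/-! ### The Laguerre kernel

`T₊`, `T₋` are the integral operators with kernels `e^{-(x-y)/2} 1_{x>y}`, `e^{-(y-x)/2} 1_{y>x}`,
`L = T₊^{m+d} T₋^{-(m-d)}`, `R = T₊^{-(m+d)} T₋^{m-d}`, and the kernel is `K = L P₋ R` with `P₋` the
projection onto `(-∞, 0)`. -/

/-- `I(x) = ∮ e^{-zx} (z+ρ)^{m-d} / (1-ρ-z)^{m+d} dz` around the pole `1-ρ` (the only pole of the
integrand when `|d| ≤ m`), anticlockwise. -/
def contourI (ρ : ℝ) (m d : ℤ) (x : ℝ) : ℂ :=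
  ∮ z in C((1 - ρ : ℂ), 1), Complex.exp (-z * x) * ((z + ρ) ^ (m - d) / (1 - ρ - z) ^ (m + d))

/-- `Ĩ(x) = ∮ e^{zx} (1-ρ-z)^{m+d} / (ρ+z)^{m-d} dz` around the pole `-ρ` (the only pole of the
integrand when `|d| ≤ m`), anticlockwise. -/
def contourITilde (ρ : ℝ) (m d : ℤ) (x : ℝ) : ℂ :=
  ∮ z in C((-ρ : ℂ), 1), Complex.exp (z * x) * ((1 - ρ - z) ^ (m + d) / (ρ + z) ^ (m - d))

/-- The kernel `L(x,y)` for `r = x - y > 0`; it is real, so taking the real part only changes the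
type.  It does not depend on `ρ`, which enters through the integration variable only. -/
def kernelL (ρ : ℝ) (m d : ℤ) (r : ℝ) : ℝ :=
  (1 / (-(2 * Real.pi * Complex.I)) * Real.exp ((1 / 2 - ρ) * r) * contourI ρ m d r).re

/-- The kernel `R(x,y)` for `r = x - y < 0`; real, and independent of `ρ`. -/
def kernelR (ρ : ℝ) (m d : ℤ) (r : ℝ) : ℝ :=
  (1 / (2 * Real.pi * Complex.I) * Real.exp ((1 / 2 - ρ) * r) * contourITilde ρ m d (-r)).re

/-- The kernel `K(x,y) = ∫_{v<0} L(x,v) R(v,y) dv` for `x, y > 0`. -/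
def kernelK (ρ : ℝ) (m d : ℤ) (x y : ℝ) : ℝ :=
  ∫ v in Iio (0 : ℝ), kernelL ρ m d (x - v) * kernelR ρ m d (v - y)

/-- `T₋`. -/
def opTMinus (f : ℝ → ℝ) (x : ℝ) : ℝ := ∫ y in Ioi x, Real.exp (-(y - x) / 2) * f y

/-- `T₊⁻¹ = 1/2 + d/dx`. -/
def opTPlusInv (f : ℝ → ℝ) (x : ℝ) : ℝ := f x / 2 + deriv f x

/-- `R = T₊^{-(m+d)} T₋^{m-d}` acting on smooth functions (here: exponentials). -/
def opR (m d : ℤ) (f : ℝ → ℝ) : ℝ → ℝ :=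
  opTPlusInv^[(m + d).toNat] (opTMinus^[(m - d).toNat] f)

/-- `L* = T₋^{m+d} T₊^{-(m-d)}` acting on smooth functions (here: exponentials). -/
def opLStar (m d : ℤ) (f : ℝ → ℝ) : ℝ → ℝ :=
  opTMinus^[(m + d).toNat] (opTPlusInv^[(m - d).toNat] f)

/-- The exponentials `ψ_a(x) = e^{-ax}`. -/
def psi (a x : ℝ) : ℝ := Real.exp (-a * x)

/-- `(1 - K) f = f - L P₋ R f` at points `x > 0`. -/
def oneSubK (ρ : ℝ) (m d : ℤ) (f : ℝ → ℝ) (x : ℝ) : ℝ :=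
  f x - ∫ v in Iio (0 : ℝ), kernelL ρ m d (x - v) * opR m d f v

/-- `(1 - K)* f = f - R* P₋ L* f` at points `x > 0`. -/
def oneSubKStar (ρ : ℝ) (m d : ℤ) (f : ℝ → ℝ) (x : ℝ) : ℝ :=
  f x - ∫ v in Iio (0 : ℝ), kernelR ρ m d (v - x) * opLStar m d f v

/-- The normalization `Z_{a,b} = ⟨ψ_a, (1 - K) ψ_b⟩`, in closed form. -/
def normZ (m d : ℤ) (a b : ℝ) : ℝ :=
  1 / (a + b) * ((1 - 2 * a) / (1 + 2 * a)) ^ m * ((1 - 2 * b) / (1 + 2 * b)) ^ m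
    * (1 / 4 - a ^ 2) ^ (-d) * (1 / 4 - b ^ 2) ^ d

/-- `G^{a,b}(u)` for `0 < a, b < 1/2`:
`(a+b) G^{a,b}(u) = 1 - Z_{a,b}⁻¹ ⟨ψ_a, (1-K) P_u (1 - P_u K P_u)⁻¹ P_u (1-K) ψ_b⟩`,
with `P_u` the projection onto `[u,∞)`. -/
def Gab (ρ : ℝ) (m d : ℤ) (u a b : ℝ) : ℝ :=
  1 / (a + b) * (1 - 1 / normZ m d a b *
    resolventPairing (volume.restrict (Ici u)) (kernelK ρ m d)
      (oneSubKStar ρ m d (psi a)) (oneSubK ρ m d (psi b)))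

/-- `H` is the (unique) real analytic extension of `(a,b) ↦ G^{a,b}(u)` from `(0,1/2)²` to
`(-1/2,1/2)²`. -/
def IsAnalyticExtension (ρ : ℝ) (m d : ℤ) (u : ℝ) (H : ℝ × ℝ → ℝ) : Prop :=
  AnalyticOnNhd ℝ H (Ioo (-1 / 2) (1 / 2) ×ˢ Ioo (-1 / 2) (1 / 2)) ∧
    ∀ a ∈ Ioo (0 : ℝ) (1 / 2), ∀ b ∈ Ioo (0 : ℝ) (1 / 2), H (a, b) = Gab ρ m d u a b

open Classical in
/-- `G_0(u) = lim_{b → -a} G^{a,b}(u)` with `a = 1/2 - ρ`, where `G^{a,b}(u)` stands for the analytic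
extension to `(-1/2,1/2)²`. -/
def GZero (ρ : ℝ) (m d : ℤ) (u : ℝ) : ℝ :=
  if h : ∃ H, IsAnalyticExtension ρ m d u H then
    limUnder (𝓝[≠] (-(1 / 2 - ρ))) fun b => h.choose (1 / 2 - ρ, b)
  else 0

/-! ### The limit -/

/-- The Airy function
`Ai(x) = (2πi)⁻¹ ∫_{1 + iℝ} exp(ξ³/3 - xξ) dξ` (absolutely convergent, real). -/
def airy (x : ℝ) : ℝ :=
  1 / (2 * Real.pi) *
    (∫ y : ℝ, Complex.exp ((1 + y * Complex.I) ^ 3 / 3 - x * (1 + y * Complex.I))).re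

/-- The Airy kernel shifted by `q`. -/
def airyKernel (q x y : ℝ) : ℝ := ∫ z in Ioi (0 : ℝ), airy (q + z + x) * airy (q + z + y)

def phi (w s z : ℝ) : ℝ :=
  airy (w ^ 2 + s + z) * Real.exp (w * (w ^ 2 + s + z)) * Real.exp (-(1 / 3) * w ^ 3)

def limS (w s : ℝ) : ℝ := s + ∫ x in Ioi (0 : ℝ), ∫ y in Ioi (0 : ℝ), phi w s (x + y)

def limPhi (w s x : ℝ) : ℝ :=
  Real.exp (w * x) * ∫ y in Ioi (0 : ℝ),
    phi (-w) s (y + x) * (1 - ∫ z in Ioi (0 : ℝ), phi w s (z + y))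

def limPsi (w s x : ℝ) : ℝ := Real.exp (-w * x) * (1 - ∫ y in Ioi (0 : ℝ), phi w s (y + x))

/-- `S_{w,s} + ⟨Φ_{w,s}, (1 - P₀ K_{Ai,w²+s} P₀)⁻¹ Ψ_{w,s}⟩`, for `w ≥ 0`, with `P₀` the projection
onto `[0,∞)`. -/
def edgeLimit (w s : ℝ) : ℝ :=
  limS w s + resolventPairing (volume.restrict (Ici 0)) (airyKernel (w ^ 2 + s))
    (limPhi w s) (limPsi w s)

def hatPhi (w s x : ℝ) : ℝ :=
  ∫ z in Iio (0 : ℝ), Real.exp (w * z) * airyKernel s z x * Real.exp (w * s)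

def hatPsi (w s y : ℝ) : ℝ := ∫ z in Iio (0 : ℝ), Real.exp (w * z) * airy (y + z + s)

/-- The scaling function `g(s,w)` for `w > 0`, where all integrals converge absolutely. -/
def scalingGPos (s w : ℝ) : ℝ :=
  Real.exp (-(1 / 3) * w ^ 3) *
    ((∫ x in Iio (0 : ℝ), ∫ y in Iio (0 : ℝ), Real.exp (w * (x + y + s)) * airy (x + y + s)) +
      resolventPairing (volume.restrict (Ici 0)) (airyKernel s) (hatPhi w s) (hatPsi w s))

/-- The scaling function `g(s,w)` for all real `w`: the even extension in `w`, with the value at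
`w = 0` defined by continuity. -/
def scalingG (s w : ℝ) : ℝ :=
  if w = 0 then limUnder (𝓝[>] 0) (scalingGPos s) else scalingGPos s |w|

end StationaryTASEP

end

noncomputable section

namespace StationaryTASEP

/-! ### Hilbert–Schmidt integral operators -/

section HilbertSchmidt

variable {ν μ κ : Measure ℝ}

/-! Write `n = m - d`, `p = m + d`, ℓ(r) for `L` at a positive argument r and k(r) for `R` at the
argument -r. The substitution z ↦ -z shows that ℓ and k are residues of the same kind. Hence both
are exponential polynomials e^{-r/2}P(r), e^{-r/2}Q(r), and K(x,y) = ∫_0^∞ ℓ(x+v)k(v+y)dv has finite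
rank on [u,∞).

Analytic extension. Exponentials are eigenfunctions of R and L*. On [u,∞) the function (1-K)*ψ_a is
the truncated (1-P_uKP_u)*ψ_a minus a multiple of an exponential polynomial (`dressedExp_eq_sub`).
The truncated part cancels the resolvent and leaves elementary terms, in which 1/(a+b) is a
removable singularity. In the other part a and b occur only in finitely many scalar coefficients
that are analytic on (-1/2,1/2)² (`resolventPairing_cutRemainder`). This gives `extG`, and G_0 is
its value at b = -a.

Edge variables. With x = u + λX, λ = χ^{-1/3}t^{1/3}, this value is λ times `edgeForm` of the
rescaled ℓ and k (`extG_eq_edgeForm`). The two factors of K are exchanged (AB becomes BA) and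
weighted by exponentials, so that the resulting kernel `edgeKernel` has exactly the shifted Airy
kernel as its limit.

Asymptotics. Steepest descent on a circle through a point at distance κ/λ from the double critical
point gives convergence of the rescaled ℓ, k to φ_{w,s}, φ_{-w,s}, with a uniform bound C e^{-κX}
for some κ > |w| (`dominatedLimit_edgeAlpha`). `edgeForm` is continuous under such convergence,
because kernels converge in Hilbert–Schmidt norm and inversion is continuous at a unit
(`tendsto_edgeForm`). Only the limit operator has to be inverted by hand; units form an open set, so
the finite time resolvents exist for large t.

Invertibility. K_Ai = A² with A the Hankel operator of Ai(q+x+y). Parseval makes A a contraction,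
even into L²(-1,∞); equality of norms on (0,∞) would force an analytic function to vanish on (-1,0),
hence everywhere. So 1 is not an eigenvalue of the compact operator A²
(`isUnit_one_sub_airyKernel`).

The limit. The limit comes out as `edgeLimit w s` for w of either sign, and it is even in w by a
resolvent identity (`edgeLimit_neg`). For w > 0 it equals g because ∫e^{wz}Ai(z)dz = e^{w³/3} trades
integrals over the negative half line for explicit terms minus integrals over the positive one
(`edgeLimit_eq_scalingGPos`). Continuity at w = 0 is again continuity of `edgeForm`. -/

lemma MemLp.inner_toLp {f g : ℝ → ℝ} (hf : MemLp f 2 μ) (hg : MemLp g 2 μ) :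
    inner ℝ (hf.toLp f) (hg.toLp g) = ∫ x, f x * g x ∂μ := by
  rw [L2.inner_def]
  refine integral_congr_ae ?_
  filter_upwards [hf.coeFn_toLp, hg.coeFn_toLp] with x h1 h2
  rw [h1, h2]
  simp [mul_comm]

lemma Lp.inner_eq_integral (f g : Lp ℝ 2 μ) : inner ℝ f g = ∫ x, f x * g x ∂μ := by
  rw [L2.inner_def]
  simp [mul_comm]

lemma Lp.norm_sq_eq_integral (f : Lp ℝ 2 μ) : ‖f‖ ^ 2 = ∫ x, f x ^ 2 ∂μ := by
  rw [← real_inner_self_eq_norm_sq, Lp.inner_eq_integral]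
  simp [pow_two]

lemma MemLp.norm_sq_toLp {f : ℝ → ℝ} (hf : MemLp f 2 μ) : ‖hf.toLp f‖ ^ 2 = ∫ x, f x ^ 2 ∂μ := by
  rw [← real_inner_self_eq_norm_sq, MemLp.inner_toLp]
  simp [pow_two]

lemma integral_mul_sq_le {f g : ℝ → ℝ} (hf : MemLp f 2 μ) (hg : MemLp g 2 μ) :
    (∫ x, f x * g x ∂μ) ^ 2 ≤ (∫ x, f x ^ 2 ∂μ) * ∫ x, g x ^ 2 ∂μ := by
  rw [← MemLp.inner_toLp hf hg, ← MemLp.norm_sq_toLp hf, ← MemLp.norm_sq_toLp hg, ← mul_pow,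
    ← sq_abs]
  exact pow_le_pow_left₀ (abs_nonneg _) (abs_real_inner_le_norm _ _) 2

lemma MemLp.integrable_fun_mul {f g : ℝ → ℝ} (hf : MemLp f 2 μ) (hg : MemLp g 2 μ) :
    Integrable (fun x => f x * g x) μ := hf.integrable_mul hg

lemma memLp_two_mul_prod [SFinite ν] [SFinite μ] {f g : ℝ → ℝ}
    (hf : MemLp f 2 ν) (hg : MemLp g 2 μ) :
    MemLp (fun p : ℝ × ℝ => f p.1 * g p.2) 2 (ν.prod μ) := by
  have hm : AEStronglyMeasurable (fun p : ℝ × ℝ => f p.1 * g p.2) (ν.prod μ) :=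
    hf.1.comp_fst.mul hg.1.comp_snd
  rw [memLp_two_iff_integrable_sq hm]
  simpa only [mul_pow] using Integrable.mul_prod hf.integrable_sq hg.integrable_sq

lemma MemLp.ae_section [SFinite ν] [SFinite μ] {k : ℝ → ℝ → ℝ}
    (hk : MemLp (Function.uncurry k) 2 (ν.prod μ)) : ∀ᵐ x ∂ν, MemLp (k x) 2 μ := by
  filter_upwards [hk.integrable_sq.prod_right_ae, hk.1.prodMk_left] with x h1 h2
  exact (memLp_two_iff_integrable_sq h2).2 h1

lemma memLp_swap [SFinite ν] [SFinite μ] {k : ℝ → ℝ → ℝ}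
    (hk : MemLp (Function.uncurry k) 2 (ν.prod μ)) :
    MemLp (Function.uncurry fun y x => k x y) 2 (μ.prod ν) := by
  have := hk.comp_measurePreserving (Measure.measurePreserving_swap (μ := μ) (ν := ν))
  exact this

lemma aestronglyMeasurable_integral_mul [SFinite ν] [SFinite μ] {k : ℝ → ℝ → ℝ} {g : ℝ → ℝ}
    (hk : AEStronglyMeasurable (Function.uncurry k) (ν.prod μ)) (hg : AEStronglyMeasurable g μ) :
    AEStronglyMeasurable (fun x => ∫ y, k x y * g y ∂μ) ν :=
  (hk.mul hg.comp_snd).integral_prod_right'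

lemma ae_sq_integral_le [SFinite ν] [SFinite μ] {k : ℝ → ℝ → ℝ} {g : ℝ → ℝ}
    (hk : MemLp (Function.uncurry k) 2 (ν.prod μ)) (hg : MemLp g 2 μ) :
    ∀ᵐ x ∂ν, (∫ y, k x y * g y ∂μ) ^ 2 ≤ (∫ y, k x y ^ 2 ∂μ) * ∫ y, g y ^ 2 ∂μ := by
  filter_upwards [MemLp.ae_section hk] with x hx
  exact integral_mul_sq_le hx hg

lemma memLp_integral_mul [SFinite ν] [SFinite μ] {k : ℝ → ℝ → ℝ} {g : ℝ → ℝ}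
    (hk : MemLp (Function.uncurry k) 2 (ν.prod μ)) (hg : MemLp g 2 μ) :
    MemLp (fun x => ∫ y, k x y * g y ∂μ) 2 ν := by
  have hm := aestronglyMeasurable_integral_mul hk.1 hg.1
  rw [memLp_two_iff_integrable_sq hm]
  refine Integrable.mono' (hk.integrable_sq.integral_prod_left.mul_const (∫ y, g y ^ 2 ∂μ))
    (hm.pow 2) ?_
  filter_upwards [ae_sq_integral_le hk hg] with x hx
  rw [Real.norm_of_nonneg (sq_nonneg _)]
  exact hx

lemma integral_sq_integral_mul_le [SFinite ν] [SFinite μ] {k : ℝ → ℝ → ℝ} {g : ℝ → ℝ}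
    (hk : MemLp (Function.uncurry k) 2 (ν.prod μ)) (hg : MemLp g 2 μ) :
    ∫ x, (∫ y, k x y * g y ∂μ) ^ 2 ∂ν ≤
      (∫ p, Function.uncurry k p ^ 2 ∂(ν.prod μ)) * ∫ y, g y ^ 2 ∂μ := by
  rw [integral_prod _ hk.integrable_sq, ← integral_mul_const]
  exact integral_mono_ae (memLp_integral_mul hk hg).integrable_sq
    (hk.integrable_sq.integral_prod_left.mul_const _) (ae_sq_integral_le hk hg)

/-- The Hilbert–Schmidt operator `L²(μ) → L²(ν)` with kernel `k`. -/
def integralOp [SFinite ν] [SFinite μ] (k : ℝ → ℝ → ℝ)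
    (hk : MemLp (Function.uncurry k) 2 (ν.prod μ)) : Lp ℝ 2 μ →L[ℝ] Lp ℝ 2 ν :=
  LinearMap.mkContinuous
    { toFun := fun f => (memLp_integral_mul hk (Lp.memLp f)).toLp _
      map_add' := fun f g => by
        rw [← MemLp.toLp_add, MemLp.toLp_eq_toLp_iff]
        filter_upwards [MemLp.ae_section hk] with x hx
        rw [Pi.add_apply, ← integral_add (MemLp.integrable_fun_mul hx (Lp.memLp f))
          (MemLp.integrable_fun_mul hx (Lp.memLp g))]
        refine integral_congr_ae ?_
        filter_upwards [Lp.coeFn_add f g] with y hy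
        change k x y * (f + g : Lp ℝ 2 μ) y = _
        rw [hy, Pi.add_apply, mul_add]
      map_smul' := fun c f => by
        rw [RingHom.id_apply, ← MemLp.toLp_const_smul, MemLp.toLp_eq_toLp_iff]
        refine ae_of_all _ fun x => ?_
        rw [Pi.smul_apply, smul_eq_mul, ← integral_const_mul]
        refine integral_congr_ae ?_
        filter_upwards [Lp.coeFn_smul c f] with y hy
        change k x y * (c • f : Lp ℝ 2 μ) y = _
        rw [hy, Pi.smul_apply, smul_eq_mul, mul_left_comm] }
    (√(∫ p, Function.uncurry k p ^ 2 ∂(ν.prod μ))) (fun f => by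
      refine abs_le_of_sq_le_sq' ?_ (by positivity) |>.2
      simp only [LinearMap.coe_mk, AddHom.coe_mk]
      rw [MemLp.norm_sq_toLp, mul_pow, Real.sq_sqrt (integral_nonneg fun _ => sq_nonneg _),
        Lp.norm_sq_eq_integral]
      exact integral_sq_integral_mul_le hk (Lp.memLp f))

lemma integralOp_toLp [SFinite ν] [SFinite μ] {k : ℝ → ℝ → ℝ}
    (hk : MemLp (Function.uncurry k) 2 (ν.prod μ)) {g : ℝ → ℝ} (hg : MemLp g 2 μ) :
    integralOp k hk (hg.toLp g) = (memLp_integral_mul hk hg).toLp _ := by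
  change MemLp.toLp _ (memLp_integral_mul hk (Lp.memLp _)) = _
  rw [MemLp.toLp_eq_toLp_iff]
  refine ae_of_all _ fun x => integral_congr_ae ?_
  filter_upwards [hg.coeFn_toLp] with y hy
  rw [hy]

lemma coeFn_integralOp [SFinite ν] [SFinite μ] {k : ℝ → ℝ → ℝ}
    (hk : MemLp (Function.uncurry k) 2 (ν.prod μ)) (f : Lp ℝ 2 μ) :
    integralOp k hk f =ᵐ[ν] fun x => ∫ y, k x y * f y ∂μ :=
  MemLp.coeFn_toLp (memLp_integral_mul hk (Lp.memLp f))

lemma norm_integralOp_le [SFinite ν] [SFinite μ] {k : ℝ → ℝ → ℝ}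
    (hk : MemLp (Function.uncurry k) 2 (ν.prod μ)) :
    ‖integralOp k hk‖ ≤ √(∫ p, Function.uncurry k p ^ 2 ∂(ν.prod μ)) :=
  LinearMap.mkContinuous_norm_le _ (Real.sqrt_nonneg _) _

lemma integralOp_sub [SFinite ν] [SFinite μ] {k k' : ℝ → ℝ → ℝ}
    (hk : MemLp (Function.uncurry k) 2 (ν.prod μ)) (hk' : MemLp (Function.uncurry k') 2 (ν.prod μ))
    (h : MemLp (Function.uncurry fun x y => k x y - k' x y) 2 (ν.prod μ)) :
    integralOp k hk - integralOp k' hk' = integralOp _ h := by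
  ext1 f
  apply Lp.ext
  filter_upwards [Lp.coeFn_sub (integralOp k hk f) (integralOp k' hk' f), coeFn_integralOp hk f,
    coeFn_integralOp hk' f, coeFn_integralOp h f, MemLp.ae_section hk, MemLp.ae_section hk']
    with x h1 h2 h3 h4 h5 h6
  rw [_root_.sub_apply, h1, Pi.sub_apply, h2, h3, h4,
    ← integral_sub (MemLp.integrable_fun_mul h5 (Lp.memLp f)) (MemLp.integrable_fun_mul h6 (Lp.memLp f))]
  simp [sub_mul]

/-- An element of L² is determined by its values almost everywhere, so the operator chosen in the
definition of `kernelOp` is unique and any candidate identifies it. -/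
lemma kernelOp_eq_of_ae {k : ℝ → ℝ → ℝ} (T : Lp ℝ 2 ν →L[ℝ] Lp ℝ 2 ν)
    (hT : ∀ f : Lp ℝ 2 ν, (T f : ℝ → ℝ) =ᵐ[ν] fun x => ∫ y, k x y * f y ∂ν) :
    kernelOp ν k = T := by
  have h : ∃ T : Lp ℝ 2 ν →L[ℝ] Lp ℝ 2 ν,
      ∀ f : Lp ℝ 2 ν, (T f : ℝ → ℝ) =ᵐ[ν] fun x => ∫ y, k x y * f y ∂ν := ⟨T, hT⟩
  rw [kernelOp, dif_pos h]
  ext1 f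
  exact Lp.ext ((h.choose_spec f).trans (hT f).symm)

lemma kernelOp_eq_integralOp [SFinite ν] {k : ℝ → ℝ → ℝ}
    (hk : MemLp (Function.uncurry k) 2 (ν.prod ν)) : kernelOp ν k = integralOp k hk :=
  kernelOp_eq_of_ae _ (coeFn_integralOp hk)

lemma toL2_of_memLp {f : ℝ → ℝ} (hf : MemLp f 2 μ) : toL2 μ f = hf.toLp f := dif_pos hf

/-- The adjoint relation `⟨f, k h⟩ = ⟨kᵀ f, h⟩` for a Hilbert–Schmidt kernel. -/
lemma integral_mul_integral_mul_comm [SFinite ν] [SFinite μ] {k : ℝ → ℝ → ℝ} {f h : ℝ → ℝ}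
    (hk : MemLp (Function.uncurry k) 2 (ν.prod μ)) (hf : MemLp f 2 ν) (hh : MemLp h 2 μ) :
    ∫ x, f x * ∫ y, k x y * h y ∂μ ∂ν = ∫ y, (∫ x, k x y * f x ∂ν) * h y ∂μ := by
  have hint : Integrable (Function.uncurry fun x y => f x * (k x y * h y)) (ν.prod μ) := by
    have := (memLp_two_mul_prod hf hh).integrable_mul hk
    refine this.congr (ae_of_all _ fun p => ?_)
    simp only [Pi.mul_apply, Function.uncurry]
    ring
  simp_rw [← integral_const_mul]
  rw [integral_integral_swap hint]
  refine integral_congr_ae (ae_of_all _ fun y => ?_)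
  simp only
  rw [← integral_mul_const]
  exact integral_congr_ae (ae_of_all _ fun x => by simp only; ring)

end HilbertSchmidt

/-! ### Factored kernels -/

section Factor

variable {ν μ : Measure ℝ} [SFinite ν] [SFinite μ]

/-- Fubini, with integrability of `Y g` only against each L² function: `g` itself need not be in L²,
which is the case for Ψ with `w ≤ 0`. -/
lemma integral_integral_factor {X Y : ℝ → ℝ → ℝ} {g : ℝ → ℝ}
    (hX : MemLp (Function.uncurry X) 2 (ν.prod μ))
    (hg : ∀ h : ℝ → ℝ, MemLp h 2 μ →
      Integrable (fun p : ℝ × ℝ => h p.1 * (Y p.1 p.2 * g p.2)) (μ.prod ν)) :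
    (fun x => ∫ y, (∫ v, X x v * Y v y ∂μ) * g y ∂ν) =ᵐ[ν]
      fun x => ∫ v, X x v * ∫ y, Y v y * g y ∂ν ∂μ := by
  filter_upwards [MemLp.ae_section hX] with x hx
  simp_rw [← integral_const_mul, ← integral_mul_const]
  rw [integral_integral_swap (f := fun v y => X x v * (Y v y * g y)) (hg _ hx)]
  simp_rw [mul_assoc]

lemma integrable_mul_of_memLp {Y : ℝ → ℝ → ℝ} {g : ℝ → ℝ}
    (hY : MemLp (Function.uncurry Y) 2 (μ.prod ν)) (hg : MemLp g 2 ν) (h : ℝ → ℝ)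
    (hh : MemLp h 2 μ) :
    Integrable (fun p : ℝ × ℝ => h p.1 * (Y p.1 p.2 * g p.2)) (μ.prod ν) := by
  refine ((memLp_two_mul_prod hh hg).integrable_mul hY).congr (ae_of_all _ fun p => ?_)
  simp only [Pi.mul_apply, Function.uncurry]
  ring

lemma kernelOp_factor {X Y : ℝ → ℝ → ℝ}
    (hX : MemLp (Function.uncurry X) 2 (ν.prod μ)) (hY : MemLp (Function.uncurry Y) 2 (μ.prod ν)) :
    kernelOp ν (fun x y => ∫ v, X x v * Y v y ∂μ) = (integralOp X hX).comp (integralOp Y hY) := by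
  refine kernelOp_eq_of_ae _ fun f => ?_
  refine (coeFn_integralOp hX _).trans ?_
  refine EventuallyEq.trans ?_
    (integral_integral_factor hX (integrable_mul_of_memLp hY (Lp.memLp f))).symm
  refine ae_of_all _ fun x => integral_congr_ae ?_
  filter_upwards [coeFn_integralOp hY f] with v hv
  exact congrArg _ hv

/-- If N inverts 1 - BA, then 1 + ANB inverts 1 - AB, and (1-AB)⁻¹A = A(1-BA)⁻¹. This permits
exchanging the two factors of a kernel and so changing the space on which the resolvent lives. -/
lemma isUnit_one_sub_comp {E F : Type*} [NormedAddCommGroup E] [NormedSpace ℝ E]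
    [NormedAddCommGroup F] [NormedSpace ℝ F] (A : E →L[ℝ] F) (B : F →L[ℝ] E)
    (h : IsUnit (1 - B.comp A)) :
    IsUnit (1 - A.comp B) ∧
      (Ring.inverse (1 - A.comp B)).comp A = A.comp (Ring.inverse (1 - B.comp A)) := by
  set N := Ring.inverse (1 - B.comp A) with hN
  have h1 : N * (1 - B.comp A) = 1 := Ring.inverse_mul_cancel _ h
  have h2 : (1 - B.comp A) * N = 1 := Ring.mul_inverse_cancel _ h
  have h1' : ∀ x, N (B (A x)) = N x - x := fun x => by
    have : N (x - B (A x)) = x := DFunLike.congr_fun h1 x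
    rw [map_sub] at this
    rw [eq_sub_iff_add_eq, ← eq_sub_iff_add_eq', this]
  have h2' : ∀ x, B (A (N x)) = N x - x := fun x => by
    have : N x - B (A (N x)) = x := DFunLike.congr_fun h2 x
    rw [eq_sub_iff_add_eq, ← eq_sub_iff_add_eq', this]
  have hu : IsUnit (1 - A.comp B) := by
    refine ⟨⟨1 - A.comp B, 1 + A.comp (N.comp B), ?_, ?_⟩, rfl⟩ <;> ext x <;>
      simp [h1', h2']
  refine ⟨hu, ?_⟩
  have h3 : Ring.inverse (1 - A.comp B) * (1 - A.comp B) = 1 := Ring.inverse_mul_cancel _ hu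
  ext x
  have : Ring.inverse (1 - A.comp B) (A (N x) - A (B (A (N x)))) = A (N x) :=
    DFunLike.congr_fun h3 (A (N x))
  rw [← map_sub, h2', sub_sub_cancel] at this
  exact this

lemma isUnit_one_sub_kernelOp_factor {X Y : ℝ → ℝ → ℝ}
    (hX : MemLp (Function.uncurry X) 2 (ν.prod μ)) (hY : MemLp (Function.uncurry Y) 2 (μ.prod ν))
    (hu : IsUnit (1 - kernelOp μ fun v v' => ∫ x, Y v x * X x v' ∂ν)) :
    IsUnit (1 - kernelOp ν fun x y => ∫ v, X x v * Y v y ∂μ) := by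
  rw [kernelOp_factor hY hX] at hu
  rw [kernelOp_factor hX hY]
  exact (isUnit_one_sub_comp _ _ hu).1

/-- The pairing `⟨f, (1 - XY)⁻¹ g⟩` expressed by the resolvent of `YX`. -/
lemma resolventPairing_factor {X Y : ℝ → ℝ → ℝ} {f g : ℝ → ℝ}
    (hX : MemLp (Function.uncurry X) 2 (ν.prod μ)) (hY : MemLp (Function.uncurry Y) 2 (μ.prod ν))
    (hu : IsUnit (1 - kernelOp μ fun v v' => ∫ x, Y v x * X x v' ∂ν))
    (hf : MemLp f 2 ν) (hfg : Integrable (fun x => f x * g x) ν)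
    (hg : ∀ h : ℝ → ℝ, MemLp h 2 μ →
      Integrable (fun p : ℝ × ℝ => h p.1 * (Y p.1 p.2 * g p.2)) (μ.prod ν))
    (hYg : MemLp (fun v => ∫ y, Y v y * g y ∂ν) 2 μ) :
    resolventPairing ν (fun x y => ∫ v, X x v * Y v y ∂μ) f g =
      (∫ x, f x * g x ∂ν) + inner ℝ (toL2 μ fun v => ∫ x, X x v * f x ∂ν)
        (Ring.inverse (1 - kernelOp μ fun v v' => ∫ x, Y v x * X x v' ∂ν)
          (toL2 μ fun v => ∫ y, Y v y * g y ∂ν)) := by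
  set N := Ring.inverse (1 - kernelOp μ fun v v' => ∫ x, Y v x * X x v' ∂ν) with hN
  have hKg : toL2 ν (fun x => ∫ y, (∫ v, X x v * Y v y ∂μ) * g y ∂ν) =
      integralOp X hX (toL2 μ fun v => ∫ y, Y v y * g y ∂ν) := by
    rw [toL2_of_memLp hYg, integralOp_toLp hX hYg]
    have := integral_integral_factor hX hg
    rw [toL2_of_memLp ((memLp_congr_ae this).2 (memLp_integral_mul hX hYg)),
      MemLp.toLp_eq_toLp_iff]
    exact this
  set h := N (toL2 μ fun v => ∫ y, Y v y * g y ∂ν) with hh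
  -- The resolvent of XY is pushed through X, where it becomes the resolvent of YX.
  have hres : Ring.inverse (1 - kernelOp ν fun x y => ∫ v, X x v * Y v y ∂μ)
      (toL2 ν (fun x => ∫ y, (∫ v, X x v * Y v y ∂μ) * g y ∂ν)) = integralOp X hX h := by
    have hu' := hu
    rw [kernelOp_factor hY hX] at hu'
    have := congrArg (fun T => T (toL2 μ fun v => ∫ y, Y v y * g y ∂ν))
      (isUnit_one_sub_comp _ _ hu').2
    rw [hKg, kernelOp_factor hX hY, hh, hN, kernelOp_factor hY hX]
    exact this
  have hXf : MemLp (fun v => ∫ x, X x v * f x ∂ν) 2 μ := memLp_integral_mul (memLp_swap hX) hf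
  rw [resolventPairing]
  have hae : (fun x => f x * resolventApply ν (fun x y => ∫ v, X x v * Y v y ∂μ) g x) =ᵐ[ν]
      fun x => f x * g x + f x * ∫ v, X x v * h v ∂μ := by
    filter_upwards [coeFn_integralOp hX h] with x hx
    rw [resolventApply, hres, hx, mul_add]
  rw [integral_congr_ae hae, integral_add hfg
    (MemLp.integrable_fun_mul hf (memLp_integral_mul hX (Lp.memLp h))),
    integral_mul_integral_mul_comm hX hf (Lp.memLp h), toL2_of_memLp hXf, Lp.inner_eq_integral]
  congr 1
  refine integral_congr_ae ?_
  filter_upwards [hXf.coeFn_toLp] with v hv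
  rw [hv]

lemma resolventApply_ae_eq {k : ℝ → ℝ → ℝ} {g : ℝ → ℝ}
    (hk : MemLp (Function.uncurry k) 2 (ν.prod ν)) (hu : IsUnit (1 - kernelOp ν k))
    (hg : MemLp g 2 ν) :
    resolventApply ν k g =ᵐ[ν] Ring.inverse (1 - kernelOp ν k) (hg.toLp g) := by
  have h1 : toL2 ν (fun x' => ∫ y, k x' y * g y ∂ν) = kernelOp ν k (hg.toLp g) := by
    rw [kernelOp_eq_integralOp hk, integralOp_toLp hk hg,
      toL2_of_memLp (memLp_integral_mul hk hg)]
  have h2 : Ring.inverse (1 - kernelOp ν k) (hg.toLp g) =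
      hg.toLp g + Ring.inverse (1 - kernelOp ν k) (kernelOp ν k (hg.toLp g)) := by
    have : Ring.inverse (1 - kernelOp ν k) (hg.toLp g - kernelOp ν k (hg.toLp g)) =
      hg.toLp g := DFunLike.congr_fun (Ring.inverse_mul_cancel _ hu) (hg.toLp g)
    rw [map_sub, sub_eq_iff_eq_add] at this
    exact this
  rw [h2]
  filter_upwards [Lp.coeFn_add (hg.toLp g) (Ring.inverse (1 - kernelOp ν k)
    (kernelOp ν k (hg.toLp g))), hg.coeFn_toLp] with x hx hx'
  rw [hx, Pi.add_apply, hx', resolventApply, h1]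

/-- `⟨(1 - K)* ψ - q, (1 - K)⁻¹ g⟩ = ⟨ψ, g⟩ - ⟨q, (1 - K)⁻¹ g⟩`. -/
lemma resolventPairing_one_sub_transpose {k : ℝ → ℝ → ℝ} {ψ q g : ℝ → ℝ}
    (hk : MemLp (Function.uncurry k) 2 (ν.prod ν)) (hu : IsUnit (1 - kernelOp ν k))
    (hψ : MemLp ψ 2 ν) (hq : MemLp q 2 ν) (hg : MemLp g 2 ν) :
    resolventPairing ν k (fun y => ψ y - (∫ x, k x y * ψ x ∂ν) - q y) g =
      (∫ x, ψ x * g x ∂ν) - resolventPairing ν k q g := by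
  set S := Ring.inverse (1 - kernelOp ν k) (hg.toLp g) with hS
  -- S solves (1-K)S = g, so pairing ψ with g is pairing (1-K)*ψ with S.
  have hSg : (fun x => S x - ∫ y, k x y * S y ∂ν) =ᵐ[ν] g := by
    have h3 : S - kernelOp ν k S = hg.toLp g :=
      DFunLike.congr_fun (Ring.mul_inverse_cancel _ hu) (hg.toLp g)
    rw [kernelOp_eq_integralOp hk] at h3
    filter_upwards [Lp.coeFn_sub S (integralOp k hk S), coeFn_integralOp hk S, hg.coeFn_toLp]
      with x h4 h5 h6
    rw [← h6, ← h3, h4, Pi.sub_apply, h5]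
  have hres := resolventApply_ae_eq hk hu hg
  have hSm : MemLp S 2 ν := Lp.memLp S
  have hkψ : MemLp (fun y => ∫ x, k x y * ψ x ∂ν) 2 ν := memLp_integral_mul (memLp_swap hk) hψ
  have e1 : resolventPairing ν k (fun y => ψ y - (∫ x, k x y * ψ x ∂ν) - q y) g =
      ∫ y, (ψ y * S y - (∫ x, k x y * ψ x ∂ν) * S y - q y * S y) ∂ν := by
    refine integral_congr_ae ?_
    filter_upwards [hres] with y hy
    rw [hy]; ring
  have e2 : resolventPairing ν k q g = ∫ y, q y * S y ∂ν := by
    refine integral_congr_ae ?_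
    filter_upwards [hres] with y hy
    rw [hy]
  have e3 : ∫ x, ψ x * g x ∂ν = ∫ x, (ψ x * S x - ψ x * ∫ y, k x y * S y ∂ν) ∂ν := by
    refine integral_congr_ae ?_
    filter_upwards [hSg] with y hy
    rw [← hy]; ring
  rw [e1, e2, e3, integral_sub _ (MemLp.integrable_fun_mul hq hSm), integral_sub (MemLp.integrable_fun_mul hψ hSm)
    (MemLp.integrable_fun_mul hkψ hSm), integral_sub (MemLp.integrable_fun_mul hψ hSm)
    (MemLp.integrable_fun_mul hψ (memLp_integral_mul hk hSm)), integral_mul_integral_mul_comm hk hψ hSm]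
  exact (MemLp.integrable_fun_mul hψ hSm).sub (MemLp.integrable_fun_mul hkψ hSm)

end Factor

/-! ### Dominated convergence in `L²` -/

section Convergence

variable {ι : Type*} {l : Filter ι} [l.IsCountablyGenerated] {α : Type*} [MeasurableSpace α]
  {μ : Measure α}

lemma tendsto_integral_sq_sub {F : ι → α → ℝ} {f g : α → ℝ}
    (hF : ∀ᶠ i in l, AEStronglyMeasurable (F i) μ) (hf : AEStronglyMeasurable f μ)
    (hg : MemLp g 2 μ) (hb : ∀ᶠ i in l, ∀ᵐ x ∂μ, |F i x| ≤ g x) (hfb : ∀ᵐ x ∂μ, |f x| ≤ g x)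
    (hlim : ∀ᵐ x ∂μ, Tendsto (fun i => F i x) l (𝓝 (f x))) :
    Tendsto (fun i => ∫ x, (F i x - f x) ^ 2 ∂μ) l (𝓝 0) := by
  have := tendsto_integral_filter_of_dominated_convergence (μ := μ) (l := l)
    (F := fun i x => (F i x - f x) ^ 2) (f := fun _ => 0) (fun x => 4 * g x ^ 2)
    (by filter_upwards [hF] with i hi using (hi.sub hf).pow 2)
    (by
      filter_upwards [hb] with i hi
      filter_upwards [hi, hfb] with x h1 h2
      rw [Real.norm_of_nonneg (sq_nonneg _)]
      have h3 := abs_le.1 h1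
      have h4 := abs_le.1 h2
      nlinarith)
    (hg.integrable_sq.const_mul 4)
    (by
      filter_upwards [hlim] with x hx
      simpa using (hx.sub_const (f x)).pow 2)
  simpa using this

lemma tendsto_toL2 {μ : Measure ℝ} {F : ι → ℝ → ℝ} {f g : ℝ → ℝ}
    (hF : ∀ᶠ i in l, AEStronglyMeasurable (F i) μ) (hf : AEStronglyMeasurable f μ)
    (hg : MemLp g 2 μ) (hb : ∀ᶠ i in l, ∀ᵐ x ∂μ, |F i x| ≤ g x) (hfb : ∀ᵐ x ∂μ, |f x| ≤ g x)
    (hlim : ∀ᵐ x ∂μ, Tendsto (fun i => F i x) l (𝓝 (f x))) :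
    Tendsto (fun i => toL2 μ (F i)) l (𝓝 (toL2 μ f)) := by
  have hfm : MemLp f 2 μ := hg.mono' hf hfb
  rw [tendsto_iff_norm_sub_tendsto_zero]
  have h := (tendsto_integral_sq_sub hF hf hg hb hfb hlim).sqrt
  rw [Real.sqrt_zero] at h
  refine h.congr' ?_
  filter_upwards [hF, hb] with i h1 h2
  have hFm : MemLp (F i) 2 μ := hg.mono' h1 h2
  rw [toL2_of_memLp hFm, toL2_of_memLp hfm, ← MemLp.toLp_sub, ← Real.sqrt_sq (norm_nonneg _),
    MemLp.norm_sq_toLp]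
  rfl

/-- The operator norm is at most the L² norm of the kernel, and the latter tends to zero by
dominated convergence on the product space. -/
lemma tendsto_kernelOp {μ : Measure ℝ} [SFinite μ] {F : ι → ℝ → ℝ → ℝ} {f : ℝ → ℝ → ℝ}
    {g : ℝ × ℝ → ℝ}
    (hF : ∀ᶠ i in l, AEStronglyMeasurable (Function.uncurry (F i)) (μ.prod μ))
    (hf : AEStronglyMeasurable (Function.uncurry f) (μ.prod μ))
    (hg : MemLp g 2 (μ.prod μ))
    (hb : ∀ᶠ i in l, ∀ᵐ p ∂(μ.prod μ), |F i p.1 p.2| ≤ g p)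
    (hfb : ∀ᵐ p ∂(μ.prod μ), |f p.1 p.2| ≤ g p)
    (hlim : ∀ᵐ p ∂(μ.prod μ), Tendsto (fun i => F i p.1 p.2) l (𝓝 (f p.1 p.2))) :
    Tendsto (fun i => kernelOp μ (F i)) l (𝓝 (kernelOp μ f)) := by
  have hfm : MemLp (Function.uncurry f) 2 (μ.prod μ) := hg.mono' hf hfb
  rw [tendsto_iff_norm_sub_tendsto_zero]
  have h := (tendsto_integral_sq_sub hF hf hg hb hfb hlim).sqrt
  rw [Real.sqrt_zero] at h
  refine squeeze_zero' (Eventually.of_forall fun _ => norm_nonneg _) ?_ h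
  filter_upwards [hF, hb] with i h1 h2
  have hFm : MemLp (Function.uncurry (F i)) 2 (μ.prod μ) := hg.mono' h1 h2
  have hd : MemLp (Function.uncurry fun x y => F i x y - f x y) 2 (μ.prod μ) := hFm.sub hfm
  rw [kernelOp_eq_integralOp hFm, kernelOp_eq_integralOp hfm, integralOp_sub hFm hfm hd]
  exact norm_integralOp_le hd

end Convergence

end StationaryTASEP

end


noncomputable section

namespace StationaryTASEP

/-! ### The Airy function -/

/-- The integrand `exp(ξ³/3 - zξ)` of the Airy function on the line `ξ = c + iy`. -/
def airyIntegrand (c : ℝ) (z : ℂ) (y : ℝ) : ℂ :=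
  Complex.exp ((c + y * Complex.I) ^ 3 / 3 - z * (c + y * Complex.I))

lemma norm_airyIntegrand (c : ℝ) (z : ℂ) (y : ℝ) :
    ‖airyIntegrand c z y‖ = Real.exp (c ^ 3 / 3 - c * y ^ 2 - z.re * c + z.im * y) := by
  rw [airyIntegrand, Complex.norm_exp]
  congr 1
  have : ((c + y * Complex.I) ^ 3 / 3 : ℂ) =
      (((c ^ 3 / 3 - c * y ^ 2 : ℝ) : ℂ)) + ((c ^ 2 * y - y ^ 3 / 3 : ℝ) : ℂ) * Complex.I := by
    push_cast
    linear_combination (c * y ^ 2 + y ^ 3 / 3 * Complex.I : ℂ) * Complex.I_sq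
  rw [this, Complex.sub_re, Complex.add_re, Complex.re_ofReal_mul, Complex.ofReal_re, Complex.mul_re]
  simp only [Complex.I_re, mul_zero, add_zero, Complex.add_re, Complex.ofReal_re, Complex.mul_re,
    Complex.ofReal_im, Complex.I_im, Complex.add_im, Complex.mul_im]
  ring

lemma continuous_airyIntegrand (c : ℝ) (z : ℂ) : Continuous (airyIntegrand c z) := by
  unfold airyIntegrand
  fun_prop

lemma norm_airyIntegrand_le {c : ℝ} (hc : 0 < c) (z : ℂ) (y : ℝ) :
    ‖airyIntegrand c z y‖ ≤
      Real.exp (c ^ 3 / 3 - z.re * c + z.im ^ 2 / (2 * c)) * Real.exp (-(c / 2) * y ^ 2) := by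
  rw [norm_airyIntegrand, ← Real.exp_add]
  apply Real.exp_le_exp.2
  -- Completing the square gives up half of the Gaussian decay c y² to absorb the linear term.
  have h : z.im * y ≤ z.im ^ 2 / (2 * c) + c / 2 * y ^ 2 := by
    have : 0 ≤ (z.im - c * y) ^ 2 / (2 * c) := by positivity
    have e : (z.im - c * y) ^ 2 / (2 * c) = z.im ^ 2 / (2 * c) + c / 2 * y ^ 2 - z.im * y := by
      field_simp; ring
    linarith
  nlinarith

lemma integrable_airyIntegrand {c : ℝ} (hc : 0 < c) (z : ℂ) : Integrable (airyIntegrand c z) :=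
  Integrable.mono' ((integrable_exp_neg_mul_sq (half_pos hc)).const_mul _)
    (continuous_airyIntegrand c z).aestronglyMeasurable
    (ae_of_all _ (norm_airyIntegrand_le hc z))

/-- The (complex) integral of `exp(ξ³/3 - xξ)` over the line `Re ξ = c`. -/
def airyLine (c : ℝ) (z : ℂ) : ℂ := ∫ y : ℝ, airyIntegrand c z y

lemma airy_eq (x : ℝ) : airy x = 1 / (2 * Real.pi) * (airyLine 1 x).re := by
  simp [airy, airyLine, airyIntegrand]

/-- Independence of the line of integration, in infinitesimal form: the derivative in c of the
integrand is -i times its derivative in y, which integrates to zero. -/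
lemma hasDerivAt_airyLine {c : ℝ} (hc : 0 < c) (x : ℝ) :
    HasDerivAt (fun c' : ℝ => airyLine c' x) 0 c := by
  set F' : ℝ → ℝ → ℂ := fun c' y =>
    ((c' + y * Complex.I) ^ 2 - x) * airyIntegrand c' x y with hF'
  -- For c' between c/2 and 2c the integrand decays like e^{-cy²/2}; half of this decay absorbs the
  -- quadratic factor, since y² ≤ (4/c)e^{cy²/4}.
  set K : ℝ := (2 * (2 * c) ^ 2 + |x| + 8 / c) * Real.exp ((2 * c) ^ 3 / 3 + |x| * (2 * c)) with hK
  have hd1 : ∀ c' y : ℝ, HasDerivAt (fun c' : ℝ => airyIntegrand c' x y) (F' c' y) c' := by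
    intro c' y
    have h1 : HasDerivAt (fun c' : ℝ => ((c' : ℂ) + y * Complex.I)) 1 c' :=
      (Complex.ofRealCLM.hasDerivAt (x := c')).add_const _
    refine (((h1.fun_pow 3).div_const 3).fun_sub (h1.const_mul (x : ℂ))).cexp.congr_deriv ?_
    simp only [hF', airyIntegrand]
    push_cast
    ring
  have hb : ∀ c' ∈ Ioo (c / 2) (2 * c), ∀ y : ℝ, ‖F' c' y‖ ≤ K * Real.exp (-(c / 4) * y ^ 2) := by
    intro c' hc' y
    obtain ⟨h1, h2⟩ := hc'
    have hc'0 : 0 < c' := by linarith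
    have hz : ‖((c' : ℂ) + y * Complex.I) ^ 2 - x‖ ≤ 2 * (2 * c) ^ 2 + 2 * y ^ 2 + |x| := by
      refine (norm_sub_le _ _).trans ?_
      rw [Complex.norm_real, Real.norm_eq_abs, norm_pow, Complex.sq_norm]
      simp [Complex.normSq_apply]
      nlinarith
    have hy : y ^ 2 ≤ 4 / c * Real.exp (c / 4 * y ^ 2) := by
      have := Real.add_one_le_exp (c / 4 * y ^ 2)
      rw [div_mul_eq_mul_div, le_div_iff₀ hc]
      nlinarith
    have he : ‖airyIntegrand c' x y‖ ≤
        Real.exp ((2 * c) ^ 3 / 3 + |x| * (2 * c)) * Real.exp (-(c / 2) * y ^ 2) := by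
      rw [norm_airyIntegrand, ← Real.exp_add]
      apply Real.exp_le_exp.2
      simp only [Complex.ofReal_re, Complex.ofReal_im]
      have e1 : c' ^ 3 ≤ (2 * c) ^ 3 := pow_le_pow_left₀ hc'0.le h2.le 3
      have e2 : -(x * c') ≤ |x| * (2 * c) := by
        have := neg_abs_le (x)
        nlinarith [abs_nonneg x]
      nlinarith [sq_nonneg y]
    have he1 : 1 ≤ Real.exp (c / 4 * y ^ 2) := Real.one_le_exp (by positivity)
    have e3 : Real.exp (-(c / 4) * y ^ 2) =
        Real.exp (c / 4 * y ^ 2) * Real.exp (-(c / 2) * y ^ 2) := by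
      rw [← Real.exp_add]; congr 1; ring
    rw [hF', norm_mul, e3, hK]
    calc _ ≤ ((2 * (2 * c) ^ 2 + |x| + 8 / c) * Real.exp (c / 4 * y ^ 2)) *
        (Real.exp ((2 * c) ^ 3 / 3 + |x| * (2 * c)) * Real.exp (-(c / 2) * y ^ 2)) := by
          refine mul_le_mul (hz.trans ?_) he (norm_nonneg _) (by positivity)
          have : (8 / c) = 2 * (4 / c) := by ring
          rw [this]
          nlinarith [abs_nonneg x, sq_nonneg c]
      _ = _ := by ring
  have hbi : Integrable (fun y : ℝ => K * Real.exp (-(c / 4) * y ^ 2)) :=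
    (integrable_exp_neg_mul_sq (by positivity)).const_mul _
  have hmem : c ∈ Ioo (c / 2) (2 * c) := ⟨by linarith, by linarith⟩
  have hF'c : Continuous (F' c) := by
    simp only [hF']
    have := continuous_airyIntegrand c x
    fun_prop
  have key := hasDerivAt_integral_of_dominated_loc_of_deriv_le (μ := volume)
    (F := fun c' y => airyIntegrand c' x y) (F' := F') (x₀ := c)
    (bound := fun y => K * Real.exp (-(c / 4) * y ^ 2))
    (Ioo_mem_nhds hmem.1 hmem.2)
    (Eventually.of_forall fun c' => (continuous_airyIntegrand c' x).aestronglyMeasurable)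
    (integrable_airyIntegrand hc x) hF'c.aestronglyMeasurable
    (ae_of_all _ fun y c' hc' => hb c' hc' y) hbi
    (ae_of_all _ fun y c' _ => hd1 c' y)
  have hzero : ∫ y, F' c y = 0 := by
    have h1 : ∀ y : ℝ, HasDerivAt (fun y : ℝ => airyIntegrand c x y) (Complex.I * F' c y) y := by
      intro y
      have h1 : HasDerivAt (fun y : ℝ => ((c : ℂ) + y * Complex.I)) (1 * Complex.I) y :=
        ((Complex.ofRealCLM.hasDerivAt (x := y)).mul_const _).const_add _
      refine (((h1.fun_pow 3).div_const 3).fun_sub (h1.const_mul (x : ℂ))).cexp.congr_deriv ?_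
      simp only [hF', airyIntegrand]
      push_cast
      ring
    have := integral_eq_zero_of_hasDerivAt_of_integrable h1 (key.1.const_mul _)
      (integrable_airyIntegrand hc x)
    rw [integral_const_mul] at this
    simpa using this
  simpa [hzero, airyLine] using key.2

lemma airyLine_eq {c c' : ℝ} (hc : 0 < c) (hc' : 0 < c') (x : ℝ) :
    airyLine c x = airyLine c' x := by
  refine isOpen_Ioi.is_const_of_deriv_eq_zero (f := fun c' : ℝ => airyLine c' x) (s := Ioi 0)
    isPreconnected_Ioi ?_ ?_ hc hc'
  · exact fun y hy => (hasDerivAt_airyLine hy x).differentiableAt.differentiableWithinAt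
  · exact fun y hy => (hasDerivAt_airyLine hy x).deriv

/-- Conjugation corresponds to y ↦ -y, so the integral is real and taking the real part in the
definition loses nothing. The line may then be moved to any c > 0. -/
lemma ofReal_airy {c : ℝ} (hc : 0 < c) (x : ℝ) :
    (airy x : ℂ) = 1 / (2 * Real.pi) * airyLine c x := by
  have hreal : (starRingEnd ℂ) (airyLine 1 x) = airyLine 1 x := by
    rw [airyLine, ← integral_conj, ← integral_neg_eq_self]
    refine integral_congr_ae (ae_of_all _ fun y => ?_)
    simp only [airyIntegrand]
    rw [← Complex.exp_conj]
    congr 1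
    simp [show (starRingEnd ℂ) 3 = 3 from map_ofNat _ 3]
  rw [airyLine_eq hc one_pos, airy_eq]
  push_cast
  rw [Complex.conj_eq_iff_re.1 hreal]

/-- The exponential bound for the Airy function obtained from the line `Re ξ = c`. -/
lemma abs_airy_le {c : ℝ} (hc : 0 < c) :
    ∃ C, 0 < C ∧ ∀ x, |airy x| ≤ C * Real.exp (-c * x) := by
  refine ⟨1 / (2 * Real.pi) * (Real.exp (c ^ 3 / 3) * ∫ y : ℝ, Real.exp (-(c / 2) * y ^ 2)), ?_, ?_⟩
  · have : 0 < ∫ y : ℝ, Real.exp (-(c / 2) * y ^ 2) := by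
      rw [integral_gaussian]; positivity
    positivity
  intro x
  rw [← Real.norm_eq_abs, ← Complex.norm_real, ofReal_airy hc, norm_mul]
  have h : ‖airyLine c x‖ ≤
      Real.exp (c ^ 3 / 3) * (∫ y : ℝ, Real.exp (-(c / 2) * y ^ 2)) * Real.exp (-c * x) := by
    refine (norm_integral_le_integral_norm _).trans ?_
    calc _ ≤ ∫ y : ℝ, Real.exp (c ^ 3 / 3 - x * c) * Real.exp (-(c / 2) * y ^ 2) := by
          refine integral_mono (integrable_airyIntegrand hc x).norm
            ((integrable_exp_neg_mul_sq (half_pos hc)).const_mul _) fun y => ?_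
          simpa using norm_airyIntegrand_le hc x y
      _ = _ := by
          rw [integral_const_mul, sub_eq_add_neg, Real.exp_add,
            show -(x * c) = -c * x by ring]
          ring
  have hn : ‖(1 / (2 * Real.pi) : ℂ)‖ = 1 / (2 * Real.pi) := by
    simp [abs_of_pos Real.pi_pos]
  rw [hn, mul_assoc]
  exact mul_le_mul_of_nonneg_left h (by positivity)

lemma continuous_airy : Continuous airy := by
  have h : Continuous fun x : ℝ => airyLine 1 x := by
    refine continuous_iff_continuousAt.2 fun x₀ => ?_
    refine continuousAt_of_dominated
      (bound := fun y => Real.exp (1 / 3 + |x₀| + 1) * Real.exp (-(1 / 2) * y ^ 2))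
      (Eventually.of_forall fun x => (continuous_airyIntegrand 1 x).aestronglyMeasurable) ?_
      ((integrable_exp_neg_mul_sq (by norm_num)).const_mul _) (ae_of_all _ fun y => ?_)
    · filter_upwards [Metric.ball_mem_nhds x₀ one_pos] with x hx
      refine ae_of_all _ fun y => (norm_airyIntegrand_le one_pos x y).trans ?_
      refine mul_le_mul_of_nonneg_right (Real.exp_le_exp.2 ?_) (Real.exp_nonneg _)
      rw [Metric.mem_ball, Real.dist_eq, abs_lt] at hx
      simp
      linarith [neg_abs_le x₀]
    · simp only [airyIntegrand]
      fun_prop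
  have : airy = fun x : ℝ => 1 / (2 * Real.pi) * (airyLine 1 x).re := funext airy_eq
  rw [this]
  fun_prop

end StationaryTASEP

end


/-! ### Laplace–Fourier transform, first moment and Parseval identity for the Airy function -/

noncomputable section

namespace StationaryTASEP

open FourierTransform

lemma integrable_exp_neg_mul_abs {c : ℝ} (hc : 0 < c) :
    Integrable fun x : ℝ => Real.exp (-c * |x|) := by
  have h1 : IntegrableOn (fun x : ℝ => Real.exp (-c * |x|)) (Iic 0) :=
    (integrableOn_exp_mul_Iic hc 0).congr_fun
      (fun x hx => by simp only; rw [abs_of_nonpos hx]; congr 1; ring) measurableSet_Iic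
  have h2 : IntegrableOn (fun x : ℝ => Real.exp (-c * |x|)) (Ioi 0) :=
    (integrableOn_exp_mul_Ioi (neg_neg_of_pos hc) 0).congr_fun
      (fun x hx => by simp only; rw [abs_of_pos hx]) measurableSet_Ioi
  have := h1.union h2
  rwa [Iic_union_Ioi, integrableOn_univ] at this

/-- The lines Re ξ = c/2 for x ≤ 0 and Re ξ = 3c/2 for x ≥ 0 give decay of e^{cx}Ai(x) at both ends.
-/
lemma abs_airy_le_two_sided {c : ℝ} (hc : 0 < c) :
    ∃ C, 0 < C ∧ ∀ x, |airy x| ≤ C * (Real.exp (-c * x) * Real.exp (-(c / 2) * |x|)) := by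
  obtain ⟨C₁, h1, hC₁⟩ := abs_airy_le (half_pos hc)
  obtain ⟨C₂, h2, hC₂⟩ := abs_airy_le (c := 3 * c / 2) (by positivity)
  refine ⟨max C₁ C₂, lt_max_of_lt_left h1, fun x => ?_⟩
  rw [← Real.exp_add]
  rcases le_total x 0 with hx | hx
  · refine (hC₁ x).trans (mul_le_mul (le_max_left _ _) (le_of_eq ?_) (Real.exp_nonneg _)
      (le_max_of_le_left h1.le))
    rw [abs_of_nonpos hx]; congr 1; ring
  · refine (hC₂ x).trans (mul_le_mul (le_max_right _ _) (le_of_eq ?_) (Real.exp_nonneg _)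
      (le_max_of_le_left h1.le))
    rw [abs_of_nonneg hx]; congr 1; ring

lemma exp_mul_airy_le {c : ℝ} (hc : 0 < c) :
    ∃ C, 0 < C ∧ ∀ x, |Real.exp (c * x) * airy x| ≤ C * Real.exp (-(c / 2) * |x|) := by
  obtain ⟨C, h0, hC⟩ := abs_airy_le_two_sided hc
  refine ⟨C, h0, fun x => ?_⟩
  rw [abs_mul, abs_of_pos (Real.exp_pos _)]
  calc _ ≤ Real.exp (c * x) * (C * (Real.exp (-c * x) * Real.exp (-(c / 2) * |x|))) :=
        mul_le_mul_of_nonneg_left (hC x) (Real.exp_nonneg _)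
    _ = C * (Real.exp (c * x) * Real.exp (-c * x)) * Real.exp (-(c / 2) * |x|) := by ring
    _ = _ := by rw [← Real.exp_add]; simp

lemma integrable_exp_mul_airy {c : ℝ} (hc : 0 < c) :
    Integrable fun x => Real.exp (c * x) * airy x := by
  obtain ⟨C, h0, hC⟩ := exp_mul_airy_le hc
  have := continuous_airy
  exact ((integrable_exp_neg_mul_abs (half_pos hc)).const_mul C).mono'
    (by fun_prop : Continuous fun x => Real.exp (c * x) * airy x).aestronglyMeasurable
    (ae_of_all _ hC)

lemma ofReal_exp_mul_airy {c : ℝ} (hc : 0 < c) (x : ℝ) :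
    ((Real.exp (c * x) * airy x : ℝ) : ℂ) =
      1 / (2 * Real.pi) * ∫ y : ℝ, Complex.exp (-(x * y * Complex.I)) * airyIntegrand c 0 y := by
  push_cast
  rw [ofReal_airy hc, mul_left_comm, airyLine, ← integral_const_mul]
  congr 2
  funext y
  simp only [airyIntegrand]
  rw [← Complex.exp_add, ← Complex.exp_add]
  congr 1
  ring

/-- The Laplace–Fourier transform of the Airy function. -/
lemma integral_cexp_mul_airy {c : ℝ} (hc : 0 < c) (y : ℝ) :
    ∫ x : ℝ, Complex.exp (x * y * Complex.I) * ((Real.exp (c * x) * airy x : ℝ) : ℂ) =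
      airyIntegrand c 0 y := by
  set G : ℝ → ℂ := airyIntegrand c 0 with hG
  have hGi : Integrable G := integrable_airyIntegrand hc 0
  have hF : 𝓕 G = fun ξ : ℝ =>
      (2 * Real.pi : ℂ) * ((Real.exp (c * (2 * Real.pi * ξ)) * airy (2 * Real.pi * ξ) : ℝ) : ℂ) := by
    funext ξ
    have hpi : (Real.pi : ℂ) ≠ 0 := by exact_mod_cast Real.pi_ne_zero
    rw [Real.fourier_real_eq_integral_exp_smul, ofReal_exp_mul_airy hc, ← mul_assoc]
    rw [show (2 * Real.pi : ℂ) * (1 / (2 * Real.pi)) = 1 by field_simp, one_mul]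
    refine integral_congr_ae (ae_of_all _ fun v => ?_)
    simp only [smul_eq_mul]
    congr 2
    push_cast
    ring
  -- Fourier inversion needs an integrable transform; here that is integrability of e^{cx}Ai(x).
  have hFi : Integrable (𝓕 G) := by
    rw [hF]
    exact (((integrable_exp_mul_airy hc).comp_mul_left' (by positivity)).ofReal).const_mul _
  have hinv := congrFun ((continuous_airyIntegrand c 0).fourierInv_fourier_eq hGi hFi) y
  rw [Real.fourierInv_eq', hF] at hinv
  rw [hG, ← hinv]
  have := Measure.integral_comp_mul_left (fun x : ℝ => (2 * Real.pi : ℂ) *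
    (Complex.exp (x * y * Complex.I) * ((Real.exp (c * x) * airy x : ℝ) : ℂ))) (2 * Real.pi)
  have hpi : (2 * Real.pi : ℂ) ≠ 0 := by simp [Real.pi_ne_zero]
  rw [integral_const_mul (2 * Real.pi : ℂ) (fun x : ℝ => Complex.exp (x * y * Complex.I) *
      ((Real.exp (c * x) * airy x : ℝ) : ℂ)), abs_of_pos (by positivity), Complex.real_smul,
    Complex.ofReal_inv, Complex.ofReal_mul, Complex.ofReal_ofNat, inv_mul_cancel_left₀ hpi] at this
  rw [← this]
  refine integral_congr_ae (ae_of_all _ fun v => ?_)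
  simp only [smul_eq_mul]
  rw [mul_left_comm]
  congr 3
  simp
  ring

lemma integral_exp_mul_airy {c : ℝ} (hc : 0 < c) :
    ∫ x : ℝ, Real.exp (c * x) * airy x = Real.exp (c ^ 3 / 3) := by
  have := integral_cexp_mul_airy hc 0
  simp only [Complex.ofReal_zero, mul_zero, zero_mul, Complex.exp_zero, one_mul] at this
  rw [integral_complex_ofReal] at this
  simp only [airyIntegrand, Complex.ofReal_zero, zero_mul, add_zero, sub_zero] at this
  exact_mod_cast this

lemma abs_le_exp_mul_abs {ε : ℝ} (hε : 0 < ε) (x : ℝ) : |x| ≤ ε⁻¹ * Real.exp (ε * |x|) := by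
  have := Real.add_one_le_exp (ε * |x|)
  rw [inv_mul_eq_div, le_div_iff₀ hε]
  linarith

/-- Differentiation of ∫e^{cx}Ai(x)dx = e^{c³/3} in c. The first moment is what identifies S_{w,s}
with a double integral over negative half lines. -/
lemma integral_id_mul_exp_mul_airy {c : ℝ} (hc : 0 < c) :
    Integrable (fun x : ℝ => x * (Real.exp (c * x) * airy x)) ∧
    ∫ x : ℝ, x * (Real.exp (c * x) * airy x) = c ^ 2 * Real.exp (c ^ 3 / 3) := by
  have hcont := continuous_airy
  obtain ⟨C, h0, hC⟩ := exp_mul_airy_le hc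
  -- Of the decay rate c/2, one share c/8 pays for moving c' and another c/8 for the factor x,
  -- leaving c/4.
  have hb : ∀ c' ∈ Ioo (c - c / 8) (c + c / 8), ∀ x : ℝ,
      ‖x * (Real.exp (c' * x) * airy x)‖ ≤ (c / 8)⁻¹ * C * Real.exp (-(c / 4) * |x|) := by
    intro c' hc' x
    have e1 : (c' - c) * x ≤ c / 8 * |x| := by
      refine (le_abs_self _).trans ?_
      rw [abs_mul]
      refine mul_le_mul_of_nonneg_right (abs_le.2 ⟨?_, ?_⟩) (abs_nonneg _) <;>
        linarith [hc'.1, hc'.2]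
    calc ‖x * (Real.exp (c' * x) * airy x)‖
        = |x| * (Real.exp ((c' - c) * x) * |Real.exp (c * x) * airy x|) := by
          rw [Real.norm_eq_abs, abs_mul, abs_mul, abs_mul, abs_of_pos (Real.exp_pos _),
            abs_of_pos (Real.exp_pos _), ← mul_assoc (Real.exp _), ← Real.exp_add]
          congr 4; ring
      _ ≤ ((c / 8)⁻¹ * Real.exp (c / 8 * |x|)) *
          (Real.exp (c / 8 * |x|) * (C * Real.exp (-(c / 2) * |x|))) := by
          refine mul_le_mul (abs_le_exp_mul_abs (by positivity) x) ?_ (by positivity)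
            (by positivity)
          exact mul_le_mul (Real.exp_le_exp.2 e1) (hC x) (abs_nonneg _) (Real.exp_nonneg _)
      _ = (c / 8)⁻¹ * C * (Real.exp (c / 8 * |x|) * Real.exp (c / 8 * |x|) *
          Real.exp (-(c / 2) * |x|)) := by ring
      _ = _ := by
          rw [← Real.exp_add, ← Real.exp_add]; congr 2; ring
  have key := hasDerivAt_integral_of_dominated_loc_of_deriv_le (μ := volume)
    (F := fun (c' : ℝ) (x : ℝ) => Real.exp (c' * x) * airy x)
    (F' := fun (c' : ℝ) (x : ℝ) => x * (Real.exp (c' * x) * airy x)) (x₀ := c)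
    (bound := fun x => (c / 8)⁻¹ * C * Real.exp (-(c / 4) * |x|))
    (Ioo_mem_nhds (by linarith) (by linarith))
    (Eventually.of_forall fun c' =>
      (by fun_prop : Continuous fun x => Real.exp (c' * x) * airy x).aestronglyMeasurable)
    (integrable_exp_mul_airy hc)
    (by fun_prop : Continuous fun x => x * (Real.exp (c * x) * airy x)).aestronglyMeasurable
    (ae_of_all _ fun x c' hc' => hb c' hc' x)
    ((integrable_exp_neg_mul_abs (by positivity)).const_mul _)
    (ae_of_all _ fun x c' _ => by
      have := (((hasDerivAt_id c').mul_const x).exp.mul_const (airy x))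
      refine this.congr_deriv ?_
      simp only [id, one_mul]
      ring)
  refine ⟨key.1, ?_⟩
  have h2 : HasDerivAt (fun c' : ℝ => Real.exp (c' ^ 3 / 3)) (c ^ 2 * Real.exp (c ^ 3 / 3)) c := by
    refine (((hasDerivAt_id c).fun_pow 3).div_const 3).exp.congr_deriv ?_
    simp only [id]
    push_cast
    ring
  refine key.2.unique (h2.congr_of_eventuallyEq ?_)
  filter_upwards [Ioi_mem_nhds hc] with c' hc'
  exact integral_exp_mul_airy hc'

/-- Parseval's identity for two shifted Airy functions. -/
lemma integral_exp_mul_airy_mul_airy {c : ℝ} (hc : 0 < c) (x y : ℝ) :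
    ∫ z : ℝ, Real.exp (2 * c * z) * (airy (z + x) * airy (z + y)) =
      Real.exp (2 * c ^ 3 / 3 - c * (x + y)) *
        (√(1 / (8 * Real.pi * c)) * Real.exp (-(1 / (8 * c)) * (x - y) ^ 2)) := by
  set G : ℝ → ℂ := airyIntegrand c 0 with hG
  have hGi : Integrable G := integrable_airyIntegrand hc 0
  set a : ℝ → ℂ := fun z => ((Real.exp (c * z) * airy z : ℝ) : ℂ) with ha
  have hai : Integrable a := (integrable_exp_mul_airy hc).ofReal
  -- The cubic phases at η and -η cancel, so only a Gaussian remains.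
  have hGG : ∀ η : ℝ, G η * G (-η) = Complex.exp (2 * c ^ 3 / 3) *
      Complex.exp (-(2 * c : ℝ) * (η : ℂ) ^ 2) := by
    intro η
    simp only [hG, airyIntegrand]
    rw [← Complex.exp_add, ← Complex.exp_add]
    congr 1
    push_cast
    linear_combination (2 * c * η ^ 2 : ℂ) * Complex.I_sq
  have hpi : (Real.pi : ℂ) ≠ 0 := by exact_mod_cast Real.pi_ne_zero
  have step1 : (∫ z : ℝ, a (z + x) * a (z + y)) =
      1 / (2 * Real.pi) * ∫ η : ℝ, (Complex.exp (-(x * η * Complex.I)) * G η) *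
        ∫ z : ℝ, Complex.exp (-(z * η * Complex.I)) * a (z + y) := by
    have e1 : ∀ z : ℝ, a (z + x) * a (z + y) = 1 / (2 * Real.pi) *
        ∫ η : ℝ, (Complex.exp (-((z + x : ℝ) * η * Complex.I)) * G η) * a (z + y) := by
      intro z
      rw [integral_mul_const, ← mul_assoc]
      congr 1
      exact ofReal_exp_mul_airy hc (z + x)
    simp_rw [e1, ← integral_const_mul (μ := volume) (1 / (2 * (Real.pi : ℂ)))]
    have hb : Integrable (fun p : ℝ × ℝ => Complex.exp (-((p.1 + x : ℝ) * p.2 * Complex.I)) *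
        (a (p.1 + y) * G p.2)) (volume.prod volume) := by
      refine Integrable.bdd_mul (c := 1) ((hai.comp_add_right y).mul_prod hGi) ?_ ?_
      · exact (by fun_prop : Continuous fun p : ℝ × ℝ =>
          Complex.exp (-((p.1 + x : ℝ) * p.2 * Complex.I))).aestronglyMeasurable
      · refine ae_of_all _ fun p => ?_
        rw [Complex.norm_exp]
        simp
    rw [integral_integral_swap]
    · refine integral_congr_ae (ae_of_all _ fun η => ?_)
      simp only
      rw [← integral_const_mul, ← integral_const_mul]
      refine integral_congr_ae (ae_of_all _ fun z => ?_)
      simp only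
      rw [show -(((z + x : ℝ) : ℂ) * η * Complex.I) = -(x * η * Complex.I) + -(z * η * Complex.I) by
        push_cast; ring, Complex.exp_add]
      ring
    · refine (hb.const_mul (1 / (2 * (Real.pi : ℂ)))).congr (ae_of_all _ fun p => ?_)
      simp only [Function.uncurry]
      ring
  have step2 : ∀ η : ℝ, ∫ z : ℝ, Complex.exp (-(z * η * Complex.I)) * a (z + y) =
      Complex.exp (y * η * Complex.I) * G (-η) := by
    intro η
    rw [hG, ← integral_cexp_mul_airy hc (-η), ← integral_const_mul,
      ← integral_add_right_eq_self (fun z : ℝ => Complex.exp (y * η * Complex.I) *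
        (Complex.exp (z * (-η : ℝ) * Complex.I) * ((Real.exp (c * z) * airy z : ℝ) : ℂ))) y]
    refine integral_congr_ae (ae_of_all _ fun z => ?_)
    simp only [ha]
    rw [← mul_assoc, ← Complex.exp_add]
    congr 2
    push_cast
    ring
  have hL : (∫ z : ℝ, a (z + x) * a (z + y)) = ((Real.exp (c * (x + y)) *
      ∫ z : ℝ, Real.exp (2 * c * z) * (airy (z + x) * airy (z + y)) : ℝ) : ℂ) := by
    rw [← integral_const_mul, ← integral_complex_ofReal]
    refine integral_congr_ae (ae_of_all _ fun z => ?_)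
    simp only [ha]
    rw [← Complex.ofReal_mul]
    congr 1
    rw [show c * (z + x) = c * x + c * z by ring, show c * (z + y) = c * y + c * z by ring,
      show 2 * c * z = c * z + c * z by ring, show c * (x + y) = c * x + c * y by ring]
    simp only [Real.exp_add]
    ring
  have hR : (∫ z : ℝ, a (z + x) * a (z + y)) = ((Real.exp (2 * c ^ 3 / 3) *
        (√(1 / (8 * Real.pi * c)) * Real.exp (-(1 / (8 * c)) * (x - y) ^ 2)) : ℝ) : ℂ) := by
    rw [step1]
    have e2 : ∀ η : ℝ, (Complex.exp (-(x * η * Complex.I)) * G η) *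
        ∫ z : ℝ, Complex.exp (-(z * η * Complex.I)) * a (z + y) =
        Complex.exp (2 * c ^ 3 / 3) * (Complex.exp (Complex.I * ((y - x : ℝ) : ℂ) * η) *
          Complex.exp (-(2 * c : ℝ) * (η : ℂ) ^ 2)) := by
      intro η
      rw [step2, mul_mul_mul_comm, hGG, ← Complex.exp_add, mul_left_comm]
      congr 3
      push_cast
      ring
    simp_rw [e2]
    rw [integral_const_mul, fourierIntegral_gaussian (by simpa using hc)]
    have e3 : ((Real.pi : ℂ) / ((2 * c : ℝ) : ℂ)) ^ (1 / 2 : ℂ) =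
        ((2 * Real.pi * √(1 / (8 * Real.pi * c)) : ℝ) : ℂ) := by
      rw [← Complex.ofReal_div, show (1 / 2 : ℂ) = ((1 / 2 : ℝ) : ℂ) by push_cast; rfl,
        ← Complex.ofReal_cpow (by positivity), ← Real.sqrt_eq_rpow]
      congr 1
      rw [show Real.pi / (2 * c) = (2 * Real.pi) ^ 2 * (1 / (8 * Real.pi * c)) by
        field_simp; ring, Real.sqrt_mul (by positivity), Real.sqrt_sq (by positivity)]
    rw [e3]
    push_cast
    rw [show -((y : ℂ) - x) ^ 2 / (4 * (2 * c)) = -(1 / (8 * c)) * (x - y) ^ 2 by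
      have : (c : ℂ) ≠ 0 := by exact_mod_cast hc.ne'
      field_simp; ring]
    field_simp
  have hfin := hL.symm.trans hR
  rw [Complex.ofReal_inj] at hfin
  rw [sub_eq_add_neg, Real.exp_add, mul_assoc, mul_left_comm, ← hfin, ← mul_assoc, ← Real.exp_add]
  simp

end StationaryTASEP

end


noncomputable section

namespace StationaryTASEP

/-! ### Exponential bounds on the half line -/

/-- Lebesgue measure on `[0,∞)`. -/
abbrev halfLine : Measure ℝ := volume.restrict (Ici 0)

lemma ae_halfLine : ∀ᵐ x ∂halfLine, 0 ≤ x := ae_restrict_mem measurableSet_Ici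

lemma ae_halfLine_prod : ∀ᵐ p ∂(halfLine.prod halfLine), 0 ≤ p.1 ∧ 0 ≤ p.2 := by
  rw [Measure.prod_restrict]
  exact ae_restrict_mem (measurableSet_Ici.prod measurableSet_Ici)

lemma integrable_exp_halfLine {κ : ℝ} (hκ : 0 < κ) :
    Integrable (fun x => Real.exp (-κ * x)) halfLine := by
  rw [halfLine, ← restrict_Ioi_eq_restrict_Ici]
  exact integrableOn_exp_mul_Ioi (neg_neg_of_pos hκ) 0

lemma memLp_exp_halfLine {κ : ℝ} (hκ : 0 < κ) : MemLp (fun x => Real.exp (-κ * x)) 2 halfLine := by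
  rw [memLp_two_iff_integrable_sq (by fun_prop : Continuous _).aestronglyMeasurable]
  refine (integrable_exp_halfLine (κ := 2 * κ) (by positivity)).congr (ae_of_all _ fun x => ?_)
  simp only
  rw [← Real.exp_nat_mul]
  congr 1
  push_cast
  ring

lemma memLp_exp_halfLine_prod {κ : ℝ} (hκ : 0 < κ) (C : ℝ) :
    MemLp (fun p : ℝ × ℝ => C * (Real.exp (-κ * p.1) * Real.exp (-κ * p.2))) 2
      (halfLine.prod halfLine) :=
  (memLp_two_mul_prod (memLp_exp_halfLine hκ) (memLp_exp_halfLine hκ)).const_mul C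

lemma memLp_halfLine_of_bound {f : ℝ → ℝ} (hf : AEStronglyMeasurable f halfLine) {C κ : ℝ}
    (hκ : 0 < κ) (h : ∀ x, 0 ≤ x → |f x| ≤ C * Real.exp (-κ * x)) : MemLp f 2 halfLine :=
  ((memLp_exp_halfLine hκ).const_mul C).mono' hf (ae_halfLine.mono fun x hx => h x hx)

lemma integrable_halfLine_of_bound {f : ℝ → ℝ} (hf : AEStronglyMeasurable f halfLine) {C κ : ℝ}
    (hκ : 0 < κ) (h : ∀ x, 0 ≤ x → |f x| ≤ C * Real.exp (-κ * x)) : Integrable f halfLine :=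
  ((integrable_exp_halfLine hκ).const_mul C).mono' hf (ae_halfLine.mono fun x hx => h x hx)

lemma memLp_kernel_of_bound {k : ℝ → ℝ → ℝ}
    (hk : AEStronglyMeasurable (Function.uncurry k) (halfLine.prod halfLine)) {C κ : ℝ}
    (hκ : 0 < κ)
    (h : ∀ x y, 0 ≤ x → 0 ≤ y → |k x y| ≤ C * (Real.exp (-κ * x) * Real.exp (-κ * y))) :
    MemLp (Function.uncurry k) 2 (halfLine.prod halfLine) :=
  (memLp_exp_halfLine_prod hκ C).mono' hk
    (ae_halfLine_prod.mono fun p hp => h p.1 p.2 hp.1 hp.2)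

lemma abs_airy_add_le {κ : ℝ} (hκ : 0 < κ) (q : ℝ) : ∃ C, 0 < C ∧ ∀ x y : ℝ,
    |airy (q + x + y)| ≤ C * (Real.exp (-κ * x) * Real.exp (-κ * y)) := by
  obtain ⟨C, h0, hC⟩ := abs_airy_le hκ
  refine ⟨C * Real.exp (-κ * q), by positivity, fun x y => (hC _).trans (le_of_eq ?_)⟩
  rw [mul_assoc, ← Real.exp_add, ← Real.exp_add]
  congr 2; ring

lemma memLp_airyShift (q : ℝ) :
    MemLp (Function.uncurry fun x y => airy (q + x + y)) 2 (halfLine.prod halfLine) := by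
  obtain ⟨C, -, hC⟩ := abs_airy_add_le one_pos q
  have := continuous_airy
  refine memLp_kernel_of_bound ?_ one_pos fun x y _ _ => hC x y
  exact (by unfold Function.uncurry; fun_prop :
    Continuous (Function.uncurry fun x y => airy (q + x + y))).aestronglyMeasurable

/-! ### The truncated Airy transform -/

/-- `F(z) = ∫_0^∞ Ai(q+z+x) f(x) dx`. -/
def airyTransform (q : ℝ) (f : ℝ → ℝ) (z : ℝ) : ℝ := ∫ x, airy (q + z + x) * f x ∂halfLine

/-- The centred Gaussian density of variance `4c`. -/
def gaussDensity (c x : ℝ) : ℝ := √(1 / (8 * Real.pi * c)) * Real.exp (-(1 / (8 * c)) * x ^ 2)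

lemma gaussDensity_nonneg (c x : ℝ) : 0 ≤ gaussDensity c x := by
  unfold gaussDensity; positivity

lemma continuous_gaussDensity (c : ℝ) : Continuous (gaussDensity c) := by
  unfold gaussDensity; fun_prop

lemma integrable_gaussDensity {c : ℝ} (hc : 0 < c) : Integrable (gaussDensity c) :=
  (integrable_exp_neg_mul_sq (by positivity)).const_mul _

lemma integral_gaussDensity {c : ℝ} (hc : 0 < c) : ∫ x, gaussDensity c x = 1 := by
  unfold gaussDensity
  rw [integral_const_mul, integral_gaussian, ← Real.sqrt_mul (by positivity)]
  rw [show 1 / (8 * Real.pi * c) * (Real.pi / (1 / (8 * c))) = 1 by field_simp, Real.sqrt_one]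

/-- Each row of the kernel is a probability density, and restriction to the half line can only lose
mass. This is the Schur bound behind the contraction property of the Airy transform. -/
lemma integral_sq_mul_gaussDensity {c : ℝ} (hc : 0 < c) {f : ℝ → ℝ} (hf : MemLp f 2 halfLine) :
    Integrable (fun p : ℝ × ℝ => f p.1 ^ 2 * gaussDensity c (p.1 - p.2)) (halfLine.prod halfLine) ∧
    ∫ p, f p.1 ^ 2 * gaussDensity c (p.1 - p.2) ∂(halfLine.prod halfLine) ≤
      ∫ x, f x ^ 2 ∂halfLine := by
  have hg := continuous_gaussDensity c
  have hm : AEStronglyMeasurable (fun p : ℝ × ℝ => f p.1 ^ 2 * gaussDensity c (p.1 - p.2))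
      (halfLine.prod halfLine) :=
    (hf.1.comp_fst.pow 2).mul (by fun_prop : Continuous fun p : ℝ × ℝ =>
      gaussDensity c (p.1 - p.2)).aestronglyMeasurable
  have hint : ∀ x, Integrable (fun y => gaussDensity c (x - y)) := fun x =>
    (integrable_gaussDensity hc).comp_sub_left x
  have hle : ∀ x, ∫ y, gaussDensity c (x - y) ∂halfLine ≤ 1 := fun x => by
    refine (setIntegral_le_integral (hint x)
      (ae_of_all _ fun y => gaussDensity_nonneg _ _)).trans ?_
    rw [integral_sub_left_eq_self (gaussDensity c), integral_gaussDensity hc]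
  have hin : ∀ x, ∫ y, f x ^ 2 * gaussDensity c (x - y) ∂halfLine ≤ f x ^ 2 := fun x => by
    rw [integral_const_mul]
    exact mul_le_of_le_one_right (sq_nonneg _) (hle x)
  have hI : Integrable (fun p : ℝ × ℝ => f p.1 ^ 2 * gaussDensity c (p.1 - p.2))
      (halfLine.prod halfLine) := by
    rw [integrable_prod_iff hm]
    refine ⟨ae_of_all _ fun x => ((hint x).restrict (s := Ici 0)).const_mul (f x ^ 2), ?_⟩
    refine hf.integrable_sq.mono' hm.norm.integral_prod_right' (ae_of_all _ fun x => ?_)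
    rw [Real.norm_of_nonneg (integral_nonneg fun _ => norm_nonneg _)]
    refine le_trans (le_of_eq (integral_congr_ae (ae_of_all _ fun y => ?_))) (hin x)
    exact Real.norm_of_nonneg (mul_nonneg (sq_nonneg _) (gaussDensity_nonneg _ _))
  refine ⟨hI, ?_⟩
  rw [integral_prod _ hI]
  exact integral_mono hI.integral_prod_left hf.integrable_sq hin

/-- Weighted `L²` bound for the truncated Airy transform. -/
lemma integral_exp_mul_airyTransform_sq_le {c : ℝ} (hc : 0 < c) (q : ℝ) {f : ℝ → ℝ}
    (hf : MemLp f 2 halfLine) :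
    Integrable (fun z => Real.exp (2 * c * z) * airyTransform q f z ^ 2) ∧
    ∫ z, Real.exp (2 * c * z) * airyTransform q f z ^ 2 ≤
      Real.exp (2 * c ^ 3 / 3 - 2 * c * q) * ∫ x, f x ^ 2 ∂halfLine := by
  have hcont := continuous_airy
  -- The square of the transform is written as a double integral, so that the z-integral can be done
  -- first by Parseval.
  set Θ : ℝ × (ℝ × ℝ) → ℝ := fun r => Real.exp (2 * c * r.1) *
    ((airy (q + r.1 + r.2.1) * f r.2.1) * (airy (q + r.1 + r.2.2) * f r.2.2)) with hΘ
  obtain ⟨C, hC0, hC⟩ := abs_airy_le_two_sided hc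
  set D : ℝ := C * Real.exp (c / 2 * |q| - c * q) with hD
  have hbd : ∀ z x : ℝ, 0 ≤ x → |airy (q + z + x)| ≤
      D * Real.exp (-c * z) * Real.exp (-(c / 2) * |z|) * Real.exp (-(c / 2) * x) := by
    intro z x hx
    refine (hC _).trans ?_
    rw [hD, mul_assoc, mul_assoc, mul_assoc]
    refine mul_le_mul_of_nonneg_left ?_ hC0.le
    rw [← Real.exp_add, ← Real.exp_add, ← Real.exp_add, ← Real.exp_add]
    apply Real.exp_le_exp.2
    have h1 : |z| ≤ |q + z + x| + |q| + x := by
      calc |z| = |(q + z + x) - q - x| := by congr 1; ring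
        _ ≤ |q + z + x| + |q| + |x| := by
          refine (abs_sub _ _).trans (add_le_add_left (abs_sub _ _) _)
        _ = _ := by rw [abs_of_nonneg hx]
    nlinarith
  have hfe : Integrable (fun x => Real.exp (-(c / 2) * x) * f x) halfLine :=
    MemLp.integrable_fun_mul (memLp_exp_halfLine (half_pos hc)) hf
  have hΘi : Integrable Θ (volume.prod (halfLine.prod halfLine)) := by
    have hdom := ((integrable_exp_neg_mul_abs hc).mul_prod
      (hfe.norm.mul_prod hfe.norm)).const_mul (D ^ 2)
    refine hdom.mono' ?_ ?_
    · have h1 : Continuous fun r : ℝ × (ℝ × ℝ) => Real.exp (2 * c * r.1) := by fun_prop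
      have h2 : Continuous fun r : ℝ × (ℝ × ℝ) => airy (q + r.1 + r.2.1) := by fun_prop
      have h3 : Continuous fun r : ℝ × (ℝ × ℝ) => airy (q + r.1 + r.2.2) := by fun_prop
      exact h1.aestronglyMeasurable.mul ((h2.aestronglyMeasurable.mul hf.1.comp_fst.comp_snd).mul
        (h3.aestronglyMeasurable.mul hf.1.comp_snd.comp_snd))
    · have hae : ∀ᵐ r ∂((volume : Measure ℝ).prod (halfLine.prod halfLine)),
          0 ≤ r.2.1 ∧ 0 ≤ r.2.2 := Measure.quasiMeasurePreserving_snd.ae ae_halfLine_prod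
      filter_upwards [hae] with r hr
      obtain ⟨z, x, y⟩ := r
      simp only [hΘ, Real.norm_eq_abs, abs_mul, Real.abs_exp]
      have := mul_le_mul (hbd z x hr.1) (hbd z y hr.2) (abs_nonneg _) (by positivity)
      calc _ = Real.exp (2 * c * z) * (|airy (q + z + x)| * |airy (q + z + y)|) *
            (|f x| * |f y|) := by ring
        _ ≤ Real.exp (2 * c * z) * ((D * Real.exp (-c * z) * Real.exp (-(c / 2) * |z|) *
            Real.exp (-(c / 2) * x)) * (D * Real.exp (-c * z) * Real.exp (-(c / 2) * |z|) *
            Real.exp (-(c / 2) * y))) * (|f x| * |f y|) := by gcongr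
        _ = D ^ 2 * ((Real.exp (2 * c * z) * Real.exp (-c * z) * Real.exp (-c * z)) *
            (Real.exp (-(c / 2) * |z|) * Real.exp (-(c / 2) * |z|)) *
            (Real.exp (-(c / 2) * x) * |f x| * (Real.exp (-(c / 2) * y) * |f y|))) := by ring
        _ = _ := by
          rw [← Real.exp_add, ← Real.exp_add, ← Real.exp_add,
            show 2 * c * z + -c * z + -c * z = 0 by ring, Real.exp_zero, one_mul,
            show -(c / 2) * |z| + -(c / 2) * |z| = -c * |z| by ring]
  have hsq : ∀ z, ∫ p, Θ (z, p) ∂(halfLine.prod halfLine) =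
      Real.exp (2 * c * z) * airyTransform q f z ^ 2 := by
    intro z
    simp only [hΘ]
    rw [integral_const_mul, integral_prod_mul (fun x => airy (q + z + x) * f x)
      (fun x => airy (q + z + x) * f x), airyTransform, sq]
  have hin : ∀ p : ℝ × ℝ, ∫ z, Θ (z, p) = f p.1 * f p.2 *
      (Real.exp (2 * c ^ 3 / 3 - c * ((q + p.1) + (q + p.2))) * gaussDensity c (p.1 - p.2)) := by
    intro p
    have := integral_exp_mul_airy_mul_airy hc (q + p.1) (q + p.2)
    rw [show q + p.1 - (q + p.2) = p.1 - p.2 by ring] at this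
    rw [gaussDensity, ← this, ← integral_const_mul]
    refine integral_congr_ae (ae_of_all _ fun z => ?_)
    simp only [hΘ]
    rw [show q + z + p.1 = z + (q + p.1) by ring, show q + z + p.2 = z + (q + p.2) by ring]
    ring
  refine ⟨by simpa only [hsq] using hΘi.integral_prod_left, ?_⟩
  obtain ⟨hG1, hG2⟩ := integral_sq_mul_gaussDensity hc hf
  have hG1' : Integrable (fun p : ℝ × ℝ => f p.2 ^ 2 * gaussDensity c (p.2 - p.1))
      (halfLine.prod halfLine) := hG1.swap
  have hG2' : ∫ p, f p.2 ^ 2 * gaussDensity c (p.2 - p.1) ∂(halfLine.prod halfLine) ≤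
      ∫ x, f x ^ 2 ∂halfLine := by
    rw [← integral_prod_swap] at hG2
    exact hG2
  set E := Real.exp (2 * c ^ 3 / 3 - 2 * c * q) with hE
  -- After Parseval the kernel in (x,y) is a Gaussian density times a weight that is largest at x =
  -- y = 0, where it equals E. The inequality 2|f(x)f(y)| ≤ f(x)² + f(y)² and the Schur bound
  -- finish.
  calc ∫ z, Real.exp (2 * c * z) * airyTransform q f z ^ 2
      = ∫ z, ∫ p, Θ (z, p) ∂(halfLine.prod halfLine) := by simp only [hsq]
    _ = ∫ p, (∫ z : ℝ, Θ (z, p)) ∂(halfLine.prod halfLine) := integral_integral_swap hΘi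
    _ ≤ ∫ p, (E / 2 * (f p.1 ^ 2 * gaussDensity c (p.1 - p.2)) +
          E / 2 * (f p.2 ^ 2 * gaussDensity c (p.2 - p.1))) ∂(halfLine.prod halfLine) := by
        refine integral_mono_ae hΘi.integral_prod_right
          ((hG1.const_mul _).add (hG1'.const_mul _)) ?_
        filter_upwards [ae_halfLine_prod] with p hp
        rw [hin]
        have hgs : gaussDensity c (p.2 - p.1) = gaussDensity c (p.1 - p.2) := by
          unfold gaussDensity; congr 3; ring
        have hg0 := gaussDensity_nonneg c (p.1 - p.2)
        rw [hgs]
        have h1 : Real.exp (2 * c ^ 3 / 3 - c * ((q + p.1) + (q + p.2))) ≤ E := by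
          apply Real.exp_le_exp.2
          nlinarith [mul_nonneg hc.le hp.1, mul_nonneg hc.le hp.2]
        have h2 : f p.1 * f p.2 ≤ |f p.1 * f p.2| := le_abs_self _
        have h3 : |f p.1 * f p.2| ≤ (f p.1 ^ 2 + f p.2 ^ 2) / 2 := by
          rw [abs_le]
          constructor <;> nlinarith [sq_nonneg (f p.1 + f p.2), sq_nonneg (f p.1 - f p.2)]
        calc _ ≤ |f p.1 * f p.2| * (Real.exp (2 * c ^ 3 / 3 - c * ((q + p.1) + (q + p.2))) *
              gaussDensity c (p.1 - p.2)) := by gcongr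
          _ ≤ (f p.1 ^ 2 + f p.2 ^ 2) / 2 * (E * gaussDensity c (p.1 - p.2)) := by gcongr
          _ = _ := by ring
    _ ≤ E * ∫ x, f x ^ 2 ∂halfLine := by
        rw [integral_add (hG1.const_mul _) (hG1'.const_mul _), integral_const_mul,
          integral_const_mul]
        have hE0 : 0 < E := Real.exp_pos _
        nlinarith

/-- The Airy transform is a contraction from `L²(0,∞)` to `L²(-M,∞)`. -/
lemma integral_airyTransform_sq_le (q M : ℝ) {f : ℝ → ℝ} (hf : MemLp f 2 halfLine) :
    IntegrableOn (fun z => airyTransform q f z ^ 2) (Ici (-M)) ∧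
    ∫ z in Ici (-M), airyTransform q f z ^ 2 ≤ ∫ x, f x ^ 2 ∂halfLine := by
  have hpt : ∀ c : ℝ, 0 < c → ∀ z ∈ Ici (-M), airyTransform q f z ^ 2 ≤
      Real.exp (2 * c * M) * (Real.exp (2 * c * z) * airyTransform q f z ^ 2) := by
    intro c hc z hz
    rw [← mul_assoc, ← Real.exp_add]
    refine le_mul_of_one_le_left (sq_nonneg _) (Real.one_le_exp ?_)
    have : -M ≤ z := hz
    nlinarith
  have hmeas : AEStronglyMeasurable (fun z => airyTransform q f z ^ 2)
      (volume.restrict (Ici (-M))) := by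
    have hcont := continuous_airy
    have : AEStronglyMeasurable (fun z => airyTransform q f z) volume := by
      refine aestronglyMeasurable_integral_mul (k := fun z x => airy (q + z + x)) ?_ hf.1
      exact (by unfold Function.uncurry; fun_prop :
        Continuous (Function.uncurry fun z x => airy (q + z + x))).aestronglyMeasurable
    exact (this.pow 2).restrict
  have hI : ∀ c : ℝ, 0 < c → IntegrableOn (fun z => Real.exp (2 * c * M) *
      (Real.exp (2 * c * z) * airyTransform q f z ^ 2)) (Ici (-M)) := fun c hc =>
    ((integral_exp_mul_airyTransform_sq_le hc q hf).1.const_mul _).integrableOn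
  have hF : IntegrableOn (fun z => airyTransform q f z ^ 2) (Ici (-M)) := by
    refine (hI 1 one_pos).mono' hmeas ?_
    filter_upwards [ae_restrict_mem measurableSet_Ici] with z hz
    rw [Real.norm_of_nonneg (sq_nonneg _)]
    exact hpt 1 one_pos z hz
  refine ⟨hF, ?_⟩
  have hc : ∀ c : ℝ, 0 < c → ∫ z in Ici (-M), airyTransform q f z ^ 2 ≤
      Real.exp (2 * c * M) * (Real.exp (2 * c ^ 3 / 3 - 2 * c * q) * ∫ x, f x ^ 2 ∂halfLine) := by
    intro c hc
    obtain ⟨h1, h2⟩ := integral_exp_mul_airyTransform_sq_le hc q hf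
    calc _ ≤ ∫ z in Ici (-M), Real.exp (2 * c * M) *
          (Real.exp (2 * c * z) * airyTransform q f z ^ 2) :=
          setIntegral_mono_on hF (hI c hc) measurableSet_Ici (hpt c hc)
      _ ≤ ∫ z, Real.exp (2 * c * M) * (Real.exp (2 * c * z) * airyTransform q f z ^ 2) :=
          setIntegral_le_integral (h1.const_mul _) (ae_of_all _ fun z => by
            simp only [Pi.zero_apply]; positivity)
      _ ≤ _ := by
          rw [integral_const_mul]
          gcongr
  -- As c ↓ 0 both exponential weights tend to 1, which yields the constant 1.
  have hlim : Tendsto (fun c : ℝ => Real.exp (2 * c * M) *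
      (Real.exp (2 * c ^ 3 / 3 - 2 * c * q) * ∫ x, f x ^ 2 ∂halfLine)) (𝓝[>] 0)
      (𝓝 (∫ x, f x ^ 2 ∂halfLine)) := by
    have : Continuous fun c : ℝ => Real.exp (2 * c * M) *
      (Real.exp (2 * c ^ 3 / 3 - 2 * c * q) * ∫ x, f x ^ 2 ∂halfLine) := by fun_prop
    have := (this.tendsto 0).mono_left (nhdsWithin_le_nhds (s := Ioi 0))
    simpa using this
  refine ge_of_tendsto hlim ?_
  filter_upwards [self_mem_nhdsWithin] with c hc'
  exact hc c hc'

end StationaryTASEP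

end


/-! ### Strict contraction of the Airy transform, by analyticity -/

noncomputable section

namespace StationaryTASEP

lemma one_add_abs_le (y : ℝ) : 1 + |y| ≤ 2 * Real.exp (1 / 4 * y ^ 2) := by
  have := Real.add_one_le_exp (1 / 4 * y ^ 2)
  have h : |y| ^ 2 = y ^ 2 := sq_abs y
  nlinarith [sq_nonneg (|y| - 1)]

lemma norm_one_add_mul_I_le (y : ℝ) : ‖(1 : ℂ) + y * Complex.I‖ ≤ 1 + |y| := by
  refine (norm_add_le _ _).trans ?_
  simp

/-- Differentiating in z brings down the factor -(1+iy), bounded by 2e^{y²/4}, while the integrand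
decays like e^{-y²/2} locally uniformly in z. -/
lemma differentiable_integral_airyIntegrand_mul (q : ℝ) {g : ℝ → ℂ} {M : ℝ}
    (hg : AEStronglyMeasurable g) (hM : ∀ y, ‖g y‖ ≤ M) :
    Differentiable ℂ fun z : ℂ => ∫ y : ℝ, airyIntegrand 1 (q + z) y * g y := by
  intro z₀
  have hM0 : 0 ≤ M := (norm_nonneg _).trans (hM 0)
  set K : ℝ := Real.exp (1 / 3 + |q + z₀.re| + 1 + (|z₀.im| + 1) ^ 2 / 2) with hK
  have hb : ∀ z ∈ Metric.ball z₀ 1, ∀ y : ℝ,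
      ‖airyIntegrand 1 (q + z) y‖ ≤ K * Real.exp (-(1 / 2) * y ^ 2) := by
    intro z hz y
    refine (norm_airyIntegrand_le one_pos _ y).trans ?_
    refine mul_le_mul_of_nonneg_right (Real.exp_le_exp.2 ?_) (Real.exp_nonneg _)
    rw [Metric.mem_ball, dist_eq_norm] at hz
    have h1 : |(z - z₀).re| ≤ 1 := (Complex.abs_re_le_norm _).trans hz.le
    have h2 : |(z - z₀).im| ≤ 1 := (Complex.abs_im_le_norm _).trans hz.le
    rw [Complex.sub_re, abs_le] at h1
    have h3 : |z.im| ≤ |z₀.im| + 1 := by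
      have : z.im = z₀.im + (z - z₀).im := by simp
      rw [this]
      exact (abs_add_le _ _).trans (by linarith)
    have h4 : z.im ^ 2 ≤ (|z₀.im| + 1) ^ 2 := by
      rw [← sq_abs z.im]; exact pow_le_pow_left₀ (abs_nonneg _) h3 2
    have h5 := neg_abs_le (q + z₀.re)
    simp only [Complex.add_re, Complex.ofReal_re, Complex.add_im, Complex.ofReal_im, zero_add]
    linarith
  have hmem : z₀ ∈ Metric.ball z₀ 1 := Metric.mem_ball_self one_pos
  have hmeas : ∀ z : ℂ, AEStronglyMeasurable (fun y : ℝ => airyIntegrand 1 (q + z) y * g y) :=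
    fun z => (continuous_airyIntegrand 1 _).aestronglyMeasurable.mul hg
  have hlin : Continuous fun y : ℝ => -((1 : ℂ) + y * Complex.I) := by fun_prop
  have key := hasDerivAt_integral_of_dominated_loc_of_deriv_le (μ := volume)
    (F := fun (z : ℂ) (y : ℝ) => airyIntegrand 1 (q + z) y * g y)
    (F' := fun (z : ℂ) (y : ℝ) => -((1 : ℂ) + y * Complex.I) * (airyIntegrand 1 (q + z) y * g y))
    (bound := fun y => 2 * K * M * Real.exp (-(1 / 4) * y ^ 2)) (x₀ := z₀)
    (Metric.ball_mem_nhds z₀ one_pos) (Eventually.of_forall hmeas)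
    (((integrable_exp_neg_mul_sq (by norm_num : (0 : ℝ) < 1 / 2)).const_mul (K * M)).mono'
      (hmeas z₀) (ae_of_all _ fun y => by
        rw [norm_mul]
        calc _ ≤ (K * Real.exp (-(1 / 2) * y ^ 2)) * M :=
              mul_le_mul (hb z₀ hmem y) (hM y) (norm_nonneg _) (by positivity)
          _ = _ := by ring))
    (hlin.aestronglyMeasurable.mul (hmeas z₀))
    (ae_of_all _ fun y z hz => by
      rw [norm_mul, norm_mul, norm_neg]
      calc _ ≤ (2 * Real.exp (1 / 4 * y ^ 2)) * ((K * Real.exp (-(1 / 2) * y ^ 2)) * M) :=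
            mul_le_mul ((norm_one_add_mul_I_le y).trans (one_add_abs_le y))
              (mul_le_mul (hb z hz y) (hM y) (norm_nonneg _) (by positivity)) (by positivity)
              (by positivity)
        _ = 2 * K * M * (Real.exp (1 / 4 * y ^ 2) * Real.exp (-(1 / 2) * y ^ 2)) := by ring
        _ = _ := by rw [← Real.exp_add]; congr 2; ring)
    ((integrable_exp_neg_mul_sq (by norm_num)).const_mul _)
    (ae_of_all _ fun y z _ => by
      have h1 : HasDerivAt (fun z : ℂ => (q + z : ℂ)) 1 z := (hasDerivAt_id z).const_add _
      refine ((((h1.mul_const (((1 : ℝ) : ℂ) + y * Complex.I)).const_sub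
        ((((1 : ℝ) : ℂ) + y * Complex.I) ^ 3 / 3)).cexp).mul_const (g y)).congr_deriv ?_
      simp only [airyIntegrand]
      push_cast
      ring)
  exact key.2.differentiableAt

/-- Inserting the contour integral for Ai and exchanging integrals exhibits the transform as the
real part, on the real axis, of an entire function; the inner integral is the Laplace transform of f
on Re = 1, which is bounded. -/
lemma analyticOnNhd_airyTransform (q : ℝ) {f : ℝ → ℝ} (hf : MemLp f 2 halfLine) :
    AnalyticOnNhd ℝ (airyTransform q f) univ := by
  set g : ℝ → ℂ := fun y => ∫ x, Complex.exp (-(x * (1 + y * Complex.I))) * f x ∂halfLine with hg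
  have hfe : Integrable (fun x => Real.exp (-1 * x) * f x) halfLine :=
    MemLp.integrable_fun_mul (memLp_exp_halfLine one_pos) hf
  have hnorm : ∀ x y : ℝ, ‖Complex.exp (-(x * (1 + y * Complex.I))) * (f x : ℂ)‖ =
      ‖Real.exp (-1 * x) * f x‖ := by
    intro x y
    rw [norm_mul, norm_mul, Complex.norm_exp, Complex.norm_real, Real.norm_of_nonneg
      (Real.exp_nonneg _)]
    simp
  have hfm : AEStronglyMeasurable (fun x => (f x : ℂ)) halfLine :=
    Complex.continuous_ofReal.comp_aestronglyMeasurable hf.1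
  have hgm : AEStronglyMeasurable g := by
    have h1 : Continuous fun p : ℝ × ℝ => Complex.exp (-(p.2 * (1 + p.1 * Complex.I))) := by
      fun_prop
    exact (h1.aestronglyMeasurable.mul (hfm.comp_snd (μ := volume))).integral_prod_right'
  have hgb : ∀ y, ‖g y‖ ≤ ∫ x, ‖Real.exp (-1 * x) * f x‖ ∂halfLine := fun y => by
    refine (norm_integral_le_integral_norm _).trans (le_of_eq ?_)
    simp only [hnorm]
  have hrep : ∀ z : ℝ, airyTransform q f z =
      ((1 / (2 * Real.pi) : ℂ) * ∫ y : ℝ, airyIntegrand 1 (q + z) y * g y).re := by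
    intro z
    have h1 : ((airyTransform q f z : ℝ) : ℂ) =
        (1 / (2 * Real.pi) : ℂ) * ∫ y : ℝ, airyIntegrand 1 (q + z) y * g y := by
      rw [airyTransform, ← integral_complex_ofReal]
      have e1 : ∀ x : ℝ, ((airy (q + z + x) * f x : ℝ) : ℂ) = 1 / (2 * Real.pi) *
          ∫ y : ℝ, airyIntegrand 1 (q + z) y *
            (Complex.exp (-(x * (1 + y * Complex.I))) * f x) := by
        intro x
        rw [Complex.ofReal_mul, ofReal_airy one_pos, mul_assoc, airyLine, ← integral_mul_const]
        congr 2
        funext y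
        rw [← mul_assoc]
        congr 1
        simp only [airyIntegrand]
        rw [← Complex.exp_add]
        congr 1
        push_cast
        ring
      simp_rw [e1]
      rw [integral_const_mul, integral_integral_swap]
      · simp only [hg, integral_const_mul]
      · have hd := hfe.norm.mul_prod (integrable_airyIntegrand one_pos ((q + z : ℝ) : ℂ)).norm
        refine hd.mono' ?_ (ae_of_all _ fun p => ?_)
        · have h1 : Continuous fun p : ℝ × ℝ => airyIntegrand 1 (q + z) p.2 :=
            (continuous_airyIntegrand 1 _).comp continuous_snd
          have h2 : Continuous fun p : ℝ × ℝ =>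
            Complex.exp (-((p.1 : ℂ) * (1 + p.2 * Complex.I))) := by fun_prop
          exact h1.aestronglyMeasurable.mul (h2.aestronglyMeasurable.mul hfm.comp_fst)
        · simp only [Function.uncurry]
          rw [norm_mul, hnorm, mul_comm]
          push_cast
          rfl
    rw [← h1, Complex.ofReal_re]
  intro z _
  have hd := (differentiable_integral_airyIntegrand_mul q hgm hgb).const_mul
    (1 / (2 * Real.pi) : ℂ)
  have := (hd.analyticAt (z : ℂ)).re_ofReal
  rw [show airyTransform q f = _ from funext hrep]
  exact this

/-- An `L²(0,∞)` function whose truncated Airy transform has the same norm vanishes. -/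
lemma integral_airyTransform_sq_lt (q : ℝ) {f : ℝ → ℝ} (hf : MemLp f 2 halfLine)
    (h : ∫ z, airyTransform q f z ^ 2 ∂halfLine = ∫ x, f x ^ 2 ∂halfLine) :
    ∫ x, f x ^ 2 ∂halfLine = 0 := by
  obtain ⟨h1, h2⟩ := integral_airyTransform_sq_le q 1 hf
  have han := analyticOnNhd_airyTransform q hf
  have hsplit : Ici (-1 : ℝ) = Ico (-1) 0 ∪ Ici 0 := (Ico_union_Ici_eq_Ici (by norm_num)).symm
  rw [hsplit] at h1 h2
  rw [setIntegral_union (Set.disjoint_left.2 fun x hx hx' => absurd hx.2 (not_lt.2 hx') :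
      Disjoint (Ico (-1 : ℝ) 0) (Ici 0))
    measurableSet_Ici h1.left_of_union h1.right_of_union, h] at h2
  -- The norm over [-1,∞) is at most that of f, and [0,∞) already accounts for all of it, so nothing
  -- is left on [-1,0).
  have h3 : ∫ z in Ico (-1 : ℝ) 0, airyTransform q f z ^ 2 = 0 :=
    le_antisymm (by linarith) (integral_nonneg fun _ => sq_nonneg _)
  have h4 : ∀ᵐ z ∂(volume.restrict (Ioo (-1 : ℝ) 0)), airyTransform q f z = 0 := by
    rw [integral_eq_zero_iff_of_nonneg (fun _ => sq_nonneg _) h1.left_of_union] at h3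
    refine (ae_restrict_of_ae_restrict_of_subset Ioo_subset_Ico_self h3).mono fun z hz => ?_
    simpa using hz
  have hc : ContinuousOn (airyTransform q f) (Ioo (-1 : ℝ) 0) :=
    han.continuousOn.mono (subset_univ _)
  have h5 : EqOn (airyTransform q f) 0 (Ioo (-1 : ℝ) 0) :=
    Measure.eqOn_open_of_ae_eq h4 isOpen_Ioo hc continuousOn_const
  have h6 : airyTransform q f = 0 := by
    refine han.eq_of_eventuallyEq (z₀ := -1 / 2) (fun _ _ => analyticAt_const) ?_
    filter_upwards [Ioo_mem_nhds (by norm_num : (-1 : ℝ) < -1 / 2)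
      (by norm_num : (-1 / 2 : ℝ) < 0)] with z hz using h5 hz
  rw [← h, h6]
  simp

/-! ### The Airy operator on the half line -/

/-- The Hankel operator with kernel `Ai(q+x+y)` on `L²(0,∞)`. -/
def airyOp (q : ℝ) : Lp ℝ 2 halfLine →L[ℝ] Lp ℝ 2 halfLine :=
  integralOp (fun x y => airy (q + x + y)) (memLp_airyShift q)

lemma norm_sq_airyOp (q : ℝ) (f : Lp ℝ 2 halfLine) :
    ‖airyOp q f‖ ^ 2 = ∫ z, airyTransform q f z ^ 2 ∂halfLine := by
  rw [Lp.norm_sq_eq_integral]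
  refine integral_congr_ae ?_
  filter_upwards [coeFn_integralOp (memLp_airyShift q) f] with z hz
  rw [airyOp, hz, airyTransform]

lemma norm_airyOp_le (q : ℝ) (f : Lp ℝ 2 halfLine) : ‖airyOp q f‖ ≤ ‖f‖ := by
  have := (integral_airyTransform_sq_le q 0 (Lp.memLp f)).2
  rw [neg_zero] at this
  rw [← abs_of_nonneg (norm_nonneg (airyOp q f)), ← abs_of_nonneg (norm_nonneg f), ← sq_le_sq,
    norm_sq_airyOp, Lp.norm_sq_eq_integral]
  exact this

/-- From ‖f‖ = ‖AAf‖ ≤ ‖Af‖ ≤ ‖f‖, equality holds throughout and strictness of the contraction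
applies. -/
lemma eq_zero_of_airyOp_airyOp_eq (q : ℝ) {f : Lp ℝ 2 halfLine}
    (h : airyOp q (airyOp q f) = f) : f = 0 := by
  have h1 : ‖airyOp q f‖ = ‖f‖ := by
    refine le_antisymm (norm_airyOp_le q f) ?_
    conv_lhs => rw [← h]
    exact norm_airyOp_le q _
  have h2 := integral_airyTransform_sq_lt q (Lp.memLp f) (by
    rw [← norm_sq_airyOp, h1, Lp.norm_sq_eq_integral])
  rw [← Lp.norm_sq_eq_integral] at h2
  simpa using h2

lemma isCompactOperator_of_rank_one {μ ν : Measure ℝ} [SFinite μ] [SFinite ν] {p g : ℝ → ℝ}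
    (hp : MemLp p 2 ν) (hg : MemLp g 2 μ) :
    IsCompactOperator (integralOp (fun x y => p x * g y) (memLp_two_mul_prod hp hg)) := by
  have h : integralOp (fun x y => p x * g y) (memLp_two_mul_prod hp hg) =
      (ContinuousLinearMap.toSpanSingleton ℝ (hp.toLp p)).comp (innerSL ℝ (hg.toLp g)) := by
    ext1 f
    apply Lp.ext
    filter_upwards [coeFn_integralOp (k := fun x y => p x * g y) (memLp_two_mul_prod hp hg) f, hp.coeFn_toLp,
      Lp.coeFn_smul (inner ℝ (hg.toLp g) f) (hp.toLp p)] with x h1 h2 h3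
    rw [h1, ContinuousLinearMap.comp_apply, innerSL_apply_apply,
      ContinuousLinearMap.toSpanSingleton_apply, h3, Pi.smul_apply, h2, Lp.inner_eq_integral,
      smul_eq_mul, mul_comm, ← integral_const_mul]
    refine integral_congr_ae ?_
    filter_upwards [hg.coeFn_toLp] with y hy
    rw [hy, mul_assoc]
  rw [h]
  exact IsCompactOperator.clm_comp (f := innerSL ℝ (hg.toLp g))
    (isCompactOperator_of_locallyCompactSpace_dom _)
    (ContinuousLinearMap.toSpanSingleton ℝ (hp.toLp p))

lemma integralOp_add {μ ν : Measure ℝ} [SFinite ν] [SFinite μ] {k k' : ℝ → ℝ → ℝ}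
    (hk : MemLp (Function.uncurry k) 2 (ν.prod μ)) (hk' : MemLp (Function.uncurry k') 2 (ν.prod μ))
    (h : MemLp (Function.uncurry fun x y => k x y + k' x y) 2 (ν.prod μ)) :
    integralOp _ h = integralOp k hk + integralOp k' hk' := by
  have := integralOp_sub h hk' (by simpa using hk)
  rw [← sub_eq_iff_eq_add, this]
  congr
  simp

lemma isCompactOperator_of_finite_rank {μ ν : Measure ℝ} [SFinite μ] [SFinite ν] {ι : Type*}
    (s : Finset ι) {p g : ι → ℝ → ℝ} (hp : ∀ i, MemLp (p i) 2 ν) (hg : ∀ i, MemLp (g i) 2 μ) :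
    ∃ h, IsCompactOperator (integralOp (ν := ν) (μ := μ) (fun x y => ∑ i ∈ s, p i x * g i y) h) := by
  classical
  induction s using Finset.induction_on with
  | empty =>
    have h0 : MemLp (Function.uncurry fun _ _ : ℝ => (0 : ℝ)) 2 (ν.prod μ) := MemLp.zero
    refine ⟨by simpa using h0, ?_⟩
    have : integralOp (ν := ν) (μ := μ) (fun x y => ∑ i ∈ (∅ : Finset ι), p i x * g i y)
        (by simpa using h0) = 0 := by
      ext1 f
      apply Lp.ext
      filter_upwards [coeFn_integralOp (ν := ν) (μ := μ)
        (k := fun x y => ∑ i ∈ (∅ : Finset ι), p i x * g i y) (by simpa using h0) f,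
        Lp.coeFn_zero ℝ 2 ν] with x h1 h2
      rw [h1, _root_.zero_apply, h2]
      simp
    rw [this]
    exact isCompactOperator_zero
  | insert i s his ih =>
    obtain ⟨h, hc⟩ := ih
    have hi := memLp_two_mul_prod (hp i) (hg i)
    have hadd : MemLp (Function.uncurry fun x y => p i x * g i y + ∑ i ∈ s, p i x * g i y) 2
      (ν.prod μ) := hi.add h
    have e : (fun x y => ∑ j ∈ insert i s, p j x * g j y) =
        fun x y => p i x * g i y + ∑ i ∈ s, p i x * g i y := by
      funext x y; rw [Finset.sum_insert his]
    simp only [e]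
    refine ⟨hadd, ?_⟩
    rw [integralOp_add (k := fun x y => p i x * g i y)
      (k' := fun x y => ∑ i ∈ s, p i x * g i y) hi h hadd]
    exact (isCompactOperator_of_rank_one (hp i) (hg i)).add hc

/-- Freezing x at the left end of a grid cell and cutting off large x gives finite rank kernels
converging in Hilbert–Schmidt norm. -/
lemma isCompactOperator_airyOp (q : ℝ) : IsCompactOperator (airyOp q) := by
  have hcont := continuous_airy
  obtain ⟨C, hC0, hC⟩ := abs_airy_add_le one_pos q
  set p : ℕ → ℕ → ℝ → ℝ := fun n i x => if 0 ≤ x ∧ ⌊x * n⌋₊ = i then 1 else 0 with hp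
  set g : ℕ → ℕ → ℝ → ℝ := fun n i y => airy (q + i / n + y) with hg
  have hfl : ∀ n : ℕ, Measurable fun x : ℝ => ⌊x * n⌋₊ := fun n =>
    Nat.measurable_floor.comp (measurable_id.mul_const _)
  have hpm : ∀ n i, Measurable (p n i) := fun n i =>
    Measurable.ite ((measurableSet_le measurable_const measurable_id).inter
      (hfl n (measurableSet_singleton i))) measurable_const measurable_const
  have hp2 : ∀ n i, MemLp (p (n + 1) i) 2 halfLine := by
    intro n i
    refine memLp_halfLine_of_bound (C := Real.exp (i + 1)) (κ := 1)
      (hpm _ _).aestronglyMeasurable one_pos fun x hx => ?_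
    simp only [hp]
    split_ifs with h
    · rw [abs_one, ← Real.exp_add]
      refine Real.one_le_exp ?_
      have := Nat.lt_floor_add_one (x * ((n + 1 : ℕ) : ℝ))
      rw [h.2] at this
      push_cast at this
      nlinarith [mul_nonneg hx (Nat.cast_nonneg (α := ℝ) n)]
    · rw [abs_zero]; positivity
  have hg2 : ∀ n i, MemLp (g n i) 2 halfLine := by
    intro n i
    refine memLp_halfLine_of_bound (C := C * Real.exp (-1 * (i / n))) (κ := 1)
      (by fun_prop : Continuous (g n i)).aestronglyMeasurable one_pos fun y hy => ?_
    rw [mul_assoc]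
    exact hC _ _
  -- The (n+1)² cells of width 1/(n+1) cover [0,n+1).
  set k : ℕ → ℝ → ℝ → ℝ := fun n x y =>
    ∑ i ∈ Finset.range ((n + 1) ^ 2), p (n + 1) i x * g (n + 1) i y with hk
  have hcomp : ∀ n, ∃ h, IsCompactOperator (integralOp (ν := halfLine) (μ := halfLine) (k n) h) :=
    fun n => isCompactOperator_of_finite_rank _ (hp2 n) (hg2 (n + 1))
  have hkval : ∀ n x y, 0 ≤ x → k n x y = if ⌊x * (n + 1 : ℕ)⌋₊ < (n + 1) ^ 2 then
      airy (q + ⌊x * (n + 1 : ℕ)⌋₊ / (n + 1 : ℕ) + y) else 0 := by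
    intro n x y hx
    simp only [hk, hp, hg, hx, true_and, ite_mul, one_mul, zero_mul]
    rw [Finset.sum_ite_eq]
    simp only [Finset.mem_range]
  have hlim : Tendsto (fun n => kernelOp halfLine (k n)) atTop
      (𝓝 (kernelOp halfLine fun x y => airy (q + x + y))) := by
    have hm : ∀ n, AEStronglyMeasurable (Function.uncurry (k n)) (halfLine.prod halfLine) :=
      fun n => (hcomp n).choose.1
    -- Rounding down moves x by at most 1, which costs the factor e in the dominating function.
    refine tendsto_kernelOp (g := fun p => (C * Real.exp 1) *
      (Real.exp (-1 * p.1) * Real.exp (-1 * p.2))) (Eventually.of_forall hm) (memLp_airyShift q).1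
      (memLp_exp_halfLine_prod one_pos _) (Eventually.of_forall fun n => ?_) ?_ ?_
    · filter_upwards [ae_halfLine_prod] with r hr
      rw [hkval _ _ _ hr.1]
      split_ifs
      · refine (hC _ _).trans ?_
        rw [mul_assoc]
        refine mul_le_mul_of_nonneg_left ?_ hC0.le
        rw [← mul_assoc, ← Real.exp_add 1]
        refine mul_le_mul_of_nonneg_right (Real.exp_le_exp.2 ?_) (Real.exp_nonneg _)
        have h1 := Nat.lt_floor_add_one (r.1 * ((n + 1 : ℕ) : ℝ))
        have h2 : r.1 ≤ ⌊r.1 * ((n + 1 : ℕ) : ℝ)⌋₊ / ((n + 1 : ℕ) : ℝ) + 1 := by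
          rw [div_add_one (by positivity), le_div_iff₀ (by positivity)]
          push_cast at h1 ⊢
          have : (0 : ℝ) ≤ n := Nat.cast_nonneg n
          linarith
        linarith
      · rw [abs_zero]; positivity
    · filter_upwards [ae_halfLine_prod] with r hr
      refine (hC _ _).trans (mul_le_mul_of_nonneg_right ?_ (by positivity))
      exact le_mul_of_one_le_right hC0.le (Real.one_le_exp zero_le_one)
    · filter_upwards [ae_halfLine_prod] with r hr
      have h1 : Tendsto (fun n : ℕ => ((⌊r.1 * (n + 1 : ℕ)⌋₊ : ℝ) / (n + 1 : ℕ))) atTop (𝓝 r.1) :=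
        (tendsto_nat_floor_mul_div_atTop hr.1).comp
          (tendsto_natCast_atTop_atTop.comp (tendsto_add_atTop_nat 1))
      have h2 := (hcont.tendsto (q + r.1 + r.2)).comp ((h1.const_add q).add_const r.2)
      refine h2.congr' ?_
      obtain ⟨N, hN⟩ := exists_nat_gt r.1
      filter_upwards [eventually_ge_atTop N] with n hn
      rw [hkval _ _ _ hr.1, if_pos]
      · rfl
      · rw [Nat.floor_lt (by have := hr.1; positivity)]
        push_cast
        have h3 : (N : ℝ) ≤ n := by exact_mod_cast hn
        have : (0 : ℝ) ≤ n := Nat.cast_nonneg n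
        nlinarith
  rw [kernelOp_eq_integralOp (memLp_airyShift q)] at hlim
  refine isCompactOperator_of_tendsto hlim (Eventually.of_forall fun n => ?_)
  obtain ⟨h, hc⟩ := hcomp n
  rw [kernelOp_eq_integralOp h]
  exact hc

lemma airyKernel_eq (q : ℝ) : airyKernel q =
    fun x y => ∫ z, airy (q + x + z) * airy (q + z + y) ∂halfLine := by
  funext x y
  rw [airyKernel, integral_Ici_eq_integral_Ioi]
  congr 1
  funext z
  rw [show q + z + x = q + x + z by ring]

lemma kernelOp_airyKernel (q : ℝ) : kernelOp halfLine (airyKernel q) = airyOp q * airyOp q := by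
  rw [airyKernel_eq]
  exact kernelOp_factor (memLp_airyShift q) (memLp_airyShift q)

/-- `1 - K_Ai` is invertible on every half line. -/
lemma isUnit_one_sub_airyKernel (q : ℝ) : IsUnit (1 - kernelOp halfLine (airyKernel q)) := by
  rw [kernelOp_airyKernel]
  have hc : IsCompactOperator (airyOp q * airyOp q) :=
    (isCompactOperator_airyOp q).clm_comp (airyOp q)
  -- Fredholm alternative at the value 1: a compact operator either has the eigenvalue 1 or 1 lies
  -- in its resolvent set.
  rcases hc.hasEigenvalue_or_mem_resolventSet one_ne_zero with h | h
  · exfalso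
    obtain ⟨v, hv⟩ := h.exists_hasEigenvector
    refine hv.2 (eq_zero_of_airyOp_airyOp_eq q ?_)
    have := hv.apply_eq_smul
    rw [one_smul] at this
    exact this
  · rw [spectrum.mem_resolventSet_iff, map_one] at h
    exact h

end StationaryTASEP

end


noncomputable section

namespace StationaryTASEP

/-! ### Exponentially dominated convergence on the half line -/

/-- The Hankel integral `∫_0^∞ α(x+y) f(y) dy`. -/
def hankel (α f : ℝ → ℝ) (x : ℝ) : ℝ := ∫ y, α (x + y) * f y ∂halfLine

lemma measurable_hankel {α f : ℝ → ℝ} (hα : Measurable α) (hf : Measurable f) :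
    Measurable (hankel α f) := by
  have h : Measurable fun p : ℝ × ℝ => α (p.1 + p.2) * f p.2 :=
    (hα.comp (measurable_fst.add measurable_snd)).mul (hf.comp measurable_snd)
  exact (h.stronglyMeasurable.integral_prod_right' (ν := halfLine)).measurable

lemma integral_exp_halfLine {κ : ℝ} (hκ : 0 < κ) : ∫ x, Real.exp (-κ * x) ∂halfLine = 1 / κ := by
  rw [integral_Ici_eq_integral_Ioi, integral_exp_mul_Ioi (neg_neg_of_pos hκ)]
  simp

lemma abs_hankel_le {α f : ℝ → ℝ} {C D κ : ℝ} (hκ : 0 < κ)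
    (hα : ∀ x, 0 ≤ x → |α x| ≤ C * Real.exp (-κ * x)) (hf : ∀ x, 0 ≤ x → |f x| ≤ D)
    {x : ℝ} (hx : 0 ≤ x) : |hankel α f x| ≤ C * D / κ * Real.exp (-κ * x) := by
  have hD : 0 ≤ D := (abs_nonneg _).trans (hf 0 le_rfl)
  have h := norm_integral_le_of_norm_le (μ := halfLine) (f := fun y => α (x + y) * f y)
    ((integrable_exp_halfLine hκ).const_mul (C * D * Real.exp (-κ * x))) (by
      filter_upwards [ae_halfLine] with y hy
      rw [Real.norm_eq_abs, abs_mul]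
      calc |α (x + y)| * |f y| ≤ (C * Real.exp (-κ * (x + y))) * D :=
            mul_le_mul (hα _ (add_nonneg hx hy)) (hf y hy) (abs_nonneg _)
              ((abs_nonneg _).trans (hα _ (add_nonneg hx hy)))
        _ = _ := by rw [mul_add, Real.exp_add]; ring)
  rw [integral_const_mul, integral_exp_halfLine hκ] at h
  refine h.trans (le_of_eq ?_)
  ring

/-- `F i → f` pointwise on `[0,∞)`, with a common exponential bound. -/
structure DominatedLimit {ι : Type*} (l : Filter ι) (F : ι → ℝ → ℝ) (f : ℝ → ℝ) (C κ : ℝ) :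
    Prop where
  meas : ∀ᶠ i in l, Measurable (F i)
  meas_lim : Measurable f
  bound : ∀ᶠ i in l, ∀ x, 0 ≤ x → |F i x| ≤ C * Real.exp (-κ * x)
  bound_lim : ∀ x, 0 ≤ x → |f x| ≤ C * Real.exp (-κ * x)
  lim : ∀ x, 0 ≤ x → Tendsto (fun i => F i x) l (𝓝 (f x))

namespace DominatedLimit

variable {ι : Type*} {l : Filter ι} {F G : ι → ℝ → ℝ} {f g : ℝ → ℝ} {C D κ : ℝ}

lemma nonneg (h : DominatedLimit l F f C κ) : 0 ≤ C := by
  have := (abs_nonneg _).trans (h.bound_lim 0 le_rfl)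
  simpa using this

lemma mono (h : DominatedLimit l F f C κ) {κ' : ℝ} (hκ : κ' ≤ κ) : DominatedLimit l F f C κ' := by
  have hle : ∀ x : ℝ, 0 ≤ x → C * Real.exp (-κ * x) ≤ C * Real.exp (-κ' * x) := fun x hx =>
    mul_le_mul_of_nonneg_left (Real.exp_le_exp.2 (by nlinarith)) h.nonneg
  exact ⟨h.meas, h.meas_lim, h.bound.mono fun i hi x hx => (hi x hx).trans (hle x hx),
    fun x hx => (h.bound_lim x hx).trans (hle x hx), h.lim⟩

lemma tendsto_integral [l.IsCountablyGenerated] (h : DominatedLimit l F f C κ) (hκ : 0 < κ) :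
    Tendsto (fun i => ∫ x, F i x ∂halfLine) l (𝓝 (∫ x, f x ∂halfLine)) :=
  tendsto_integral_filter_of_dominated_convergence (fun x => C * Real.exp (-κ * x))
    (h.meas.mono fun _ hi => hi.aestronglyMeasurable)
    (h.bound.mono fun _ hi => ae_halfLine.mono fun x hx => hi x hx)
    ((integrable_exp_halfLine hκ).const_mul C) (ae_halfLine.mono fun x hx => h.lim x hx)

lemma tendsto_toL2 [l.IsCountablyGenerated] (h : DominatedLimit l F f C κ) (hκ : 0 < κ) :
    Tendsto (fun i => toL2 halfLine (F i)) l (𝓝 (toL2 halfLine f)) :=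
  StationaryTASEP.tendsto_toL2 (g := fun x => C * Real.exp (-κ * x))
    (h.meas.mono fun _ hi => hi.aestronglyMeasurable) h.meas_lim.aestronglyMeasurable
    ((memLp_exp_halfLine hκ).const_mul C)
    (h.bound.mono fun _ hi => ae_halfLine.mono fun x hx => hi x hx)
    (ae_halfLine.mono fun x hx => h.bound_lim x hx) (ae_halfLine.mono fun x hx => h.lim x hx)

/-- A rate 0 encodes uniform boundedness, so one factor carries all the decay. -/
lemma mul (hF : DominatedLimit l F f C κ) (hG : DominatedLimit l G g D 0) :
    DominatedLimit l (fun i x => F i x * G i x) (fun x => f x * g x) (C * D) κ := by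
  have key : ∀ a b x : ℝ, |a| ≤ C * Real.exp (-κ * x) → |b| ≤ D * Real.exp (-0 * x) →
      |a * b| ≤ C * D * Real.exp (-κ * x) := by
    intro a b x ha hb
    rw [neg_zero, zero_mul, Real.exp_zero, mul_one] at hb
    rw [abs_mul, mul_right_comm]
    exact mul_le_mul ha hb (abs_nonneg _) ((abs_nonneg _).trans ha)
  refine ⟨?_, hF.meas_lim.mul hG.meas_lim, ?_,
    fun x hx => key _ _ _ (hF.bound_lim x hx) (hG.bound_lim x hx),
    fun x hx => (hF.lim x hx).mul (hG.lim x hx)⟩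
  · filter_upwards [hF.meas, hG.meas] with i h1 h2 using h1.mul h2
  · filter_upwards [hF.bound, hG.bound] with i h1 h2 x hx using key _ _ _ (h1 x hx) (h2 x hx)

lemma shift (h : DominatedLimit l F f C κ) (hκ : 0 ≤ κ) {y : ℝ} (hy : 0 ≤ y) :
    DominatedLimit l (fun i x => F i (x + y)) (fun x => f (x + y)) (C * Real.exp (-κ * y)) 0 := by
  have key : ∀ x : ℝ, 0 ≤ x → C * Real.exp (-κ * (x + y)) ≤
      C * Real.exp (-κ * y) * Real.exp (-0 * x) := by
    intro x hx
    rw [mul_assoc, ← Real.exp_add]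
    exact mul_le_mul_of_nonneg_left (Real.exp_le_exp.2 (by nlinarith)) h.nonneg
  exact ⟨h.meas.mono fun i hi => hi.comp (measurable_id.add_const y),
    h.meas_lim.comp (measurable_id.add_const y),
    h.bound.mono fun i hi x hx => (hi _ (add_nonneg hx hy)).trans (key x hx),
    fun x hx => (h.bound_lim _ (add_nonneg hx hy)).trans (key x hx),
    fun x hx => h.lim _ (add_nonneg hx hy)⟩

lemma const_one : DominatedLimit l (fun _ _ => (1 : ℝ)) (fun _ => 1) 1 0 := by
  refine ⟨Eventually.of_forall fun _ => measurable_const, measurable_const,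
    Eventually.of_forall fun _ x _ => ?_, fun x _ => ?_, fun x _ => tendsto_const_nhds⟩ <;> simp

/-- The kernel is evaluated at x + y, hence supplies decay in x as well as integrability in y;
boundedness of the second function is enough. -/
lemma hankel [l.IsCountablyGenerated] (hF : DominatedLimit l F f C κ) (hκ : 0 < κ)
    (hG : DominatedLimit l G g D 0) :
    DominatedLimit l (fun i => hankel (F i) (G i)) (hankel f g) (C * D / κ) κ := by
  have h0 : ∀ y : ℝ, D * Real.exp (-0 * y) = D := by simp
  have hGb := hG.bound
  have hgb := hG.bound_lim
  simp only [h0] at hGb hgb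
  refine ⟨?_, measurable_hankel hF.meas_lim hG.meas_lim, ?_,
    fun x hx => abs_hankel_le hκ hF.bound_lim hgb hx, fun x hx => ?_⟩
  · filter_upwards [hF.meas, hG.meas] with i h1 h2 using measurable_hankel h1 h2
  · filter_upwards [hF.bound, hGb] with i h1 h2 x hx using abs_hankel_le hκ h1 h2 hx
  · have h1 := ((hF.shift hκ.le hx).mul (hG))
    refine tendsto_integral_filter_of_dominated_convergence
      (fun y => C * D * Real.exp (-κ * x) * Real.exp (-κ * y)) ?_ ?_
      ((integrable_exp_halfLine hκ).const_mul _) ?_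
    · filter_upwards [hF.meas, hG.meas] with i h2 h3
      exact ((h2.comp (measurable_id.const_add x)).mul h3).aestronglyMeasurable
    · filter_upwards [hF.bound, hGb] with i h2 h3
      filter_upwards [ae_halfLine] with y hy
      rw [Real.norm_eq_abs, abs_mul]
      calc _ ≤ (C * Real.exp (-κ * (x + y))) * D :=
            mul_le_mul (h2 _ (add_nonneg hx hy)) (h3 y hy) (abs_nonneg _)
              ((abs_nonneg _).trans (h2 _ (add_nonneg hx hy)))
        _ = _ := by rw [mul_add, Real.exp_add]; ring
    · filter_upwards [ae_halfLine] with y hy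
      exact (hF.lim _ (add_nonneg hx hy)).mul (hG.lim y hy)

lemma one_sub (hF : DominatedLimit l F f C κ) (hκ : 0 ≤ κ) :
    DominatedLimit l (fun i x => 1 - F i x) (fun x => 1 - f x) (1 + C) 0 := by
  have key : ∀ a x : ℝ, 0 ≤ x → |a| ≤ C * Real.exp (-κ * x) →
      |1 - a| ≤ (1 + C) * Real.exp (-0 * x) := by
    intro a x hx ha
    rw [neg_zero, zero_mul, Real.exp_zero, mul_one]
    refine (abs_sub _ _).trans ?_
    rw [abs_one]
    have : C * Real.exp (-κ * x) ≤ C :=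
      mul_le_of_le_one_right hF.nonneg (Real.exp_le_one_iff.2 (by nlinarith))
    linarith
  exact ⟨hF.meas.mono fun i hi => measurable_const.sub hi, measurable_const.sub hF.meas_lim,
    hF.bound.mono fun i hi x hx => key _ x hx (hi x hx),
    fun x hx => key _ x hx (hF.bound_lim x hx), fun x hx => (hF.lim x hx).const_sub 1⟩

/-- The exponential weights cost at most W of the rate; this is why rates exceeding |w| are needed
later. -/
lemma exp_mul (hF : DominatedLimit l F f C κ) {w : ι → ℝ} {w₀ W : ℝ} (hw : Tendsto w l (𝓝 w₀))
    (hW : ∀ᶠ i in l, |w i| ≤ W) (hW₀ : |w₀| ≤ W) :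
    DominatedLimit l (fun i x => Real.exp (w i * x) * F i x) (fun x => Real.exp (w₀ * x) * f x)
      C (κ - W) := by
  have key : ∀ a w x : ℝ, 0 ≤ x → |w| ≤ W → |a| ≤ C * Real.exp (-κ * x) →
      |Real.exp (w * x) * a| ≤ C * Real.exp (-(κ - W) * x) := by
    intro a w x hx hw ha
    rw [abs_mul, Real.abs_exp]
    have h1 : Real.exp (w * x) ≤ Real.exp (W * x) :=
      Real.exp_le_exp.2 (mul_le_mul_of_nonneg_right ((le_abs_self _).trans hw) hx)
    calc _ ≤ Real.exp (W * x) * (C * Real.exp (-κ * x)) :=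
          mul_le_mul h1 ha (abs_nonneg _) (Real.exp_nonneg _)
      _ = C * (Real.exp (W * x) * Real.exp (-κ * x)) := by ring
      _ = _ := by rw [← Real.exp_add]; congr 2; ring
  have hm : ∀ w : ℝ, Measurable fun x : ℝ => Real.exp (w * x) := fun w => by fun_prop
  refine ⟨hF.meas.mono fun i hi => (hm _).mul hi, (hm _).mul hF.meas_lim, ?_,
    fun x hx => key _ _ x hx hW₀ (hF.bound_lim x hx), fun x hx => ?_⟩
  · filter_upwards [hF.bound, hW] with i h1 h2 x hx using key _ _ x hx h2 (h1 x hx)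
  · exact ((Real.continuous_exp.tendsto _).comp (hw.mul_const x)).mul (hF.lim x hx)

end DominatedLimit

/-! ### The edge functional -/

/-- The kernel `e^{w(x-y)} ∫_0^∞ β(x+z) α(z+y) dz`. -/
def edgeKernel (α β : ℝ → ℝ) (w x y : ℝ) : ℝ :=
  Real.exp (w * (x - y)) * ∫ z, β (x + z) * α (z + y) ∂halfLine

/-- `1 - ∫_0^∞ α(x+y) dy`. -/
def edgePsi (α : ℝ → ℝ) (x : ℝ) : ℝ := 1 - hankel α (fun _ => 1) x

/-- The functional of a pair of functions on the half line through which both the finite time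
quantity and its limit are expressed. -/
def edgeForm (α β : ℝ → ℝ) (w s : ℝ) : ℝ :=
  s + (∫ x, hankel α (fun _ => 1) x ∂halfLine) +
    (∫ x, hankel β (edgePsi α) x * edgePsi α x ∂halfLine) +
    inner ℝ (toL2 halfLine fun x => Real.exp (-w * x) * hankel α (hankel β (edgePsi α)) x)
      (Ring.inverse (1 - kernelOp halfLine (edgeKernel α β w))
        (toL2 halfLine fun x => Real.exp (w * x) * hankel β (edgePsi α) x))

lemma measurable_edgeKernel {α β : ℝ → ℝ} (hα : Measurable α) (hβ : Measurable β) (w : ℝ) :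
    Measurable (Function.uncurry (edgeKernel α β w)) := by
  have h : Measurable fun p : (ℝ × ℝ) × ℝ => β (p.1.1 + p.2) * α (p.2 + p.1.2) :=
    (hβ.comp (by fun_prop)).mul (hα.comp (by fun_prop))
  have h2 := (h.stronglyMeasurable.integral_prod_right' (ν := halfLine)).measurable
  have h3 : Measurable fun p : ℝ × ℝ => Real.exp (w * (p.1 - p.2)) := by fun_prop
  exact h3.mul h2

lemma abs_edgeKernel_le {α β : ℝ → ℝ} {C D κ w W : ℝ} (hκ : 0 < κ)
    (hα : ∀ x, 0 ≤ x → |α x| ≤ C * Real.exp (-κ * x))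
    (hβ : ∀ x, 0 ≤ x → |β x| ≤ D * Real.exp (-κ * x)) (hw : |w| ≤ W) {x y : ℝ} (hx : 0 ≤ x)
    (hy : 0 ≤ y) : |edgeKernel α β w x y| ≤
      D * C / κ * (Real.exp (-(κ - W) * x) * Real.exp (-(κ - W) * y)) := by
  have hC : 0 ≤ C := by simpa using (abs_nonneg _).trans (hα 0 le_rfl)
  have hD : 0 ≤ D := by simpa using (abs_nonneg _).trans (hβ 0 le_rfl)
  have h1 : |hankel β (fun z => α (z + y)) x| ≤
      D * (C * Real.exp (-κ * y)) / κ * Real.exp (-κ * x) := by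
    refine abs_hankel_le hκ hβ (fun z hz => (hα _ (add_nonneg hz hy)).trans ?_) hx
    exact mul_le_mul_of_nonneg_left (Real.exp_le_exp.2 (by nlinarith)) hC
  have h2 : Real.exp (w * (x - y)) ≤ Real.exp (W * x) * Real.exp (W * y) := by
    rw [← Real.exp_add]
    apply Real.exp_le_exp.2
    obtain ⟨h3, h4⟩ := abs_le.1 hw
    nlinarith
  rw [edgeKernel, abs_mul, Real.abs_exp]
  calc _ ≤ (Real.exp (W * x) * Real.exp (W * y)) *
        (D * (C * Real.exp (-κ * y)) / κ * Real.exp (-κ * x)) :=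
        mul_le_mul h2 h1 (abs_nonneg _) (by positivity)
    _ = D * C / κ * ((Real.exp (W * x) * Real.exp (-κ * x)) *
        (Real.exp (W * y) * Real.exp (-κ * y))) := by ring
    _ = _ := by
      rw [← Real.exp_add, ← Real.exp_add]
      congr 3 <;> ring

/-- Continuity of the edge functional under exponentially dominated convergence. -/
lemma tendsto_edgeForm {ι : Type*} {l : Filter ι} [l.IsCountablyGenerated]
    {α β : ι → ℝ → ℝ} {α₀ β₀ : ℝ → ℝ} {w s : ι → ℝ} {w₀ s₀ C D κ W : ℝ}
    (hα : DominatedLimit l α α₀ C κ) (hβ : DominatedLimit l β β₀ D κ)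
    (hw : Tendsto w l (𝓝 w₀)) (hs : Tendsto s l (𝓝 s₀))
    (hW : ∀ᶠ i in l, |w i| ≤ W) (hW₀ : |w₀| ≤ W) (hWκ : W < κ)
    (hu : IsUnit (1 - kernelOp halfLine (edgeKernel α₀ β₀ w₀))) :
    Tendsto (fun i => edgeForm (α i) (β i) (w i) (s i)) l (𝓝 (edgeForm α₀ β₀ w₀ s₀)) ∧
      ∀ᶠ i in l, IsUnit (1 - kernelOp halfLine (edgeKernel (α i) (β i) (w i))) := by
  have hW0 : 0 ≤ W := (abs_nonneg _).trans hW₀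
  have hκ : 0 < κ := hW0.trans_lt hWκ
  have hd : 0 < κ - W := sub_pos.2 hWκ
  have hA1 := hα.hankel hκ DominatedLimit.const_one
  have hg : DominatedLimit l (fun i => edgePsi (α i)) (edgePsi α₀) (1 + C * 1 / κ) 0 :=
    hA1.one_sub hκ.le
  have hB := hβ.hankel hκ hg
  have hAB := hα.hankel hκ (hB.mono hκ.le)
  have hBg := hB.mul hg
  have hq := hB.exp_mul hw hW hW₀
  have hp := hAB.exp_mul hw.neg (by simpa only [abs_neg] using hW)
    (show |-w₀| ≤ W by rwa [abs_neg])
  -- The conjugating weight e^{w(x-y)} is bounded by e^{Wx}e^{Wy}, and the decay rate κ > W leaves a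
  -- square integrable dominating kernel.
  have hT : Tendsto (fun i => kernelOp halfLine (edgeKernel (α i) (β i) (w i))) l
      (𝓝 (kernelOp halfLine (edgeKernel α₀ β₀ w₀))) := by
    refine tendsto_kernelOp (g := fun p => D * C / κ *
      (Real.exp (-(κ - W) * p.1) * Real.exp (-(κ - W) * p.2))) ?_
      (measurable_edgeKernel hα.meas_lim hβ.meas_lim _).aestronglyMeasurable
      (memLp_exp_halfLine_prod hd _) ?_ ?_ ?_
    · filter_upwards [hα.meas, hβ.meas] with i h1 h2
      exact (measurable_edgeKernel h1 h2 _).aestronglyMeasurable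
    · filter_upwards [hα.bound, hβ.bound, hW] with i h1 h2 h3
      filter_upwards [ae_halfLine_prod] with p hp
      exact abs_edgeKernel_le hκ h1 h2 h3 hp.1 hp.2
    · filter_upwards [ae_halfLine_prod] with p hp
      exact abs_edgeKernel_le hκ hα.bound_lim hβ.bound_lim hW₀ hp.1 hp.2
    · filter_upwards [ae_halfLine_prod] with p hp
      have h1 := (hβ.hankel hκ (hα.shift hκ.le hp.2)).lim p.1 hp.1
      exact ((Real.continuous_exp.tendsto _).comp (hw.mul_const (p.1 - p.2))).mul h1
  have h1T : Tendsto (fun i => 1 - kernelOp halfLine (edgeKernel (α i) (β i) (w i))) l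
      (𝓝 (1 - kernelOp halfLine (edgeKernel α₀ β₀ w₀))) := hT.const_sub 1
  have hN : Tendsto (fun i => Ring.inverse (1 - kernelOp halfLine (edgeKernel (α i) (β i) (w i)))) l
      (𝓝 (Ring.inverse (1 - kernelOp halfLine (edgeKernel α₀ β₀ w₀)))) := by
    obtain ⟨u, hu'⟩ := hu
    have := NormedRing.inverse_continuousAt u
    rw [hu'] at this
    exact this.tendsto.comp h1T
  -- The units are open, so invertibility of the limit operator passes to the approximating ones.
  refine ⟨?_, h1T.eventually (Units.isOpen.mem_nhds hu)⟩
  refine ((hs.add (hA1.tendsto_integral hκ)).add (hBg.tendsto_integral hκ)).add ?_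
  exact (hp.tendsto_toL2 hd).inner ((isBoundedBilinearMap_apply.continuous.tendsto (_, _)).comp
    (hN.prodMk_nhds (hq.tendsto_toL2 hd)))

end StationaryTASEP

end


noncomputable section

namespace StationaryTASEP

/-! ### The limit functional in terms of the Airy operator -/

lemma measurable_airyTransform (q : ℝ) {f : ℝ → ℝ} (hf : Measurable f) :
    Measurable (airyTransform q f) := by
  have h : Measurable fun p : ℝ × ℝ => airy (q + p.1 + p.2) * f p.2 :=
    (continuous_airy.measurable.comp (by fun_prop)).mul (hf.comp measurable_snd)
  exact (h.stronglyMeasurable.integral_prod_right' (ν := halfLine)).measurable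

/-- Ai decays faster than every exponential, so any exponential growth of f is permitted and the
transform decays at any chosen rate. The constant does not depend on f. -/
lemma abs_airyTransform_le (q : ℝ) {κ a : ℝ} (hκ : 0 < κ) (hκa : a < κ) : ∃ C, 0 < C ∧
    ∀ (f : ℝ → ℝ) (D : ℝ), (∀ x, 0 ≤ x → |f x| ≤ D * Real.exp (a * x)) →
      ∀ x, |airyTransform q f x| ≤ C * D * Real.exp (-κ * x) := by
  obtain ⟨C, h0, hC⟩ := abs_airy_add_le hκ q
  have ha : 0 < κ - a := sub_pos.2 hκa
  refine ⟨C * (1 / (κ - a)), by positivity, fun f D hf x => ?_⟩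
  have h := norm_integral_le_of_norm_le (μ := halfLine) (f := fun y => airy (q + x + y) * f y)
    ((integrable_exp_halfLine ha).const_mul (C * D * Real.exp (-κ * x))) (by
      filter_upwards [ae_halfLine] with y hy
      rw [Real.norm_eq_abs, abs_mul]
      calc |airy (q + x + y)| * |f y| ≤ (C * (Real.exp (-κ * x) * Real.exp (-κ * y))) *
            (D * Real.exp (a * y)) :=
            mul_le_mul (hC _ _) (hf y hy) (abs_nonneg _) (by positivity)
        _ = C * D * Real.exp (-κ * x) * (Real.exp (-κ * y) * Real.exp (a * y)) := by ring
        _ = _ := by rw [← Real.exp_add]; congr 2; ring)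
  rw [integral_const_mul, integral_exp_halfLine ha] at h
  refine h.trans (le_of_eq ?_)
  ring

/-- Only integrability of g against e^{-κx} for large κ is asked, so g may be an L² function or a
growing exponential. -/
lemma integrable_airyTransform_kernel (q : ℝ) {f g : ℝ → ℝ} (hf : Measurable f)
    {a D : ℝ} (hfb : ∀ x, 0 ≤ x → |f x| ≤ D * Real.exp (a * x)) (hg : AEStronglyMeasurable g halfLine)
    (hgi : ∀ᶠ κ in atTop, Integrable (fun x => Real.exp (-κ * x) * g x) halfLine) :
    Integrable (fun p : ℝ × ℝ => g p.1 * (airy (q + p.1 + p.2) * f p.2))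
      (halfLine.prod halfLine) := by
  have hcont := continuous_airy
  obtain ⟨κ, hκ, hκ0, hκa⟩ := (hgi.and ((eventually_gt_atTop 0).and (eventually_gt_atTop a))).exists
  obtain ⟨C, h0, hC⟩ := abs_airy_add_le hκ0 q
  have ha : 0 < κ - a := sub_pos.2 hκa
  refine (((hκ.abs).mul_prod (integrable_exp_halfLine ha)).const_mul (C * D)).mono'
    (hg.comp_fst.mul (((hcont.measurable.comp (by fun_prop)).mul
      (hf.comp measurable_snd)).aestronglyMeasurable)) ?_
  filter_upwards [ae_halfLine_prod] with p hp
  rw [Real.norm_eq_abs, abs_mul, abs_mul, abs_mul, Real.abs_exp]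
  calc _ ≤ |g p.1| * ((C * (Real.exp (-κ * p.1) * Real.exp (-κ * p.2))) *
        (D * Real.exp (a * p.2))) :=
        mul_le_mul_of_nonneg_left (mul_le_mul (hC _ _) (hfb _ hp.2) (abs_nonneg _)
          (by positivity)) (abs_nonneg _)
    _ = C * D * (Real.exp (-κ * p.1) * |g p.1| * (Real.exp (-κ * p.2) * Real.exp (a * p.2))) := by
        ring
    _ = _ := by
      rw [← Real.exp_add]
      congr 3; ring

/-- The constant `e^{wq - w³/3}`, `q = w² + s`. -/
def edgeConst (w s : ℝ) : ℝ := Real.exp (w * (w ^ 2 + s) - w ^ 3 / 3)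

lemma edgeConst_pos (w s : ℝ) : 0 < edgeConst w s := Real.exp_pos _

lemma edgeConst_neg (w s : ℝ) : edgeConst (-w) s = (edgeConst w s)⁻¹ := by
  rw [edgeConst, edgeConst, ← Real.exp_neg]
  congr 1; ring

lemma phi_eq (w s z : ℝ) :
    phi w s z = edgeConst w s * (Real.exp (w * z) * airy (w ^ 2 + s + z)) := by
  rw [phi, edgeConst, ← mul_assoc, ← Real.exp_add, mul_assoc, ← Real.exp_add, mul_comm]
  congr 2; ring

lemma continuous_phi (w s : ℝ) : Continuous (phi w s) := by
  have := continuous_airy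
  unfold phi; fun_prop

lemma abs_phi_le (w s : ℝ) {κ : ℝ} (hκ : |w| < κ) :
    ∃ C, 0 < C ∧ ∀ z, |phi w s z| ≤ C * Real.exp (-κ * z) := by
  have hc : 0 < κ + w := by have := neg_abs_le w; linarith
  obtain ⟨C, h0, hC⟩ := abs_airy_le hc
  refine ⟨edgeConst w s * C * Real.exp (-(κ + w) * (w ^ 2 + s)),
    mul_pos (mul_pos (edgeConst_pos _ _) h0) (Real.exp_pos _), fun z => ?_⟩
  rw [phi_eq, abs_mul, abs_mul, Real.abs_exp, abs_of_pos (edgeConst_pos _ _)]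
  calc _ ≤ edgeConst w s * (Real.exp (w * z) * (C * Real.exp (-(κ + w) * (w ^ 2 + s + z)))) :=
        mul_le_mul_of_nonneg_left (mul_le_mul_of_nonneg_left (hC _) (Real.exp_nonneg _))
          (edgeConst_pos _ _).le
    _ = edgeConst w s * C * (Real.exp (w * z) * Real.exp (-(κ + w) * (w ^ 2 + s + z))) := by ring
    _ = _ := by
      rw [← Real.exp_add, mul_assoc _ (Real.exp _) (Real.exp _), ← Real.exp_add]
      congr 2; ring

/-- Since φ(x+y) splits as a constant times e^{wx}e^{wy}Ai, the Hankel operator of φ is the Airy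
transform between two multiplications by e^{wx}. -/
lemma hankel_phi (w s : ℝ) (f : ℝ → ℝ) (x : ℝ) : hankel (phi w s) f x =
    edgeConst w s * (Real.exp (w * x) *
      airyTransform (w ^ 2 + s) (fun y => Real.exp (w * y) * f y) x) := by
  rw [hankel, airyTransform, ← integral_const_mul, ← integral_const_mul]
  congr 1; funext y
  rw [phi_eq, mul_add, Real.exp_add, ← add_assoc]
  ring

/-- The constants of φ_w and φ_{-w} are inverse to each other, and e^{w(x-y)} cancels
e^{-w(x+z)}e^{w(z+y)}: the weight w was chosen for this. -/
lemma edgeKernel_phi (w s : ℝ) :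
    edgeKernel (phi w s) (phi (-w) s) w = airyKernel (w ^ 2 + s) := by
  rw [airyKernel_eq]
  funext x y
  rw [edgeKernel, ← integral_const_mul]
  congr 1; funext z
  rw [phi_eq, phi_eq, edgeConst_neg, neg_sq, ← add_assoc, ← add_assoc]
  have h : Real.exp (w * (x - y)) * (Real.exp (-w * (x + z)) * Real.exp (w * (z + y))) = 1 := by
    rw [← Real.exp_add, ← Real.exp_add, ← Real.exp_zero]
    congr 1; ring
  have hc := (edgeConst_pos w s).ne'
  calc _ = (edgeConst w s)⁻¹ * edgeConst w s * (Real.exp (w * (x - y)) *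
        (Real.exp (-w * (x + z)) * Real.exp (w * (z + y)))) *
        (airy (w ^ 2 + s + x + z) * airy (w ^ 2 + s + z + y)) := by ring
    _ = _ := by rw [h, inv_mul_cancel₀ hc, one_mul, one_mul]

lemma limPsi_eq (w s x : ℝ) : limPsi w s x = Real.exp (-w * x) * edgePsi (phi w s) x := by
  rw [limPsi, edgePsi, hankel, integral_Ici_eq_integral_Ioi]
  simp only [mul_one, add_comm]

lemma measurable_edgePsi_phi (w s : ℝ) : Measurable (edgePsi (phi w s)) :=
  measurable_const.sub (measurable_hankel (continuous_phi w s).measurable measurable_const)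

lemma measurable_limPsi (w s : ℝ) : Measurable (limPsi w s) := by
  rw [show limPsi w s = fun x => Real.exp (-w * x) * edgePsi (phi w s) x from
    funext (limPsi_eq w s)]
  exact (by fun_prop : Measurable fun x : ℝ => Real.exp (-w * x)).mul (measurable_edgePsi_phi w s)

lemma abs_limPsi_le (w s : ℝ) :
    ∃ D, 0 < D ∧ ∀ x, 0 ≤ x → |limPsi w s x| ≤ D * Real.exp (-w * x) := by
  have hκ : 0 < |w| + 1 := by positivity
  obtain ⟨C, h0, hC⟩ := abs_phi_le w s (lt_add_one |w|)
  refine ⟨1 + C * 1 / (|w| + 1), by positivity, fun x hx => ?_⟩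
  rw [limPsi_eq, abs_mul, Real.abs_exp, mul_comm]
  refine mul_le_mul_of_nonneg_right ?_ (Real.exp_nonneg _)
  have h1 := abs_hankel_le (f := fun _ => 1) (D := 1) hκ (fun x _ => hC x) (by simp) hx
  have h2 : C * 1 / (|w| + 1) * Real.exp (-(|w| + 1) * x) ≤ C * 1 / (|w| + 1) :=
    mul_le_of_le_one_right (by positivity) (Real.exp_le_one_iff.2 (by nlinarith))
  rw [edgePsi]
  refine (abs_sub _ _).trans ?_
  rw [abs_one]
  linarith

lemma hankel_phi_neg_edgePsi (w s x : ℝ) : hankel (phi (-w) s) (edgePsi (phi w s)) x =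
    (edgeConst w s)⁻¹ * (Real.exp (-w * x) * airyTransform (w ^ 2 + s) (limPsi w s) x) := by
  rw [hankel_phi, edgeConst_neg, neg_sq]
  rw [show limPsi w s = fun y => Real.exp (-w * y) * edgePsi (phi w s) y from
    funext (limPsi_eq w s)]

/-- Φ is a multiple of the Airy transform of Ψ, so it decays at every exponential rate even when Ψ
grows. -/
lemma limPhi_eq (w s x : ℝ) :
    limPhi w s x = (edgeConst w s)⁻¹ * airyTransform (w ^ 2 + s) (limPsi w s) x := by
  have h : limPhi w s x = Real.exp (w * x) * hankel (phi (-w) s) (edgePsi (phi w s)) x := by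
    rw [limPhi, hankel, ← integral_Ici_eq_integral_Ioi]
    congr 2; funext y
    rw [edgePsi, hankel, ← integral_Ici_eq_integral_Ioi]
    simp only [mul_one, add_comm]
  rw [h, hankel_phi_neg_edgePsi]
  have : Real.exp (w * x) * Real.exp (-w * x) = 1 := by
    rw [← Real.exp_add, ← Real.exp_zero]; congr 1; ring
  calc _ = (edgeConst w s)⁻¹ * (Real.exp (w * x) * Real.exp (-w * x)) *
        airyTransform (w ^ 2 + s) (limPsi w s) x := by ring
    _ = _ := by rw [this, mul_one]

lemma limS_eq (w s : ℝ) : limS w s = s + ∫ x, hankel (phi w s) (fun _ => 1) x ∂halfLine := by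
  rw [limS, integral_Ici_eq_integral_Ioi]
  simp only [hankel, integral_Ici_eq_integral_Ioi, mul_one]

lemma measurable_limPhi (w s : ℝ) : Measurable (limPhi w s) := by
  rw [show limPhi w s = fun x => (edgeConst w s)⁻¹ * airyTransform (w ^ 2 + s) (limPsi w s) x from
    funext (limPhi_eq w s)]
  exact (measurable_airyTransform _ (measurable_limPsi w s)).const_mul _

lemma abs_limPhi_le (w s : ℝ) {κ : ℝ} (hκ : |w| < κ) :
    ∃ D, 0 < D ∧ ∀ x, |limPhi w s x| ≤ D * Real.exp (-κ * x) := by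
  obtain ⟨D, hD0, hD⟩ := abs_limPsi_le w s
  obtain ⟨C, hC0, hC⟩ := abs_airyTransform_le (w ^ 2 + s) (a := -w)
    ((abs_nonneg w).trans_lt hκ) ((neg_le_abs w).trans_lt hκ)
  have hc := inv_pos.2 (edgeConst_pos w s)
  refine ⟨(edgeConst w s)⁻¹ * (C * D), by positivity, fun x => ?_⟩
  rw [limPhi_eq, abs_mul, abs_of_pos hc, mul_assoc]
  exact mul_le_mul_of_nonneg_left (hC _ D hD x) hc.le

lemma memLp_limPhi (w s : ℝ) : MemLp (limPhi w s) 2 halfLine := by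
  obtain ⟨D, hD0, hD⟩ := abs_limPhi_le w s (lt_add_one |w|)
  exact memLp_halfLine_of_bound (measurable_limPhi w s).aestronglyMeasurable
    (by positivity) fun x _ => hD x

lemma memLp_airyTransform_of_bound (q : ℝ) {f : ℝ → ℝ} (hf : Measurable f) {a D : ℝ}
    (hfb : ∀ x, 0 ≤ x → |f x| ≤ D * Real.exp (a * x)) : MemLp (airyTransform q f) 2 halfLine := by
  have hκ : 0 < |a| + 1 := by positivity
  obtain ⟨C, hC0, hC⟩ := abs_airyTransform_le q (a := a) hκ ((le_abs_self a).trans_lt (lt_add_one _))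
  exact memLp_halfLine_of_bound (measurable_airyTransform q hf).aestronglyMeasurable hκ
    fun x _ => hC f D hfb x

lemma integrable_limPhi_mul_limPsi (w s : ℝ) :
    Integrable (fun x => limPhi w s x * limPsi w s x) halfLine := by
  obtain ⟨D, hD0, hD⟩ := abs_limPsi_le w s
  obtain ⟨E, hE0, hE⟩ := abs_limPhi_le w s (lt_add_one |w|)
  refine integrable_halfLine_of_bound (C := E * D) (κ := |w| + 1 + w) ((measurable_limPhi w s).mul
    (measurable_limPsi w s)).aestronglyMeasurable
    (by have := neg_abs_le w; linarith) fun x hx => ?_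
  rw [abs_mul]
  calc _ ≤ (E * Real.exp (-(|w| + 1) * x)) * (D * Real.exp (-w * x)) :=
        mul_le_mul (hE x) (hD x hx) (abs_nonneg _) (by positivity)
    _ = E * D * (Real.exp (-(|w| + 1) * x) * Real.exp (-w * x)) := by ring
    _ = _ := by rw [← Real.exp_add]; congr 2; ring

lemma integrable_exp_mul_of_memLp {g : ℝ → ℝ} (hg : MemLp g 2 halfLine) :
    ∀ᶠ κ in atTop, Integrable (fun x => Real.exp (-κ * x) * g x) halfLine :=
  (eventually_gt_atTop 0).mono fun _ hκ => MemLp.integrable_fun_mul (memLp_exp_halfLine hκ) hg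

/-- With K_Ai = A², the resolvent is applied only to AΨ and paired only with AΦ. Both are in L² for
every real w, although Ψ need not be. -/
lemma edgeLimit_eq (w s : ℝ) : edgeLimit w s = limS w s +
    ((∫ x, limPhi w s x * limPsi w s x ∂halfLine) +
      inner ℝ (toL2 halfLine (airyTransform (w ^ 2 + s) (limPhi w s)))
        (Ring.inverse (1 - airyOp (w ^ 2 + s) * airyOp (w ^ 2 + s))
          (toL2 halfLine (airyTransform (w ^ 2 + s) (limPsi w s))))) := by
  set q := w ^ 2 + s
  have hu := isUnit_one_sub_airyKernel q
  rw [← kernelOp_airyKernel]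
  rw [airyKernel_eq] at hu ⊢
  obtain ⟨D, hD0, hD⟩ := abs_limPsi_le w s
  have h := resolventPairing_factor (memLp_airyShift q) (memLp_airyShift q) hu
    (memLp_limPhi w s) (integrable_limPhi_mul_limPsi w s) (fun h hh =>
      integrable_airyTransform_kernel q (measurable_limPsi w s) hD hh.1
        (integrable_exp_mul_of_memLp hh))
    (memLp_airyTransform_of_bound q (measurable_limPsi w s) hD)
  rw [edgeLimit, airyKernel_eq]
  change _ + resolventPairing halfLine _ _ _ = _
  rw [h]
  congr 4
  funext v
  rw [airyTransform]
  congr 1; funext x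
  rw [add_right_comm]

lemma toL2_const_mul {μ : Measure ℝ} {f : ℝ → ℝ} (c : ℝ) (hf : MemLp f 2 μ) :
    toL2 μ (fun x => c * f x) = c • toL2 μ f := by
  rw [toL2_of_memLp hf, toL2_of_memLp (hf.const_mul c)]
  exact MemLp.toLp_const_smul c hf

/-- This holds for w of either sign. The constants c and c⁻¹ arising from the two Hankel operators
cancel in the inner product. -/
lemma edgeLimit_eq_edgeForm (w s : ℝ) :
    edgeLimit w s = edgeForm (phi w s) (phi (-w) s) w s := by
  obtain ⟨D, hD0, hD⟩ := abs_limPsi_le w s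
  have hc := (edgeConst_pos w s).ne'
  have hexp : ∀ x : ℝ, Real.exp (w * x) * Real.exp (-w * x) = 1 := fun x => by
    rw [← Real.exp_add, ← Real.exp_zero]; congr 1; ring
  have h1 : (fun x => Real.exp (w * x) * hankel (phi (-w) s) (edgePsi (phi w s)) x) =
      fun x => (edgeConst w s)⁻¹ * airyTransform (w ^ 2 + s) (limPsi w s) x := by
    funext x
    rw [hankel_phi_neg_edgePsi, mul_left_comm, ← mul_assoc (Real.exp _), hexp, one_mul]
  have h2 : (fun x => Real.exp (-w * x) *
      hankel (phi w s) (hankel (phi (-w) s) (edgePsi (phi w s))) x) =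
      fun x => edgeConst w s * airyTransform (w ^ 2 + s) (limPhi w s) x := by
    funext x
    rw [hankel_phi]
    have : (fun y => Real.exp (w * y) * hankel (phi (-w) s) (edgePsi (phi w s)) y) =
        limPhi w s := by rw [h1]; funext x; rw [limPhi_eq]
    rw [this, mul_left_comm, ← mul_assoc (Real.exp _), mul_comm (Real.exp _) (Real.exp _), hexp,
      one_mul]
  rw [edgeLimit_eq, edgeForm, h1, h2, edgeKernel_phi, kernelOp_airyKernel, limS_eq,
    toL2_const_mul _ (memLp_airyTransform_of_bound _ (measurable_limPsi w s) hD),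
    toL2_const_mul _ (memLp_airyTransform_of_bound _ (measurable_limPhi w s) (a := -(|w| + 1))
      (fun x _ => (abs_limPhi_le w s (lt_add_one |w|)).choose_spec.2 x)), map_smul,
    real_inner_smul_left, real_inner_smul_right, ← mul_assoc, mul_inv_cancel₀ hc, one_mul,
    ← add_assoc]
  congr 3
  funext x
  rw [hankel_phi_neg_edgePsi, limPhi_eq, limPsi_eq]
  ring

end StationaryTASEP

end


noncomputable section

namespace StationaryTASEP

/-! ### Symmetry of the limit functional -/

lemma inner_airyOp_comm (q : ℝ) (f g : Lp ℝ 2 halfLine) :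
    inner ℝ (airyOp q f) g = inner ℝ f (airyOp q g) := by
  rw [Lp.inner_eq_integral, Lp.inner_eq_integral]
  have h := integral_mul_integral_mul_comm (memLp_airyShift q) (Lp.memLp f) (Lp.memLp g)
  have h1 : ∫ x, f x * airyOp q g x ∂halfLine =
      ∫ x, f x * ∫ y, airy (q + x + y) * g y ∂halfLine ∂halfLine := by
    refine integral_congr_ae ?_
    filter_upwards [coeFn_integralOp (memLp_airyShift q) g] with x hx
    rw [airyOp, hx]
  have h2 : ∫ x, airyOp q f x * g x ∂halfLine =
      ∫ y, (∫ x, airy (q + x + y) * f x ∂halfLine) * g y ∂halfLine := by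
    refine integral_congr_ae ?_
    filter_upwards [coeFn_integralOp (memLp_airyShift q) f] with x hx
    rw [airyOp, hx]
    simp only [add_right_comm q]
  rw [h1, h2, h]

lemma toL2_airyTransform (q : ℝ) {f : ℝ → ℝ} (hf : MemLp f 2 halfLine) :
    toL2 halfLine (airyTransform q f) = airyOp q (toL2 halfLine f) := by
  rw [toL2_of_memLp hf, airyOp, integralOp_toLp]
  exact toL2_of_memLp (memLp_integral_mul (memLp_airyShift q) hf)

lemma toL2_sub {μ : Measure ℝ} {f g : ℝ → ℝ} (hf : MemLp f 2 μ) (hg : MemLp g 2 μ) :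
    toL2 μ (fun x => f x - g x) = toL2 μ f - toL2 μ g := by
  rw [toL2_of_memLp hf, toL2_of_memLp hg]
  exact toL2_of_memLp (hf.sub hg)

lemma inner_toL2 {μ : Measure ℝ} {f g : ℝ → ℝ} (hf : MemLp f 2 μ) (hg : MemLp g 2 μ) :
    inner ℝ (toL2 μ f) (toL2 μ g) = ∫ x, f x * g x ∂μ := by
  rw [toL2_of_memLp hf, toL2_of_memLp hg, MemLp.inner_toLp]

/-- The algebraic identity behind the symmetry of the limit functional. -/
lemma symmetric_resolvent_identity {H : Type*} [NormedAddCommGroup H] [InnerProductSpace ℝ H]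
    (A : H →L[ℝ] H) (hA : ∀ x y, inner ℝ (A x) y = inner ℝ x (A y)) (hu : IsUnit (1 - A * A))
    (e f : H) {c : ℝ} (hc : c ≠ 0) :
    c⁻¹ * inner ℝ e (A e) - inner ℝ f (A e) - c⁻¹ * inner ℝ (c • f - A (A e)) (A e) +
      inner ℝ (A (c • f - A (A e))) (Ring.inverse (1 - A * A) (f - c⁻¹ • A (A e))) =
    inner ℝ (c⁻¹ • A (e - c • f)) (e - c • f) +
      inner ℝ (c⁻¹ • A (A (e - c • f))) (Ring.inverse (1 - A * A) (A (e - c • f))) := by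
  set N := Ring.inverse (1 - A * A) with hN
  have hl : ∀ x, N (x - A (A x)) = x := fun x =>
    DFunLike.congr_fun (Ring.inverse_mul_cancel _ hu) x
  have hr : ∀ x, N x - A (A (N x)) = x := fun x =>
    DFunLike.congr_fun (Ring.mul_inverse_cancel _ hu) x
  -- N commutes with A; this is checked by applying 1 - A² and cancelling it.
  have h1 : N (f - c⁻¹ • A (A e)) = N f - c⁻¹ • A (A (N e)) := by
    conv_lhs => rw [← hr f, ← hr e]
    rw [← hl (N f - c⁻¹ • A (A (N e)))]
    congr 1
    simp only [map_sub, map_smul, smul_sub]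
    abel
  have h2 : N (A (e - c • f)) = A (N e - c • N f) := by
    conv_lhs => rw [← hr f, ← hr e]
    rw [← hl (A (N e - c • N f))]
    congr 1
    simp only [map_sub, map_smul, smul_sub]
    abel
  rw [h1, h2]
  -- Substituting e = E - A²E and f = F - A²F with E = Ne, F = Nf removes the resolvent. Both sides
  -- become combinations of ⟨E,AʲE⟩, ⟨E,AʲF⟩ and ⟨F,AʲF⟩ with j odd, compared using the symmetry of
  -- A.
  have he := (hr e).symm
  have hf := (hr f).symm
  generalize N e = E at *
  generalize N f = F at *
  subst he hf
  have hs : ∀ x y, inner ℝ x (A y) = inner ℝ y (A x) := fun x y => by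
    rw [← hA, real_inner_comm]
  simp only [map_sub, map_smul, smul_sub, inner_sub_left, inner_sub_right, real_inner_smul_left,
    real_inner_smul_right, hA]
  have s1 : inner ℝ F (A E) = inner ℝ E (A F) := hs _ _
  have s3 : inner ℝ F (A (A (A E))) = inner ℝ E (A (A (A F))) := by rw [hs, hA, hA]
  have s5 : inner ℝ F (A (A (A (A (A E))))) = inner ℝ E (A (A (A (A (A F))))) := by
    rw [hs, hA, hA, hA, hA]
  simp only [s1, s3, s5]
  field_simp
  ring

/-- The decomposition Ψ_w = e^{-wx} - cA(e^{w·}), which makes the effect of w ↦ -w visible. -/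
lemma limPsi_eq_sub (w s x : ℝ) : limPsi w s x = Real.exp (-w * x) -
    edgeConst w s * airyTransform (w ^ 2 + s) (fun y => Real.exp (w * y)) x := by
  rw [limPsi_eq, edgePsi, hankel_phi, mul_sub, mul_one]
  simp only [mul_one]
  have : Real.exp (w * x) * Real.exp (-w * x) = 1 := by
    rw [← Real.exp_add, ← Real.exp_zero]; congr 1; ring
  linear_combination (-edgeConst w s *
    airyTransform (w ^ 2 + s) (fun y => Real.exp (w * y)) x) * this

lemma integral_hankel_phi (w s : ℝ) : ∫ x, hankel (phi w s) (fun _ => 1) x ∂halfLine =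
    edgeConst w s *
      ∫ x, Real.exp (w * x) * airyTransform (w ^ 2 + s) (fun y => Real.exp (w * y)) x ∂halfLine := by
  rw [← integral_const_mul]
  congr 1; funext x
  rw [hankel_phi]
  simp only [mul_one]

lemma exp_bound (w : ℝ) : ∀ x : ℝ, 0 ≤ x → |Real.exp (w * x)| ≤ 1 * Real.exp (w * x) :=
  fun x _ => by rw [Real.abs_exp, one_mul]

lemma measurable_exp_mul (w : ℝ) : Measurable fun x : ℝ => Real.exp (w * x) := by fun_prop

lemma integrable_airy_mul (q x : ℝ) {f : ℝ → ℝ} (hf : Measurable f) {a D : ℝ}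
    (hfb : ∀ x, 0 ≤ x → |f x| ≤ D * Real.exp (a * x)) :
    Integrable (fun y => airy (q + x + y) * f y) halfLine := by
  have hκ : 0 < |a| + 1 := by positivity
  obtain ⟨C, h0, hC⟩ := abs_airy_add_le hκ q
  refine integrable_halfLine_of_bound (C := C * Real.exp (-(|a| + 1) * x) * D) (κ := |a| + 1 - a)
    ((continuous_airy.measurable.comp (by fun_prop)).mul hf).aestronglyMeasurable
    (by have := le_abs_self a; linarith) fun y hy => ?_
  rw [abs_mul]
  calc _ ≤ (C * (Real.exp (-(|a| + 1) * x) * Real.exp (-(|a| + 1) * y))) *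
        (D * Real.exp (a * y)) := mul_le_mul (hC _ _) (hfb y hy) (abs_nonneg _) (by positivity)
    _ = C * Real.exp (-(|a| + 1) * x) * D * (Real.exp (-(|a| + 1) * y) * Real.exp (a * y)) := by
        ring
    _ = _ := by rw [← Real.exp_add]; congr 2; ring

lemma airyTransform_sub (q : ℝ) {f g : ℝ → ℝ} (hf : Measurable f) (hg : Measurable g)
    {a D b E : ℝ} (hfb : ∀ x, 0 ≤ x → |f x| ≤ D * Real.exp (a * x))
    (hgb : ∀ x, 0 ≤ x → |g x| ≤ E * Real.exp (b * x)) (c x : ℝ) :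
    airyTransform q (fun y => f y - c * g y) x =
      airyTransform q f x - c * airyTransform q g x := by
  simp only [airyTransform]
  rw [← integral_const_mul, ← integral_sub (integrable_airy_mul q x hf hfb)
    ((integrable_airy_mul q x hg hgb).const_mul c)]
  congr 1; funext y; ring

/-- `∫ h (T f) = ∫ (T h) f` for the Airy transform `T`. -/
lemma integral_mul_airyTransform (q : ℝ) {f g : ℝ → ℝ} (hf : Measurable f)
    {a D : ℝ} (hfb : ∀ x, 0 ≤ x → |f x| ≤ D * Real.exp (a * x)) (hg : AEStronglyMeasurable g halfLine)
    (hgi : ∀ᶠ κ in atTop, Integrable (fun x => Real.exp (-κ * x) * g x) halfLine) :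
    ∫ x, g x * airyTransform q f x ∂halfLine = ∫ y, airyTransform q g y * f y ∂halfLine := by
  have h := integrable_airyTransform_kernel q hf hfb hg hgi
  simp only [airyTransform, ← integral_const_mul, ← integral_mul_const]
  rw [integral_integral_swap h]
  congr 1; funext y; congr 1; funext x
  rw [add_right_comm]; ring

/-- For w > 0 the function e^{-wx} is in L² and e^{wx} is not, but its Airy transform f is.
Everything is written through e = e^{-w·} and f; the divergent-looking J = ∫e^{wx}A(e^{w·}) is
finite and occurs as cJ in S_w and in the pairing ⟨Φ_{-w},Ψ_{-w}⟩, so it cancels.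
`symmetric_resolvent_identity` compares the rest. -/
lemma edgeLimit_neg {w : ℝ} (hw : 0 < w) (s : ℝ) : edgeLimit (-w) s = edgeLimit w s := by
  set q := w ^ 2 + s with hq
  have hq' : (-w) ^ 2 + s = q := by rw [neg_sq]
  set c := edgeConst w s with hc
  have hc0 : c ≠ 0 := (edgeConst_pos w s).ne'
  have hce : edgeConst (-w) s = c⁻¹ := edgeConst_neg w s
  set em : ℝ → ℝ := fun x => Real.exp (-w * x) with hem
  set ep : ℝ → ℝ := fun x => Real.exp (w * x) with hep
  have hemL : MemLp em 2 halfLine := memLp_exp_halfLine hw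
  set Tem := airyTransform q em with hTem
  set f0 := airyTransform q ep with hf0
  have hTemL : MemLp Tem 2 halfLine :=
    memLp_airyTransform_of_bound q (measurable_exp_mul _) (exp_bound _)
  have hf0L : MemLp f0 2 halfLine :=
    memLp_airyTransform_of_bound q (measurable_exp_mul _) (exp_bound _)
  have hTemm : Measurable Tem := measurable_airyTransform q (measurable_exp_mul _)
  obtain ⟨CT, -, hCT⟩ := abs_airyTransform_le q (a := -w) (κ := w + 1) (by positivity) (by linarith)
  have hTemb : ∀ x, 0 ≤ x → |Tem x| ≤ CT * 1 * Real.exp (-(w + 1) * x) :=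
    fun x _ => hCT em 1 (exp_bound _) x
  obtain ⟨C2, -, hC2⟩ := abs_airyTransform_le q (a := -(w + 1)) (κ := w + 1)
    (by positivity) (by linarith)
  obtain ⟨C3, -, hC3⟩ := abs_airyTransform_le q (a := w) (κ := w + 1)
    (by positivity) (by linarith)
  have hTTL : MemLp (airyTransform q Tem) 2 halfLine := memLp_airyTransform_of_bound q hTemm hTemb
  set A := airyOp q with hA
  set e := toL2 halfLine em with he
  set f := toL2 halfLine f0 with hf
  have hTemA : toL2 halfLine Tem = A e := toL2_airyTransform q hemL
  have hTTA : toL2 halfLine (airyTransform q Tem) = A (A e) := by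
    rw [toL2_airyTransform q hTemL, hTemA]
  -- positive parameter
  have hPsi : limPsi w s = fun x => em x - c * f0 x := funext (limPsi_eq_sub w s)
  have hPsiL : MemLp (limPsi w s) 2 halfLine := by rw [hPsi]; exact hemL.sub (hf0L.const_mul c)
  have hPsi2 : toL2 halfLine (limPsi w s) = e - c • f := by
    rw [hPsi, toL2_sub hemL (hf0L.const_mul c), toL2_const_mul c hf0L]
  have hPhi2 : toL2 halfLine (limPhi w s) = c⁻¹ • A (e - c • f) := by
    rw [show limPhi w s = fun x => c⁻¹ * airyTransform q (limPsi w s) x from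
      funext (limPhi_eq w s), toL2_const_mul (f := airyTransform q (limPsi w s)) _
        (memLp_integral_mul (memLp_airyShift q) hPsiL)]
    exact congrArg _ ((toL2_airyTransform q hPsiL).trans (by rw [hPsi2]))
  -- negative parameter
  have hPsiN : limPsi (-w) s = fun x => ep x - c⁻¹ * Tem x := by
    funext x
    rw [limPsi_eq_sub, hq', hce, neg_neg]
  have hTPsiN : airyTransform q (limPsi (-w) s) = fun x => f0 x - c⁻¹ * airyTransform q Tem x := by
    rw [hPsiN]
    funext x
    exact airyTransform_sub q (measurable_exp_mul _) hTemm (exp_bound _) hTemb _ _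
  have hTPsiN2 : toL2 halfLine (airyTransform q (limPsi (-w) s)) = f - c⁻¹ • A (A e) := by
    rw [hTPsiN, toL2_sub hf0L (hTTL.const_mul _), toL2_const_mul _ hTTL, hTTA]
  have hPhiN : limPhi (-w) s = fun x => c * f0 x - airyTransform q Tem x := by
    funext x
    rw [limPhi_eq, hce, inv_inv, hq', hTPsiN]
    field_simp
  have hPhiNL := memLp_limPhi (-w) s
  have hPhiN2 : toL2 halfLine (limPhi (-w) s) = c • f - A (A e) := by
    rw [hPhiN, toL2_sub (hf0L.const_mul c) hTTL, toL2_const_mul _ hf0L, hTTA]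
  set J := ∫ x, ep x * f0 x ∂halfLine with hJ
  have hSp : limS w s = s + c * J := by rw [limS_eq, integral_hankel_phi]
  have hSn : limS (-w) s = s + c⁻¹ * inner ℝ e (A e) := by
    rw [limS_eq, integral_hankel_phi, hce, hq', ← hTemA, he, inner_toL2 hemL hTemL]
  have hbd : ∀ g : ℝ → ℝ, Measurable g → (∃ B, ∀ x, |g x| ≤ B * Real.exp (-(w + 1) * x)) →
      Integrable (fun x => ep x * g x) halfLine := by
    rintro g hg ⟨B, hB⟩
    refine integrable_halfLine_of_bound (C := B) ((measurable_exp_mul w).mul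
      hg).aestronglyMeasurable one_pos fun x _ => ?_
    rw [abs_mul, Real.abs_exp]
    calc _ ≤ Real.exp (w * x) * (B * Real.exp (-(w + 1) * x)) :=
          mul_le_mul_of_nonneg_left (hB x) (Real.exp_nonneg _)
      _ = B * (Real.exp (w * x) * Real.exp (-(w + 1) * x)) := by ring
      _ = _ := by rw [← Real.exp_add]; congr 2; ring
  have hI1 : Integrable (fun x => ep x * f0 x) halfLine :=
    hbd _ (measurable_airyTransform q (measurable_exp_mul _)) ⟨_, hC3 ep 1 (exp_bound _)⟩
  have hI2 : Integrable (fun x => ep x * airyTransform q Tem x) halfLine :=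
    hbd _ (measurable_airyTransform q hTemm) ⟨_, hC2 Tem _ hTemb⟩
  have hpair : ∫ x, limPhi (-w) s x * limPsi (-w) s x ∂halfLine =
      c * J - inner ℝ f (A e) - c⁻¹ * inner ℝ (c • f - A (A e)) (A e) := by
    -- A is moved from its L² argument onto e^{wx}, which lies outside L², by Fubini rather than by
    -- the adjoint.
    have h1 : ∫ x, ep x * airyTransform q Tem x ∂halfLine = inner ℝ f (A e) := by
      rw [integral_mul_airyTransform q hTemm hTemb (measurable_exp_mul _).aestronglyMeasurable,
        ← hTemA, hf, inner_toL2 hf0L hTemL]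
      filter_upwards [eventually_gt_atTop w] with κ hκ
      refine (integrable_exp_halfLine (sub_pos.2 hκ)).congr (ae_of_all _ fun x => ?_)
      simp only
      rw [← Real.exp_add]; congr 1; ring
    have h2 : ∫ x, limPhi (-w) s x * Tem x ∂halfLine = inner ℝ (c • f - A (A e)) (A e) := by
      rw [← hPhiN2, ← hTemA, inner_toL2 hPhiNL hTemL]
    have h3 : ∀ x, limPhi (-w) s x * limPsi (-w) s x =
        (c * (ep x * f0 x) - ep x * airyTransform q Tem x) -
          c⁻¹ * (limPhi (-w) s x * Tem x) := by
      intro x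
      rw [hPhiN, hPsiN]; ring
    simp only [h3]
    have hI3 : Integrable (fun x => c * (ep x * f0 x) - ep x * airyTransform q Tem x) halfLine :=
      (hI1.const_mul c).sub hI2
    rw [integral_sub hI3
      ((MemLp.integrable_fun_mul hPhiNL hTemL).const_mul _),
      integral_sub (hI1.const_mul c) hI2, integral_const_mul, integral_const_mul, h1, h2]
  have hu : IsUnit (1 - A * A) := by
    have := isUnit_one_sub_airyKernel q
    rwa [kernelOp_airyKernel] at this
  have key := symmetric_resolvent_identity A (inner_airyOp_comm q) hu e f hc0
  rw [edgeLimit_eq, edgeLimit_eq, hq', hSn, hSp, hpair, hTPsiN2, toL2_airyTransform q hPhiNL,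
    hPhiN2, toL2_airyTransform q (memLp_limPhi w s), toL2_airyTransform q hPsiL,
    ← inner_toL2 (memLp_limPhi w s) hPsiL, hPhi2, hPsi2, map_smul]
  linear_combination key

end StationaryTASEP

end


noncomputable section

namespace StationaryTASEP

/-! ### The scaling function -/

/-- For b ≠ 0 the functions F and bF are square integrable together, so the default value 0 is
consistent; no integrability is required. -/
lemma toL2_const_mul_of_ne_zero {ν : Measure ℝ} {b : ℝ} (hb : b ≠ 0) (F : ℝ → ℝ) :
    toL2 ν (fun x => b * F x) = b • toL2 ν F := by
  by_cases hF : MemLp F 2 ν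
  · exact toL2_const_mul b hF
  · have : ¬ MemLp (fun x => b * F x) 2 ν := fun h => hF <| by
      have := h.const_mul b⁻¹
      simpa only [inv_mul_cancel_left₀ hb] using this
    rw [toL2, toL2, dif_neg hF, dif_neg this, smul_zero]

lemma resolventPairing_const_mul {ν : Measure ℝ} (k : ℝ → ℝ → ℝ) (a : ℝ) {b : ℝ} (hb : b ≠ 0)
    (f g : ℝ → ℝ) : resolventPairing ν k (fun x => a * f x) (fun x => b * g x) =
      a * b * resolventPairing ν k f g := by
  have h1 : (fun x' => ∫ y, k x' y * (b * g y) ∂ν) = fun x' => b * ∫ y, k x' y * g y ∂ν := by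
    funext x'
    rw [← integral_const_mul]
    congr 1; funext y; ring
  have h2 : ∀ F : ℝ → ℝ, toL2 ν (fun x => b * F x) = b • toL2 ν F := toL2_const_mul_of_ne_zero hb
  rw [resolventPairing, resolventPairing, ← integral_const_mul]
  refine integral_congr_ae ?_
  have h3 := Lp.coeFn_smul b
    (Ring.inverse (1 - kernelOp ν k) (toL2 ν fun x' => ∫ y, k x' y * g y ∂ν))
  filter_upwards [h3] with x hx
  rw [resolventApply, resolventApply, h1, h2, map_smul, hx, Pi.smul_apply, smul_eq_mul]
  ring

lemma integral_exp_mul_airy_add {w : ℝ} (hw : 0 < w) (q : ℝ) :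
    Integrable (fun z => Real.exp (w * z) * airy (q + z)) ∧
    ∫ z, Real.exp (w * z) * airy (q + z) = Real.exp (w ^ 3 / 3 - w * q) := by
  have h : (fun z => Real.exp (w * z) * airy (q + z)) =
      fun z => Real.exp (-(w * q)) * (Real.exp (w * (q + z)) * airy (q + z)) := by
    funext z
    rw [← mul_assoc, ← Real.exp_add]
    congr 2; ring
  rw [h]
  refine ⟨((integrable_exp_mul_airy hw).comp_add_left q).const_mul _, ?_⟩
  rw [integral_const_mul,
    integral_add_left_eq_self (fun x => Real.exp (w * x) * airy x) q,
    integral_exp_mul_airy hw, ← Real.exp_add]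
  congr 1; ring

/-- The integral over the whole line is c⁻¹e^{-wy} by the Laplace transform of Ai; subtracting the
half line z ≥ 0 leaves the decomposition of Ψ. -/
lemma hatPsi_eq {w : ℝ} (hw : 0 < w) (s y : ℝ) :
    hatPsi w (w ^ 2 + s) y = (edgeConst w s)⁻¹ * limPsi w s y := by
  set q := w ^ 2 + s with hq
  obtain ⟨h1, h2⟩ := integral_exp_mul_airy_add hw (q + y)
  have h3 := intervalIntegral.integral_Iio_add_Ici (b := (0 : ℝ)) h1.integrableOn h1.integrableOn
  have h4 : hatPsi w q y = ∫ z in Iio (0 : ℝ), Real.exp (w * z) * airy (q + y + z) := by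
    rw [hatPsi]
    congr 1; funext z; congr 2; ring
  have h5 : airyTransform q (fun y => Real.exp (w * y)) y =
      ∫ z in Ici (0 : ℝ), Real.exp (w * z) * airy (q + y + z) := by
    rw [airyTransform]
    congr 1; funext z; ring
  have hc : Real.exp (w ^ 3 / 3 - w * (q + y)) = (edgeConst w s)⁻¹ * Real.exp (-w * y) := by
    rw [edgeConst, ← Real.exp_neg, ← Real.exp_add]
    congr 1; ring
  rw [limPsi_eq_sub, mul_sub, inv_mul_cancel_left₀ (edgeConst_pos w s).ne', h4, ← hq, h5, ← hc,
    ← h2, ← h3]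
  ring

lemma integral_Iio_swap_bound {w : ℝ} (hw : 0 < w) (q x : ℝ) :
    Integrable (Function.uncurry fun z v : ℝ =>
      Real.exp (w * z) * (airy (q + v + z) * airy (q + v + x)))
      ((volume.restrict (Iio (0 : ℝ))).prod halfLine) := by
  have hcont := continuous_airy
  obtain ⟨C, h0, hC⟩ := abs_airy_add_le (half_pos hw) q
  have hE : Integrable (fun z => Real.exp (w / 2 * z)) (volume.restrict (Iio (0 : ℝ))) :=
    integrableOn_exp_mul_Iic (half_pos hw) 0 |>.mono_set Iio_subset_Iic_self
  refine ((hE.mul_prod (integrable_exp_halfLine hw)).const_mul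
    (C * C * Real.exp (-(w / 2) * x))).mono' ?_ (ae_of_all _ fun p => ?_)
  · exact (by unfold Function.uncurry; fun_prop : Continuous (Function.uncurry fun z v : ℝ =>
      Real.exp (w * z) * (airy (q + v + z) * airy (q + v + x)))).aestronglyMeasurable
  · simp only [Function.uncurry]
    rw [Real.norm_eq_abs, abs_mul, abs_mul, Real.abs_exp]
    calc _ ≤ Real.exp (w * p.1) *
          ((C * (Real.exp (-(w / 2) * p.2) * Real.exp (-(w / 2) * p.1))) *
            (C * (Real.exp (-(w / 2) * p.2) * Real.exp (-(w / 2) * x)))) :=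
          mul_le_mul_of_nonneg_left (mul_le_mul (hC _ _) (hC _ _) (abs_nonneg _) (by positivity))
            (Real.exp_nonneg _)
      _ = C * C * Real.exp (-(w / 2) * x) * ((Real.exp (w * p.1) * Real.exp (-(w / 2) * p.1)) *
            (Real.exp (-(w / 2) * p.2) * Real.exp (-(w / 2) * p.2))) := by ring
      _ = _ := by
        rw [← Real.exp_add, ← Real.exp_add]
        congr 3 <;> ring

/-- Exchanging the integral over z < 0 with the one inside the Airy kernel shows that the hatted Φ
is a multiple of the Airy transform of the hatted Ψ. -/
lemma hatPhi_eq {w : ℝ} (hw : 0 < w) (s x : ℝ) :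
    hatPhi w (w ^ 2 + s) x = Real.exp (w * (w ^ 2 + s)) * limPhi w s x := by
  set q := w ^ 2 + s with hq
  have h1 : hatPhi w q x = Real.exp (w * q) * ∫ z in Iio (0 : ℝ), ∫ v,
      Real.exp (w * z) * (airy (q + v + z) * airy (q + v + x)) ∂halfLine := by
    rw [hatPhi, ← integral_const_mul]
    congr 1; funext z
    rw [airyKernel, ← integral_Ici_eq_integral_Ioi, integral_const_mul]
    ring
  rw [h1, integral_integral_swap (integral_Iio_swap_bound hw q x), limPhi_eq, ← hq, airyTransform]
  congr 1
  rw [← integral_const_mul]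
  congr 1; funext v
  have h2 : hatPsi w q v = ∫ z in Iio (0 : ℝ), Real.exp (w * z) * airy (q + v + z) := by
    rw [hatPsi]
    congr 1; funext z; congr 2; ring
  rw [mul_left_comm, ← hatPsi_eq hw, ← hq, h2, ← integral_const_mul]
  congr 1; funext z
  rw [add_right_comm q x v]
  ring

/-- With z = x + y the inner variable ranges over [0,z], of length z. -/
lemma integral_integral_add {h : ℝ → ℝ} (hm : Measurable h) {C κ : ℝ} (hκ : 0 < κ)
    (hb : ∀ x, 0 ≤ x → |h x| ≤ C * Real.exp (-κ * x)) :
    ∫ x, ∫ y, h (x + y) ∂halfLine ∂halfLine = ∫ z, z * h z ∂halfLine := by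
  have hC : 0 ≤ C := by simpa using (abs_nonneg _).trans (hb 0 le_rfl)
  have h1 : ∀ x : ℝ, 0 ≤ x → ∫ y, h (x + y) ∂halfLine = ∫ z, (if x ≤ z then h z else 0) ∂halfLine := by
    intro x hx
    have e1 : (fun z => if x ≤ z then h z else 0) = (Ici x).indicator h := by
      funext z; simp [indicator]
    have e2 : (fun y => (Ici (0 : ℝ)).indicator (fun y => h (x + y)) y) =
        fun y => (Ici x).indicator h (x + y) := by
      funext y; simp [indicator]
    rw [e1, setIntegral_indicator measurableSet_Ici, Ici_inter_Ici, sup_of_le_right hx,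
      ← integral_indicator measurableSet_Ici, e2,
      integral_add_left_eq_self (fun z => (Ici x).indicator h z) x,
      integral_indicator measurableSet_Ici]
  have hint : Integrable (Function.uncurry fun x z : ℝ => if x ≤ z then h z else 0)
      (halfLine.prod halfLine) := by
    refine (((integrable_exp_halfLine (half_pos hκ)).mul_prod
      (integrable_exp_halfLine (half_pos hκ))).const_mul C).mono' ?_ ?_
    · exact (Measurable.ite (measurableSet_le measurable_fst measurable_snd)
        (hm.comp measurable_snd) measurable_const).aestronglyMeasurable
    · filter_upwards [ae_halfLine_prod] with p hp
      simp only [Function.uncurry]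
      split_ifs with hle
      · refine (hb _ hp.2).trans (mul_le_mul_of_nonneg_left ?_ hC)
        rw [← Real.exp_add]
        exact Real.exp_le_exp.2 (by nlinarith)
      · rw [norm_zero]; positivity
  rw [integral_congr_ae (ae_halfLine.mono fun x hx => h1 x hx), integral_integral_swap hint]
  refine integral_congr_ae (ae_halfLine.mono fun z hz => ?_)
  have e3 : (fun x => if x ≤ z then h z else 0) = (Iic z).indicator fun _ => h z := by
    funext x; simp [indicator]
  simp only [e3]
  rw [setIntegral_indicator measurableSet_Iic, Ici_inter_Iic, setIntegral_const]
  simp [hz]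

/-- Double integrals of h(x+y) are first moments, and the first moment of h over the whole line is
-c⁻¹s. Hence s plus c times the positive part equals -c times the negative part. -/
lemma limS_eq_integral {w : ℝ} (hw : 0 < w) (s : ℝ) :
    limS w s = Real.exp (-(1 / 3) * w ^ 3) * ∫ x in Iio (0 : ℝ), ∫ y in Iio (0 : ℝ),
      Real.exp (w * (x + y + (w ^ 2 + s))) * airy (x + y + (w ^ 2 + s)) := by
  set q := w ^ 2 + s with hq
  set c := edgeConst w s with hc
  set h : ℝ → ℝ := fun z => Real.exp (w * z) * airy (q + z) with hh
  have hcont := continuous_airy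
  have hm : Measurable h := (by fun_prop : Continuous h).measurable
  have hc1 : Real.exp (-(1 / 3) * w ^ 3) * Real.exp (w * q) = c := by
    rw [hc, edgeConst, ← Real.exp_add]; congr 1; ring
  have hc2 : Real.exp (w ^ 3 / 3 - w * q) = c⁻¹ := by
    rw [hc, edgeConst, ← Real.exp_neg]; congr 1; ring
  -- ε = 1 and ε = -1 cover the two ends of the line, with Airy bounds of rate 3w/2 and w/2.
  have hb : ∀ ε : ℝ, |ε| = 1 → ∃ C, ∀ x, 0 ≤ x → |h (ε * x)| ≤ C * Real.exp (-(w / 2) * x) := by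
    intro ε hε
    obtain ⟨C, h0, hC⟩ := abs_airy_add_le (κ := w + ε * w / 2) (by
      have := neg_abs_le ε; nlinarith) q
    refine ⟨C, fun x _ => ?_⟩
    have hε2 : ε * ε = 1 := by rw [← abs_mul_abs_self, hε, one_mul]
    have := hC 0 (ε * x)
    rw [add_zero, mul_zero, Real.exp_zero, one_mul] at this
    rw [hh]
    simp only
    rw [abs_mul, Real.abs_exp]
    calc _ ≤ Real.exp (w * (ε * x)) * (C * Real.exp (-(w + ε * w / 2) * (ε * x))) :=
          mul_le_mul_of_nonneg_left this (Real.exp_nonneg _)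
      _ = C * (Real.exp (w * (ε * x)) * Real.exp (-(w + ε * w / 2) * (ε * x))) := by ring
      _ ≤ _ := by
        rw [← Real.exp_add]
        refine mul_le_mul_of_nonneg_left (Real.exp_le_exp.2 (le_of_eq ?_)) h0.le
        linear_combination (-(w * x / 2)) * hε2
  have hI : Integrable (fun z => z * h z) ∧ ∫ z, z * h z = -(c⁻¹ * s) := by
    obtain ⟨i1, i2⟩ := integral_id_mul_exp_mul_airy hw
    have e : (fun z => z * h z) = fun z => Real.exp (-(w * q)) *
        ((q + z) * (Real.exp (w * (q + z)) * airy (q + z)) -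
          q * (Real.exp (w * (q + z)) * airy (q + z))) := by
      funext z
      rw [hh]
      simp only
      have : Real.exp (w * z) = Real.exp (-(w * q)) * Real.exp (w * (q + z)) := by
        rw [← Real.exp_add]; congr 1; ring
      rw [this]; ring
    have j1 := i1.comp_add_left q
    have j2 := ((integrable_exp_mul_airy hw).comp_add_left q).const_mul q
    rw [e]
    refine ⟨(j1.sub j2).const_mul _, ?_⟩
    rw [integral_const_mul, integral_sub j1 j2, integral_const_mul,
      integral_add_left_eq_self (fun x => x * (Real.exp (w * x) * airy x)) q,
      integral_add_left_eq_self (fun x => Real.exp (w * x) * airy x) q, i2,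
      integral_exp_mul_airy hw, ← hc2]
    have : Real.exp (w ^ 3 / 3 - w * q) = Real.exp (-(w * q)) * Real.exp (w ^ 3 / 3) := by
      rw [← Real.exp_add]; congr 1; ring
    rw [this, hq]; ring
  have hsplit := intervalIntegral.integral_Iio_add_Ici (b := (0 : ℝ)) hI.1.integrableOn
    hI.1.integrableOn
  obtain ⟨Cp, hCp⟩ := hb 1 abs_one
  obtain ⟨Cm, hCm⟩ := hb (-1) (by simp)
  simp only [one_mul, neg_mul] at hCp hCm
  have hP : limS w s = s + c * ∫ z, z * h z ∂halfLine := by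
    rw [limS_eq, integral_hankel_phi, ← integral_integral_add hm (half_pos hw) (by simpa using hCp)]
    congr 3; funext x
    rw [airyTransform, ← integral_const_mul]
    congr 1; funext y
    rw [hh]
    simp only
    rw [mul_add, Real.exp_add, ← add_assoc]; ring
  have hneg : ∀ f : ℝ → ℝ, ∫ x in Iio (0 : ℝ), f x = ∫ x, f (-x) ∂halfLine := by
    intro f
    rw [← integral_Iic_eq_integral_Iio, integral_Ici_eq_integral_Ioi]
    have := integral_comp_neg_Ioi (0 : ℝ) f
    rw [neg_zero] at this
    exact this.symm
  have hM : ∫ x in Iio (0 : ℝ), ∫ y in Iio (0 : ℝ),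
      Real.exp (w * (x + y + q)) * airy (x + y + q) =
      Real.exp (w * q) * -∫ z in Iio (0 : ℝ), z * h z := by
    have e : ∀ x y : ℝ, Real.exp (w * (x + y + q)) * airy (x + y + q) =
        Real.exp (w * q) * h (x + y) := by
      intro x y
      rw [hh]
      simp only
      rw [← mul_assoc, ← Real.exp_add, add_comm q]
      congr 2; ring
    simp only [e, integral_const_mul, hneg]
    congr 1
    have := integral_integral_add (h := fun z => h (-z)) (hm.comp measurable_neg) (half_pos hw)
      (by simpa using hCm)
    rw [← integral_neg]
    simp only [neg_mul, neg_neg]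
    rw [← this]
    simp only [neg_add]
  rw [hP, hM, ← mul_assoc, hc1]
  rw [hI.2] at hsplit
  have hcs : c * -(c⁻¹ * s) = -s := by
    rw [mul_neg, mul_inv_cancel_left₀ (edgeConst_pos w s).ne']
  linear_combination hcs + c * hsplit

lemma edgeLimit_eq_scalingGPos {w : ℝ} (hw : 0 < w) (s : ℝ) :
    edgeLimit w s = scalingGPos (w ^ 2 + s) w := by
  set c := edgeConst w s with hc
  have hc0 := (edgeConst_pos w s).ne'
  have h1 : hatPhi w (w ^ 2 + s) = fun x => Real.exp (w * (w ^ 2 + s)) * limPhi w s x :=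
    funext (hatPhi_eq hw s)
  have h2 : hatPsi w (w ^ 2 + s) = fun x => c⁻¹ * limPsi w s x := funext (hatPsi_eq hw s)
  have hc1 : Real.exp (-(1 / 3) * w ^ 3) * Real.exp (w * (w ^ 2 + s)) = c := by
    rw [hc, edgeConst, ← Real.exp_add]; congr 1; ring
  rw [edgeLimit, scalingGPos, h1, h2, resolventPairing_const_mul _ _ (inv_ne_zero hc0), mul_add,
    ← limS_eq_integral hw]
  congr 1
  rw [← mul_assoc, ← mul_assoc, hc1, mul_inv_cancel₀ hc0, one_mul]

/-- The limit functional along the curve on which the Airy parameter is constant. -/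
lemma tendsto_edgeLimit_zero (q : ℝ) :
    Tendsto (fun v => edgeLimit v (q - v ^ 2)) (𝓝 0) (𝓝 (edgeLimit 0 q)) := by
  have hcont := continuous_airy
  have hphi : ∀ v z : ℝ, phi v (q - v ^ 2) z =
      airy (q + z) * Real.exp (v * (q + z)) * Real.exp (-(1 / 3) * v ^ 3) := by
    intro v z; rw [phi]; congr 3 <;> ring
  -- For |v| ≤ 1 the factor e^{vz} costs rate 1, so rate 3 leaves 2, still above the weight bound W
  -- = 1.
  obtain ⟨C, h0, hC⟩ := abs_airy_le (c := 3) (by norm_num)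
  have hb : ∀ v z : ℝ, |v| ≤ 1 → 0 ≤ z → |airy (q + z) * Real.exp (v * (q + z)) *
      Real.exp (-(1 / 3) * v ^ 3)| ≤ C * Real.exp (4 * |q| + 1) * Real.exp (-2 * z) := by
    intro v z hv hz
    rw [abs_mul, abs_mul, Real.abs_exp, Real.abs_exp, mul_assoc, ← Real.exp_add]
    calc _ ≤ C * Real.exp (-3 * (q + z)) * Real.exp (v * (q + z) + -(1 / 3) * v ^ 3) :=
          mul_le_mul_of_nonneg_right (hC _) (Real.exp_nonneg _)
      _ ≤ _ := by
        rw [mul_assoc, mul_assoc, ← Real.exp_add, ← Real.exp_add]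
        refine mul_le_mul_of_nonneg_left (Real.exp_le_exp.2 ?_) h0.le
        have h1 : v * q ≤ |q| := (le_abs_self _).trans (by
          rw [abs_mul]; exact mul_le_of_le_one_left (abs_nonneg _) hv)
        have h2 : -q ≤ |q| := neg_le_abs q
        have h3 : v * z ≤ z := by nlinarith [le_abs_self v]
        have h4 : -(v ^ 3) ≤ 1 := by
          refine (neg_le_abs _).trans ?_
          rw [abs_pow]; exact pow_le_one₀ (abs_nonneg _) hv
        linarith
  have hlim : ∀ ε : ℝ, |ε| = 1 → DominatedLimit (𝓝 (0 : ℝ))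
      (fun v => phi (ε * v) (q - v ^ 2)) (phi 0 q) (C * Real.exp (4 * |q| + 1)) 2 := by
    intro ε hε
    have hε2 : ε ^ 2 = 1 := by rw [← sq_abs, hε, one_pow]
    have e1 : ∀ v, phi (ε * v) (q - v ^ 2) = fun z => airy (q + z) *
        Real.exp (ε * v * (q + z)) * Real.exp (-(1 / 3) * (ε * v) ^ 3) := by
      intro v; funext z
      rw [← hphi]
      congr 1
      rw [mul_pow, hε2, one_mul]
    have e0 : phi 0 q = fun z => airy (q + z) * Real.exp (0 * (q + z)) *
        Real.exp (-(1 / 3) * 0 ^ 3) := by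
      funext z; rw [← hphi]; congr 1; ring
    refine ⟨Eventually.of_forall fun v => (continuous_phi _ _).measurable,
      (continuous_phi _ _).measurable, ?_, fun x hx => ?_, fun x _ => ?_⟩
    · have : ∀ᶠ v : ℝ in 𝓝 0, |v| < 1 :=
        (continuous_abs.tendsto' (0 : ℝ) 0 abs_zero).eventually (gt_mem_nhds one_pos)
      filter_upwards [this] with v hv x hx
      rw [e1]
      exact hb _ _ (by rw [abs_mul, hε, one_mul]; exact hv.le) hx
    · rw [e0]; exact hb _ _ (by simp) hx
    · simp only [e1, e0]
      have : Continuous fun v : ℝ => airy (q + x) * Real.exp (ε * v * (q + x)) *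
        Real.exp (-(1 / 3) * (ε * v) ^ 3) := by fun_prop
      exact this.tendsto' _ _ (by simp)
  have hα := hlim 1 abs_one
  have hβ := hlim (-1) (by simp)
  simp only [one_mul] at hα
  simp only [neg_mul, one_mul] at hβ
  have hu : IsUnit (1 - kernelOp halfLine (edgeKernel (phi 0 q) (phi 0 q) 0)) := by
    have h1 := edgeKernel_phi 0 q
    rw [neg_zero] at h1
    rw [h1]
    exact isUnit_one_sub_airyKernel _
  have h := (tendsto_edgeForm (w := fun v : ℝ => v) (s := fun v => q - v ^ 2) (w₀ := 0) (s₀ := q)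
    (W := 1) hα hβ tendsto_id ((by fun_prop : Continuous fun v : ℝ => q - v ^ 2).tendsto' _ _
      (by simp)) (by
      have : ∀ᶠ v : ℝ in 𝓝 0, |v| < 1 :=
        (continuous_abs.tendsto' (0 : ℝ) 0 abs_zero).eventually (gt_mem_nhds one_pos)
      exact this.mono fun v hv => hv.le) (by simp) (by norm_num) hu).1
  simp only [edgeLimit_eq_edgeForm, neg_zero]
  exact h

lemma scalingGPos_eq {v : ℝ} (hv : 0 < v) (q : ℝ) : scalingGPos q v = edgeLimit v (q - v ^ 2) := by
  rw [edgeLimit_eq_scalingGPos hv, add_sub_cancel]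

lemma scalingG_eq (q v : ℝ) : scalingG q v = edgeLimit |v| (q - v ^ 2) := by
  rw [scalingG]
  split_ifs with h
  · subst h
    rw [abs_zero, zero_pow two_ne_zero, sub_zero]
    refine Tendsto.limUnder_eq (((tendsto_edgeLimit_zero q).mono_left nhdsWithin_le_nhds).congr' ?_)
    filter_upwards [self_mem_nhdsWithin] with v hv
    exact (scalingGPos_eq hv q).symm
  · rw [scalingGPos_eq (abs_pos.2 h), sq_abs]

/-- Along the curve with fixed Airy parameter q the function is `edgeLimit` composed with |v|, so
continuity of `edgeLimit` at 0 suffices, including the value defined by a limit. -/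
lemma continuousAt_scalingG (q : ℝ) : ContinuousAt (scalingG q) 0 := by
  have h : scalingG q = (fun v => edgeLimit v (q - v ^ 2)) ∘ abs := by
    funext v
    rw [scalingG_eq, Function.comp, sq_abs]
  rw [h]
  have := (tendsto_edgeLimit_zero q).comp (continuous_abs.tendsto' (0 : ℝ) 0 abs_zero)
  rw [ContinuousAt]
  convert this using 2
  simp

lemma edgeLimit_abs (w s : ℝ) : edgeLimit |w| s = edgeLimit w s := by
  rcases le_or_gt 0 w with h | h
  · rw [abs_of_nonneg h]
  · rw [abs_of_neg h, ← edgeLimit_neg (neg_pos.2 h), neg_neg]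

end StationaryTASEP

end


noncomputable section

namespace StationaryTASEP

/-! ### The Laguerre contour integrals -/

/-- z ↦ -z is a rotation of the parameter by π; the sign is that of dz. -/
lemma circleIntegral_neg_center (f : ℂ → ℂ) (c : ℂ) (R : ℝ) :
    ∮ z in C(-c, R), f z = -∮ z in C(c, R), f (-z) := by
  have hper : Function.Periodic (fun θ => deriv (circleMap c R) θ • f (-circleMap c R θ))
      (2 * Real.pi) := by
    intro θ
    simp only [deriv_circleMap, periodic_circleMap _ _ θ]
  have h := hper.intervalIntegral_add_eq Real.pi 0
  have h2 := intervalIntegral.integral_comp_add_right (a := 0) (b := 2 * Real.pi)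
    (fun θ => deriv (circleMap c R) θ • f (-circleMap c R θ)) Real.pi
  simp only [zero_add] at h h2
  rw [add_comm (2 * Real.pi)] at h2
  simp only [circleIntegral]
  rw [← h, ← h2, ← intervalIntegral.integral_neg]
  congr 1; funext θ
  have e : circleMap (-c) R θ = -circleMap c R (θ + Real.pi) := by
    simp only [circleMap]
    push_cast
    rw [add_mul, Complex.exp_add, Complex.exp_pi_mul_I]
    ring
  have e2 : deriv (circleMap (-c) R) θ = -deriv (circleMap c R) (θ + Real.pi) := by
    simp only [deriv_circleMap, circleMap]
    push_cast
    rw [add_mul (θ : ℂ), Complex.exp_add, Complex.exp_pi_mul_I]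
    ring
  rw [e, e2, neg_smul]

/-- `e^{-zr} (z+a)^n / (b-z)^p`. -/
def laguerreIntegrand (a b : ℝ) (n p : ℕ) (r : ℝ) (z : ℂ) : ℂ :=
  Complex.exp (-z * r) * ((z + a) ^ n / (b - z) ^ p)

/-- `(-2πi)⁻¹ ∮ e^{-zr} (z+a)^n / (b-z)^p dz` around `b`. -/
def laguerre (a b : ℝ) (n p : ℕ) (r : ℝ) : ℝ :=
  (1 / (-(2 * Real.pi * Complex.I)) * ∮ z in C((b : ℂ), 1), laguerreIntegrand a b n p r z).re

lemma kernelL_eq (ρ : ℝ) {m d : ℤ} {n p : ℕ} (hn : m - d = n) (hp : m + d = p) (r : ℝ) :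
    kernelL ρ m d r = Real.exp ((1 / 2 - ρ) * r) * laguerre ρ (1 - ρ) n p r := by
  have h : contourI ρ m d r = ∮ z in C(((1 - ρ : ℝ) : ℂ), 1), laguerreIntegrand ρ (1 - ρ) n p r z := by
    simp only [contourI, laguerreIntegrand, hn, hp, zpow_natCast]
    push_cast
    rfl
  rw [kernelL, h, laguerre, ← Complex.re_ofReal_mul]
  congr 1; ring

/-- Reflection z ↦ -z exchanges ρ with 1-ρ and n with p. One family of contour integrals therefore
serves both kernels, and one asymptotic analysis suffices. -/
lemma kernelR_neg_eq (ρ : ℝ) {m d : ℤ} {n p : ℕ} (hn : m - d = n) (hp : m + d = p) (r : ℝ) :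
    kernelR ρ m d (-r) = Real.exp ((ρ - 1 / 2) * r) * laguerre (1 - ρ) ρ p n r := by
  have h : contourITilde ρ m d r =
      -∮ z in C((ρ : ℂ), 1), laguerreIntegrand (1 - ρ) ρ p n r z := by
    rw [contourITilde, circleIntegral_neg_center]
    simp only [laguerreIntegrand, hn, hp, zpow_natCast]
    push_cast
    congr 3; funext z
    congr 3
    · ring
  rw [kernelR, neg_neg, h, laguerre, ← Complex.re_ofReal_mul,
    show (1 / 2 - ρ) * -r = (ρ - 1 / 2) * r by ring]
  congr 1
  rw [one_div_neg_eq_neg_one_div]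
  ring

/-- The residue at a pole of order p is a derivative of order p - 1 of e^{-rz}(z+a)^n at b; the
Leibniz rule gives e^{-br} times a polynomial in r. -/
lemma exists_polynomial_laguerre (a b : ℝ) (n : ℕ) {p : ℕ} (hp : 0 < p) :
    ∃ P : Polynomial ℝ, ∀ r, laguerre a b n p r = Real.exp (-b * r) * P.eval r := by
  obtain ⟨k, rfl⟩ := Nat.exists_eq_succ_of_ne_zero hp.ne'
  refine ⟨∑ i ∈ Finset.range (k + 1), Polynomial.C ((-1) ^ k / k.factorial *
    (k.choose i * (-1) ^ i * (n.descFactorial (k - i) * (b + a) ^ (n - (k - i))))) *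
      Polynomial.X ^ i, fun r => ?_⟩
  have h1 : (fun z => laguerreIntegrand a b n (k + 1) r z) = fun z : ℂ =>
      (-1) ^ (k + 1) * ((1 / (z - b) ^ (k + 1)) •
        (Complex.exp (-r * z) * (z + a) ^ n)) := by
    funext z
    rw [laguerreIntegrand, show (b - z : ℂ) = -1 * (z - b) by ring, mul_pow,
      show -z * (r : ℂ) = -r * z by ring, smul_eq_mul]
    have : ((-1 : ℂ) ^ (k + 1)) * (-1) ^ (k + 1) = 1 := by
      rw [← mul_pow]; norm_num
    have h0 : ((-1 : ℂ) ^ (k + 1)) ≠ 0 := by simp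
    rw [div_mul_eq_div_div, div_eq_mul_inv _ ((-1 : ℂ) ^ (k + 1)),
      inv_eq_of_mul_eq_one_left this]
    ring
  have hd : Differentiable ℂ fun z : ℂ => Complex.exp (-r * z) * (z + a) ^ n := by fun_prop
  have h2 : iteratedDeriv k (fun z : ℂ => Complex.exp (-r * z) * (z + a) ^ n) b =
      ((∑ i ∈ Finset.range (k + 1), k.choose i * ((-r) ^ i * Real.exp (-r * b)) *
        (n.descFactorial (k - i) * (b + a) ^ (n - (k - i))) : ℝ) : ℂ) := by
    rw [iteratedDeriv_fun_mul (by fun_prop) (by fun_prop)]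
    push_cast
    refine Finset.sum_congr rfl fun i _ => ?_
    rw [iteratedDeriv_cexp_const_mul, iteratedDeriv_comp_add_const (k - i) (fun z => z ^ n)]
    simp only [iteratedDeriv_pow]
  rw [laguerre, h1, circleIntegral.integral_const_mul,
    DifferentiableOn.circleIntegral_one_div_sub_center_pow_smul one_pos k hd.differentiableOn, h2,
    smul_eq_mul]
  have h3 : (1 / (-(2 * Real.pi * Complex.I)) : ℂ) * ((-1) ^ (k + 1) *
      (2 * Real.pi * Complex.I / k.factorial)) = (((-1) ^ k / k.factorial : ℝ) : ℂ) := by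
    have : (Real.pi : ℂ) ≠ 0 := by exact_mod_cast Real.pi_ne_zero
    have := Complex.I_ne_zero
    have : (k.factorial : ℂ) ≠ 0 := by exact_mod_cast k.factorial_ne_zero
    push_cast
    field_simp
    ring
  rw [← mul_assoc ((-1 : ℂ) ^ (k + 1)), ← mul_assoc, h3, ← Complex.ofReal_mul, Complex.ofReal_re,
    Polynomial.eval_finsetSum, Finset.mul_sum, Finset.mul_sum]
  refine Finset.sum_congr rfl fun i _ => ?_
  simp only [Polynomial.eval_mul, Polynomial.eval_C, Polynomial.eval_pow, Polynomial.eval_X]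
  rw [show -r * b = -b * r by ring, show (-r) ^ i = (-1) ^ i * r ^ i by rw [← mul_pow]; ring]
  ring

lemma continuous_laguerre (a b : ℝ) (n : ℕ) {p : ℕ} (hp : 0 < p) :
    Continuous (laguerre a b n p) := by
  obtain ⟨P, hP⟩ := exists_polynomial_laguerre a b n hp
  rw [funext hP]
  fun_prop

lemma circleIntegral_laguerreIntegrand_eq (a b : ℝ) (n p : ℕ) (r : ℝ) {R R' : ℝ} (hR : 0 < R)
    (hR' : 0 < R') : ∮ z in C((b : ℂ), R), laguerreIntegrand a b n p r z =
      ∮ z in C((b : ℂ), R'), laguerreIntegrand a b n p r z := by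
  wlog h : R' ≤ R generalizing R R'
  · exact (this hR' hR (le_of_not_ge h)).symm
  have hdiff : ∀ z : ℂ, z ≠ b → DifferentiableAt ℂ (laguerreIntegrand a b n p r) z := by
    intro z hz
    have : (b - z : ℂ) ^ p ≠ 0 := pow_ne_zero _ (sub_ne_zero.2 hz.symm)
    unfold laguerreIntegrand
    fun_prop (disch := assumption)
  refine Complex.circleIntegral_eq_of_differentiable_on_annulus_off_countable hR' h
    countable_empty (fun z hz => (hdiff z ?_).continuousAt.continuousWithinAt)
    fun z hz => hdiff z ?_
  · rintro rfl
    exact hz.2 (Metric.mem_ball_self hR')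
  · rintro rfl
    exact hz.1.2 (Metric.mem_closedBall_self hR'.le)

/-- The point `b - R e^{-iθ}` of the circle around `b`. -/
def circlePoint (b R θ : ℝ) : ℂ := b - R * Complex.exp (-(θ * Complex.I))

/-- The parameter is reflected so that θ = 0 is the real point b - R, where the integrand will
concentrate, in the middle of the interval. -/
lemma laguerre_eq_integral (a b : ℝ) (n p : ℕ) (r : ℝ) {R : ℝ} (hR : 0 < R) :
    laguerre a b n p r = (1 / (2 * Real.pi) * ∫ θ in (-Real.pi)..Real.pi,
      laguerreIntegrand a b n p r (circlePoint b R θ) *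
        (R * Complex.exp (-(θ * Complex.I)))).re := by
  rw [laguerre, circleIntegral_laguerreIntegrand_eq a b n p r one_pos hR, circleIntegral]
  have h := intervalIntegral.integral_comp_sub_left (a := -Real.pi) (b := Real.pi)
    (fun θ => deriv (circleMap b R) θ • laguerreIntegrand a b n p r (circleMap b R θ)) Real.pi
  rw [sub_self, sub_neg_eq_add, ← two_mul] at h
  rw [← h]
  congr 1
  rw [← intervalIntegral.integral_const_mul, ← intervalIntegral.integral_const_mul]
  congr 1; funext θ
  have e : Complex.exp (((Real.pi - θ : ℝ) : ℂ) * Complex.I) =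
      -Complex.exp (-(θ * Complex.I)) := by
    push_cast
    rw [sub_mul, sub_eq_add_neg, Complex.exp_add, Complex.exp_pi_mul_I]
    ring
  have e2 : circleMap (b : ℂ) R (Real.pi - θ) = circlePoint b R θ := by
    rw [circleMap, e, circlePoint]; ring
  rw [deriv_circleMap, e2, circleMap, e, smul_eq_mul]
  have h1 : (Real.pi : ℂ) ≠ 0 := by exact_mod_cast Real.pi_ne_zero
  have h2 := Complex.I_ne_zero
  field_simp
  ring

end StationaryTASEP

end


noncomputable section

namespace StationaryTASEP

/-! ### Steepest descent at the edge -/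

/-- Edge scaling of the parameters: the first three derivatives at `0` of
`n log(1+z/a) - p log(1-z/b) - uz`, on the scale `λ⁻¹`, converge to `-s`, `2w` and `2`. -/
structure EdgeScaling {ι : Type*} (l : Filter ι) (a b : ℝ) (n p : ι → ℕ) (u lam : ι → ℝ)
    (w s : ℝ) : Prop where
  ha : 0 < a
  hb : 0 < b
  hab : a + b = 1
  lam_tendsto : Tendsto lam l atTop
  first : Tendsto (fun i => (n i / a + p i / b - u i) / lam i) l (𝓝 (-s))
  second : Tendsto (fun i => (p i / b ^ 2 - n i / a ^ 2) / (2 * lam i ^ 2)) l (𝓝 w)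
  third : Tendsto (fun i => (n i / a ^ 3 + p i / b ^ 3) / lam i ^ 3) l (𝓝 1)

namespace EdgeScaling

variable {ι : Type*} {l : Filter ι} {a b : ℝ} {n p : ι → ℕ} {u lam : ι → ℝ} {w s : ℝ}

lemma symm (h : EdgeScaling l a b n p u lam w s) : EdgeScaling l b a p n u lam (-w) s := by
  refine ⟨h.hb, h.ha, by rw [add_comm, h.hab], h.lam_tendsto, ?_, ?_, ?_⟩
  · simpa only [add_comm] using h.first
  · refine h.second.neg.congr fun i => ?_
    ring
  · simpa only [add_comm] using h.third

lemma lam_pos (h : EdgeScaling l a b n p u lam w s) : ∀ᶠ i in l, 0 < lam i :=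
  h.lam_tendsto.eventually_gt_atTop 0

lemma inv_lam (h : EdgeScaling l a b n p u lam w s) : Tendsto (fun i => (lam i)⁻¹) l (𝓝 0) :=
  tendsto_inv_atTop_zero.comp h.lam_tendsto

/-- Dividing the second condition by one more λ makes it vanish in the limit; eliminating p between
it and the third, with a + b = 1, determines the growth of n. -/
lemma tendsto_left (h : EdgeScaling l a b n p u lam w s) :
    Tendsto (fun i => (n i : ℝ) / lam i ^ 3) l (𝓝 (a ^ 3 * b)) := by
  have h1 := (h.third.sub ((h.second.mul h.inv_lam).const_mul (2 / b))).const_mul (a ^ 3 * b)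
  rw [mul_zero, mul_zero, sub_zero, mul_one] at h1
  refine h1.congr' ?_
  filter_upwards [h.lam_pos] with i hi
  have ha := h.ha
  have hb := h.hb
  have e : b = 1 - a := by linarith [h.hab]
  field_simp
  rw [e]; ring

lemma tendsto_right (h : EdgeScaling l a b n p u lam w s) :
    Tendsto (fun i => (p i : ℝ) / lam i ^ 3) l (𝓝 (b ^ 3 * a)) := h.symm.tendsto_left

end EdgeScaling

/-- The Taylor remainder is of order λ⁻⁴, against a prefactor of order λ³. -/
lemma tendsto_mul_log_sub {ι : Type*} {l : Filter ι} {N lam : ι → ℝ} {ζ : ι → ℂ} {ν : ℝ} {ζ₀ : ℂ}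
    (hlam : Tendsto lam l atTop) (hN : Tendsto (fun i => N i / lam i ^ 3) l (𝓝 ν))
    (hζ : Tendsto ζ l (𝓝 ζ₀)) :
    Tendsto (fun i => (N i : ℂ) * (Complex.log (1 + ζ i / lam i) -
      (ζ i / lam i - (ζ i / lam i) ^ 2 / 2 + (ζ i / lam i) ^ 3 / 3))) l (𝓝 0) := by
  have hinv : Tendsto (fun i => (lam i)⁻¹) l (𝓝 0) := tendsto_inv_atTop_zero.comp hlam
  have hz : Tendsto (fun i => ζ i / lam i) l (𝓝 0) := by
    have := hζ.mul ((Complex.continuous_ofReal.tendsto 0).comp hinv)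
    simp only [Complex.ofReal_zero, mul_zero] at this
    refine this.congr fun i => ?_
    simp [div_eq_mul_inv]
  have hsmall : ∀ᶠ i in l, ‖ζ i / lam i‖ < 1 / 2 :=
    (tendsto_zero_iff_norm_tendsto_zero.1 hz).eventually (gt_mem_nhds (by norm_num))
  have hb : Tendsto (fun i => |N i / lam i ^ 3| * ‖ζ i‖ ^ 4 * (lam i)⁻¹) l (𝓝 0) := by
    have := (hN.abs.mul (hζ.norm.pow 4)).mul hinv
    rwa [mul_zero] at this
  refine squeeze_zero_norm' ?_ hb
  filter_upwards [hsmall, hlam.eventually_gt_atTop 0] with i hi hpos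
  set z := ζ i / lam i with hzdef
  have h1 := Complex.norm_log_sub_logTaylor_le 3 (hi.trans (by norm_num) : ‖z‖ < 1)
  have h2 : Complex.logTaylor (3 + 1) z = z - z ^ 2 / 2 + z ^ 3 / 3 := by
    rw [Complex.logTaylor_succ, Complex.logTaylor_succ, Complex.logTaylor_succ,
      Complex.logTaylor_succ, Complex.logTaylor_zero]
    simp only [Pi.add_apply]
    push_cast
    ring
  rw [h2] at h1
  have h3 : ‖z‖ ^ (3 + 1) * (1 - ‖z‖)⁻¹ / ((3 : ℕ) + 1) ≤ ‖z‖ ^ 4 := by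
    have : (1 - ‖z‖)⁻¹ ≤ 2 := by
      rw [inv_le_comm₀ (by linarith) two_pos]; linarith
    have h4 : 0 ≤ ‖z‖ ^ 4 := by positivity
    push_cast
    nlinarith
  rw [norm_mul, Complex.norm_real, Real.norm_eq_abs]
  refine (mul_le_mul_of_nonneg_left (h1.trans h3) (abs_nonneg _)).trans (le_of_eq ?_)
  rw [hzdef, norm_div, Complex.norm_real, Real.norm_eq_abs, abs_of_pos hpos, abs_div,
    abs_of_pos (pow_pos hpos 3)]
  field_simp

lemma laguerreIntegrand_mul_eq_exp {a b : ℝ} (ha : 0 < a) (hb : 0 < b) (n p : ℕ) (r : ℝ) {z : ℂ}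
    (hza : ‖z / a‖ < 1) (hzb : ‖z / b‖ < 1) :
    laguerreIntegrand a b n p r z * ((b ^ p / a ^ n : ℝ) : ℂ) =
      Complex.exp (-z * r + n * Complex.log (1 + z / a) - p * Complex.log (1 + -z / b)) := by
  have ha' : (a : ℂ) ≠ 0 := by exact_mod_cast ha.ne'
  have hb' : (b : ℂ) ≠ 0 := by exact_mod_cast hb.ne'
  have h1 : (1 + z / a : ℂ) ≠ 0 := by
    intro h
    rw [eq_neg_of_add_eq_zero_right h] at hza
    simp at hza
  have h2 : (1 + -z / b : ℂ) ≠ 0 := by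
    intro h
    rw [neg_div] at h
    rw [← neg_neg (z / (b : ℂ)), eq_neg_of_add_eq_zero_right h] at hzb
    simp at hzb
  rw [Complex.exp_sub, Complex.exp_add, Complex.exp_nat_mul, Complex.exp_nat_mul,
    Complex.exp_log h1, Complex.exp_log h2, laguerreIntegrand,
    show (z + a : ℂ) = a * (1 + z / a) by field_simp; ring,
    show (b - z : ℂ) = b * (1 + -z / b) by field_simp; ring, mul_pow, mul_pow]
  push_cast
  have h3 : (1 + -z / b : ℂ) ^ p ≠ 0 := pow_ne_zero _ h2
  field_simp

namespace EdgeScaling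

variable {ι : Type*} {l : Filter ι} {a b : ℝ} {n p : ι → ℕ} {u lam : ι → ℝ} {w s : ℝ}

/-- The three scaling conditions are the Taylor coefficients of the exponent up to order three in
ζ/λ; the fourth order remainders vanish, leaving the cubic Airy exponent. -/
lemma tendsto_laguerreIntegrand (h : EdgeScaling l a b n p u lam w s) {ζ : ι → ℂ} {ζ₀ : ℂ}
    (hζ : Tendsto ζ l (𝓝 ζ₀)) (X : ℝ) :
    Tendsto (fun i => laguerreIntegrand a b (n i) (p i) (u i + lam i * X) (ζ i / lam i) *
      ((b ^ p i / a ^ n i : ℝ) : ℂ)) l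
      (𝓝 (Complex.exp (ζ₀ ^ 3 / 3 + w * ζ₀ ^ 2 - (s + X) * ζ₀))) := by
  have ha := h.ha
  have hb := h.hb
  have ha' : (a : ℂ) ≠ 0 := by exact_mod_cast ha.ne'
  have hb' : (b : ℂ) ≠ 0 := by exact_mod_cast hb.ne'
  have cast : ∀ {f : ι → ℝ} {y : ℝ}, Tendsto f l (𝓝 y) →
      Tendsto (fun i => (f i : ℂ)) l (𝓝 (y : ℂ)) := fun hf =>
    (Complex.continuous_ofReal.tendsto _).comp hf
  have hz : Tendsto (fun i => ζ i / lam i) l (𝓝 0) := by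
    have := hζ.mul (cast h.inv_lam)
    simp only [Complex.ofReal_zero, mul_zero] at this
    refine this.congr fun i => ?_
    simp [div_eq_mul_inv]
  have hsmall : ∀ c : ℝ, 0 < c → ∀ᶠ i in l, ‖ζ i / lam i / c‖ < 1 := by
    intro c _
    have := tendsto_zero_iff_norm_tendsto_zero.1 (by simpa using hz.div_const (c : ℂ))
    exact this.eventually (gt_mem_nhds one_pos)
  have e1 := tendsto_mul_log_sub (N := fun i => n i) h.lam_tendsto h.tendsto_left
    (hζ.div_const (a : ℂ))
  have e2 := tendsto_mul_log_sub (N := fun i => p i) h.lam_tendsto h.tendsto_right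
    (hζ.neg.div_const (b : ℂ))
  have e3 := hζ.mul ((cast h.first).sub_const (X : ℂ))
  have e4 := (hζ.pow 2).mul (cast h.second)
  have e5 := ((hζ.pow 3).div_const 3).mul (cast h.third)
  have e6 := (((e1.sub e2).add e3).add e4).add e5
  have e7 : Tendsto (fun i => -(ζ i / lam i) * ((u i + lam i * X : ℝ) : ℂ) +
      n i * Complex.log (1 + ζ i / lam i / a) - p i * Complex.log (1 + -(ζ i / lam i) / b)) l
      (𝓝 (ζ₀ ^ 3 / 3 + w * ζ₀ ^ 2 - (s + X) * ζ₀)) := by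
    refine (e6.congr' ?_).trans (le_of_eq ?_)
    · filter_upwards [h.lam_pos] with i hi
      have hl : (lam i : ℂ) ≠ 0 := by exact_mod_cast hi.ne'
      rw [show ζ i / lam i / a = ζ i / a / lam i by ring,
        show -(ζ i / lam i) / b = -ζ i / b / lam i by ring]
      generalize Complex.log _ = L1
      generalize Complex.log _ = L2
      push_cast
      field_simp
      ring
    · congr 1
      push_cast
      ring
  refine ((Complex.continuous_exp.tendsto _).comp e7).congr' ?_
  filter_upwards [hsmall a ha, hsmall b hb] with i h1 h2
  exact (laguerreIntegrand_mul_eq_exp ha hb _ _ _ h1 h2).symm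

end EdgeScaling

/-- On a circle around b the denominator has constant modulus, so only the exponential and the
numerator vary. The first decreases away from the point z₀ and the second increases; their balance
is the last factor. -/
lemma norm_laguerreIntegrand_circlePoint_le {a b z₀ : ℝ} (ha : 0 < a) (hab : a + b = 1)
    (hz : 0 ≤ z₀) (hzb : z₀ < b) (n p : ℕ) (r θ : ℝ) :
    ‖laguerreIntegrand a b n p r (circlePoint b (b - z₀) θ)‖ ≤
      Real.exp (-z₀ * r) * ((a + z₀) ^ n / (b - z₀) ^ p) *
        Real.exp (-((b - z₀) * (1 - Real.cos θ) * (r - n / (a + z₀) ^ 2))) := by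
  set R := b - z₀ with hR
  have hR0 : 0 < R := sub_pos.2 hzb
  have haz : 0 < a + z₀ := by positivity
  set E := Complex.exp (-(θ * Complex.I)) with hE
  have hE' : E = Complex.exp ((-θ : ℝ) * Complex.I) := by rw [hE]; congr 1; push_cast; ring
  have hEn : ‖E‖ = 1 := by rw [hE', Complex.norm_exp_ofReal_mul_I]
  have hre : E.re = Real.cos θ := by
    rw [hE', Complex.exp_ofReal_mul_I_re, Real.cos_neg]
  have him : E.im = -Real.sin θ := by
    rw [hE', Complex.exp_ofReal_mul_I_im, Real.sin_neg]
  set x := R * (1 - Real.cos θ) with hx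
  have hzre : (circlePoint b R θ).re = z₀ + x := by
    rw [circlePoint, Complex.sub_re, Complex.re_ofReal_mul, hre, Complex.ofReal_re, hx, hR]
    ring
  have h1 : ‖(b : ℂ) - circlePoint b R θ‖ = R := by
    rw [circlePoint, sub_sub_cancel, norm_mul, hEn, Complex.norm_real, Real.norm_eq_abs,
      abs_of_pos hR0, mul_one]
  -- Because a + b = 1, the squared modulus is exactly (a+z₀)² + 2x, and 1 + y ≤ e^y applies.
  have h2 : ‖circlePoint b R θ + a‖ ≤ (a + z₀) * Real.exp (x / (a + z₀) ^ 2) := by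
    refine abs_le_of_sq_le_sq' ?_ (by positivity) |>.2
    have e : ‖circlePoint b R θ + a‖ ^ 2 = (a + z₀) ^ 2 + 2 * x := by
      rw [← Complex.normSq_eq_norm_sq, Complex.normSq_apply, circlePoint]
      simp only [Complex.add_re, Complex.sub_re, Complex.re_ofReal_mul, Complex.ofReal_re,
        Complex.add_im, Complex.sub_im, Complex.im_ofReal_mul, Complex.ofReal_im]
      rw [← hE, hre, him]
      have hb : b = 1 - a := by linarith
      have := Real.sin_sq_add_cos_sq θ
      rw [hx, hR, hb]
      linear_combination (1 - a - z₀) ^ 2 * this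
    rw [e, mul_pow, ← Real.exp_nat_mul]
    have := Real.add_one_le_exp (2 * (x / (a + z₀) ^ 2))
    have h3 : (a + z₀) ^ 2 * (2 * (x / (a + z₀) ^ 2) + 1) = (a + z₀) ^ 2 + 2 * x := by
      field_simp; ring
    rw [← h3]
    push_cast
    exact mul_le_mul_of_nonneg_left this (by positivity)
  rw [laguerreIntegrand, norm_mul, norm_div, norm_pow, norm_pow, h1, Complex.norm_exp,
    show (-circlePoint b R θ * (r : ℂ)).re = -(z₀ + x) * r by
      rw [Complex.re_mul_ofReal, Complex.neg_re, hzre]]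
  have h3 : ‖circlePoint b R θ + a‖ ^ n ≤ (a + z₀) ^ n * Real.exp (n * (x / (a + z₀) ^ 2)) := by
    rw [Real.exp_nat_mul, ← mul_pow]
    exact pow_le_pow_left₀ (norm_nonneg _) h2 n
  calc _ ≤ Real.exp (-(z₀ + x) * r) *
        ((a + z₀) ^ n * Real.exp (n * (x / (a + z₀) ^ 2)) / R ^ p) := by gcongr
    _ = (a + z₀) ^ n / R ^ p *
        (Real.exp (-(z₀ + x) * r) * Real.exp (n * (x / (a + z₀) ^ 2))) := by ring
    _ = (a + z₀) ^ n / R ^ p * (Real.exp (-z₀ * r) * Real.exp (-(x * (r - n / (a + z₀) ^ 2)))) := by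
        rw [← Real.exp_add, ← Real.exp_add]
        congr 2; ring
    _ = _ := by ring

end StationaryTASEP

end


/-! ### The rescaled contour integrals and their Airy limit -/

noncomputable section

namespace StationaryTASEP

/-- Shifting ξ by w completes the cube, so φ_{w,s} is an Airy integral on the line Re ξ = κ + w. -/
lemma phi_eq_integral {κ w : ℝ} (hκ : 0 < κ + w) (s X : ℝ) :
    (phi w s X : ℂ) = 1 / (2 * Real.pi) * ∫ y : ℝ, Complex.exp ((κ + y * Complex.I) ^ 3 / 3 +
      w * (κ + y * Complex.I) ^ 2 - (s + X) * (κ + y * Complex.I)) := by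
  rw [phi]
  push_cast
  rw [ofReal_airy hκ, airyLine, mul_assoc, mul_assoc, ← integral_mul_const]
  congr 2; funext y
  rw [airyIntegrand, ← Complex.exp_add, ← Complex.exp_add]
  congr 1
  push_cast
  ring

/-- The rescaled contour integral `λ (b^p/a^n) laguerre(u + λX)`. -/
def edgeAlpha (a b : ℝ) (n p : ℕ) (u lam X : ℝ) : ℝ :=
  lam * (b ^ p / a ^ n) * laguerre a b n p (u + lam * X)

lemma continuous_edgeAlpha (a b : ℝ) (n : ℕ) {p : ℕ} (hp : 0 < p) (u lam : ℝ) :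
    Continuous (edgeAlpha a b n p u lam) := by
  have := continuous_laguerre a b n hp
  unfold edgeAlpha
  fun_prop

/-- The integrand of the rescaled contour integral in the variable `y`, `z = b - R e^{-iy/(Rλ)}`. -/
def edgeIntegrand (a b : ℝ) (n p : ℕ) (u lam R X : ℝ) : ℝ → ℂ :=
  (Ioc (-Real.pi / (R * lam)⁻¹) (Real.pi / (R * lam)⁻¹)).indicator fun y =>
    laguerreIntegrand a b n p (u + lam * X) (circlePoint b R (y * (R * lam)⁻¹)) *
      ((b ^ p / a ^ n : ℝ) : ℂ) * Complex.exp (-((y * (R * lam)⁻¹ : ℝ) * Complex.I))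

lemma edgeAlpha_eq_integral (a b : ℝ) (n p : ℕ) (u : ℝ) {lam R : ℝ} (hlam : 0 < lam) (hR : 0 < R)
    (X : ℝ) : edgeAlpha a b n p u lam X =
      (1 / (2 * Real.pi) * ∫ y, edgeIntegrand a b n p u lam R X y).re := by
  have hc : (R * lam)⁻¹ ≠ 0 := by positivity
  have hle : -Real.pi / (R * lam)⁻¹ ≤ Real.pi / (R * lam)⁻¹ :=
    div_le_div_of_nonneg_right (by linarith [Real.pi_pos]) (by positivity)
  rw [edgeIntegrand, integral_indicator measurableSet_Ioc,
    ← intervalIntegral.integral_of_le hle,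
    intervalIntegral.integral_comp_mul_right (fun θ : ℝ =>
      laguerreIntegrand a b n p (u + lam * X) (circlePoint b R θ) *
      ((b ^ p / a ^ n : ℝ) : ℂ) * Complex.exp (-((θ : ℝ) * Complex.I))) hc,
    div_mul_cancel₀ _ hc, div_mul_cancel₀ _ hc, edgeAlpha, laguerre_eq_integral a b n p _ hR,
    ← Complex.re_ofReal_mul, inv_inv, Complex.real_smul,
    ← intervalIntegral.integral_const_mul, ← intervalIntegral.integral_const_mul,
    ← intervalIntegral.integral_const_mul, ← intervalIntegral.integral_const_mul]
  congr 2; funext θ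
  push_cast
  ring

lemma norm_edgeIntegrand_le {a b z₀ : ℝ} (ha : 0 < a) (hab : a + b = 1) (hz : 0 ≤ z₀) (hzb : z₀ < b)
    (n p : ℕ) {u lam X c : ℝ} (hlam : 0 < lam) (hX : 0 ≤ X) (hc : 0 ≤ c)
    (hD : c ≤ (u - n / (a + z₀) ^ 2) / lam ^ 2) (y : ℝ) :
    ‖edgeIntegrand a b n p u lam (b - z₀) X y‖ ≤
      Real.exp (-z₀ * u) * ((a + z₀) ^ n / (b - z₀) ^ p) * (b ^ p / a ^ n) *
        Real.exp (-(z₀ * lam) * X) * Real.exp (-(2 / Real.pi ^ 2 * c) * y ^ 2) := by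
  set R := b - z₀ with hR
  have hR0 : 0 < R := sub_pos.2 hzb
  have hR1 : R ≤ 1 := by linarith
  have hb : 0 < b := by linarith
  have hpi := Real.pi_pos
  have hrhs : 0 ≤ Real.exp (-z₀ * u) * ((a + z₀) ^ n / R ^ p) * (b ^ p / a ^ n) *
        Real.exp (-(z₀ * lam) * X) * Real.exp (-(2 / Real.pi ^ 2 * c) * y ^ 2) := by positivity
  rw [edgeIntegrand]
  by_cases hy : y ∈ Ioc (-Real.pi / (R * lam)⁻¹) (Real.pi / (R * lam)⁻¹)
  swap
  · rw [indicator_of_notMem hy, norm_zero]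
    exact hrhs
  rw [indicator_of_mem hy, norm_mul, norm_mul, Complex.norm_real, Real.norm_eq_abs,
    abs_of_pos (by positivity : 0 < b ^ p / a ^ n)]
  set θ := y * (R * lam)⁻¹ with hθ
  have hθpi : |θ| ≤ Real.pi := by
    have h0 : 0 < (R * lam)⁻¹ := by positivity
    rw [abs_le]
    constructor
    · have := (div_lt_iff₀ h0).1 hy.1
      linarith
    · exact (le_div_iff₀ h0).1 hy.2
  rw [show ‖Complex.exp (-((θ : ℝ) * Complex.I))‖ = 1 by
    rw [← neg_mul, ← Complex.ofReal_neg, Complex.norm_exp_ofReal_mul_I], mul_one]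
  have h1 := norm_laguerreIntegrand_circlePoint_le ha hab hz hzb n p (u + lam * X) θ
  have h2 := Real.cos_le_one_sub_mul_cos_sq hθpi
  -- The Gaussian bound comes from 1 - cos θ ≥ 2θ²/π² on [-π,π], with y = θRλ and the spare factor R
  -- ≤ 1.
  have h3 : 2 / Real.pi ^ 2 * c * y ^ 2 ≤
      R * (1 - Real.cos θ) * (u + lam * X - n / (a + z₀) ^ 2) := by
    have hD' : c * lam ^ 2 ≤ u + lam * X - n / (a + z₀) ^ 2 := by
      rw [le_div_iff₀ (by positivity)] at hD
      nlinarith [mul_nonneg hlam.le hX]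
    have h4 : R * (2 / Real.pi ^ 2 * θ ^ 2) ≤ R * (1 - Real.cos θ) :=
      mul_le_mul_of_nonneg_left (by linarith) hR0.le
    have hy2 : y = θ * (R * lam) := by
      rw [hθ]; field_simp
    calc 2 / Real.pi ^ 2 * c * y ^ 2 = R * (2 / Real.pi ^ 2 * θ ^ 2) * (c * lam ^ 2) * R := by
          rw [hy2]; ring
      _ ≤ R * (2 / Real.pi ^ 2 * θ ^ 2) * (c * lam ^ 2) * 1 :=
          mul_le_mul_of_nonneg_left hR1 (by positivity)
      _ ≤ _ := by
        rw [mul_one]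
        exact mul_le_mul h4 hD' (by positivity) (le_trans (by positivity) h4)
  calc _ ≤ Real.exp (-z₀ * (u + lam * X)) * ((a + z₀) ^ n / R ^ p) *
        Real.exp (-(R * (1 - Real.cos θ) * (u + lam * X - n / (a + z₀) ^ 2))) *
        (b ^ p / a ^ n) := mul_le_mul_of_nonneg_right h1 (by positivity)
    _ ≤ Real.exp (-z₀ * (u + lam * X)) * ((a + z₀) ^ n / R ^ p) *
        Real.exp (-(2 / Real.pi ^ 2 * c) * y ^ 2) * (b ^ p / a ^ n) := by
        refine mul_le_mul_of_nonneg_right (mul_le_mul_of_nonneg_left (Real.exp_le_exp.2 ?_)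
          (by positivity)) (by positivity)
        linarith
    _ = _ := by
        rw [show -z₀ * (u + lam * X) = -z₀ * u + -(z₀ * lam) * X by ring, Real.exp_add]
        ring

lemma aestronglyMeasurable_edgeIntegrand {b R : ℝ} (hR : 0 < R) (a : ℝ) (n p : ℕ) (u lam X : ℝ) :
    AEStronglyMeasurable (edgeIntegrand a b n p u lam R X) := by
  have hne : ∀ y : ℝ, ((b : ℂ) - circlePoint b R (y * (R * lam)⁻¹)) ^ p ≠ 0 := fun y => by
    rw [circlePoint, sub_sub_cancel]
    exact pow_ne_zero _ (mul_ne_zero (by exact_mod_cast hR.ne') (Complex.exp_ne_zero _))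
  have hc : Continuous fun y : ℝ => circlePoint b R (y * (R * lam)⁻¹) := by
    unfold circlePoint; fun_prop
  have : Continuous fun y : ℝ =>
      laguerreIntegrand a b n p (u + lam * X) (circlePoint b R (y * (R * lam)⁻¹)) *
      ((b ^ p / a ^ n : ℝ) : ℂ) * Complex.exp (-((y * (R * lam)⁻¹ : ℝ) * Complex.I)) := by
    unfold laguerreIntegrand
    exact ((Continuous.mul (by fun_prop) (Continuous.div (by fun_prop) (by fun_prop) hne)).mul
      continuous_const).mul (by fun_prop)
  exact this.aestronglyMeasurable.indicator measurableSet_Ioc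

/-- On the scale 1/λ the circle flattens to a vertical line, the contour of the Airy integral. -/
lemma tendsto_mul_one_sub_exp {ι : Type*} {l : Filter ι} {μ : ι → ℝ} (hμ : Tendsto μ l atTop)
    (y : ℝ) : Tendsto (fun i => (μ i : ℂ) *
      (1 - Complex.exp (-((y * (μ i)⁻¹ : ℝ) * Complex.I)))) l (𝓝 (y * Complex.I)) := by
  rw [tendsto_iff_norm_sub_tendsto_zero]
  have hinv : Tendsto (fun i => (μ i)⁻¹) l (𝓝 0) := tendsto_inv_atTop_zero.comp hμ
  have h1 : Tendsto (fun i => y ^ 2 * (μ i)⁻¹) l (𝓝 0) := by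
    simpa using hinv.const_mul (y ^ 2)
  have h2 : ∀ᶠ i in l, |y * (μ i)⁻¹| < 1 := by
    have : Tendsto (fun i => |y * (μ i)⁻¹|) l (𝓝 0) := by simpa using (hinv.const_mul y).abs
    exact this.eventually (gt_mem_nhds one_pos)
  refine squeeze_zero' (Eventually.of_forall fun _ => norm_nonneg _) ?_ h1
  filter_upwards [h2, hμ.eventually_gt_atTop 0] with i hi hpos
  set x : ℂ := -((y * (μ i)⁻¹ : ℝ) * Complex.I) with hx
  have hxn : ‖x‖ = |y * (μ i)⁻¹| := by
    rw [hx, norm_neg, norm_mul, Complex.norm_I, mul_one, Complex.norm_real, Real.norm_eq_abs]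
  have h3 := Complex.norm_exp_sub_one_sub_id_le (x := x) (by rw [hxn]; exact hi.le)
  have hm : (μ i : ℂ) ≠ 0 := by exact_mod_cast hpos.ne'
  have e : (μ i : ℂ) * (1 - Complex.exp x) - y * Complex.I =
      -((μ i : ℂ) * (Complex.exp x - 1 - x)) := by
    rw [hx]
    push_cast
    field_simp
    ring
  rw [e, norm_neg, norm_mul, Complex.norm_real, Real.norm_eq_abs, abs_of_pos hpos]
  calc _ ≤ μ i * ‖x‖ ^ 2 := mul_le_mul_of_nonneg_left h3 hpos.le
    _ = _ := by
      rw [hxn, sq_abs]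
      field_simp

namespace EdgeScaling

variable {ι : Type*} {l : Filter ι} {a b : ℝ} {n p : ι → ℕ} {u lam : ι → ℝ} {w s : ℝ}

/-- The quotient tends to 2b(κ+w); half of the limit is kept as a lower bound. Decay along the
contour thus rests on κ + w > 0. -/
lemma eventually_curvature (h : EdgeScaling l a b n p u lam w s) {κ : ℝ} (hκ : 0 < κ + w) :
    ∀ᶠ i in l, b * (κ + w) ≤ (u i - n i / (a + κ / lam i) ^ 2) / lam i ^ 2 := by
  have ha := h.ha
  have hb := h.hb
  have hz : Tendsto (fun i => κ / lam i) l (𝓝 0) := by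
    simpa [div_eq_mul_inv] using h.inv_lam.const_mul κ
  have e1 : Tendsto (fun i => -((n i / a + p i / b - u i) / lam i * (lam i)⁻¹) +
      2 * b * ((p i / b ^ 2 - n i / a ^ 2) / (2 * lam i ^ 2)) +
      n i / lam i ^ 3 * (κ * (2 * a + κ / lam i) / (a ^ 2 * (a + κ / lam i) ^ 2))) l
      (𝓝 (-(-s * 0) + 2 * b * w + a ^ 3 * b * (κ * (2 * a + 0) / (a ^ 2 * (a + 0) ^ 2)))) := by
    refine ((h.first.mul h.inv_lam).neg.add (h.second.const_mul _)).add (h.tendsto_left.mul ?_)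
    refine ((hz.const_add (2 * a)).const_mul κ).div (((hz.const_add a).pow 2).const_mul (a ^ 2)) ?_
    positivity
  have e2 : -(-s * 0) + 2 * b * w + a ^ 3 * b * (κ * (2 * a + 0) / (a ^ 2 * (a + 0) ^ 2)) =
      2 * (b * (κ + w)) := by
    field_simp; ring
  rw [e2] at e1
  have hpos : 0 < b * (κ + w) := by positivity
  have hne : ∀ᶠ i in l, 0 < a + κ / lam i :=
    (by simpa using hz.const_add a : Tendsto (fun i => a + κ / lam i) l (𝓝 a)).eventually
      (lt_mem_nhds ha)
  filter_upwards [e1.eventually (lt_mem_nhds (by linarith : b * (κ + w) < 2 * (b * (κ + w)))),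
    h.lam_pos, hne] with i hi hlam hne
  refine hi.le.trans (le_of_eq ?_)
  set z := κ / lam i with hz
  have hκz : κ = z * lam i := by rw [hz]; field_simp
  have hb1 : b = 1 - a := by linarith [h.hab]
  have hb0 : (1 - a) ≠ 0 := by rw [← hb1]; exact hb.ne'
  rw [hκz, hb1]
  field_simp
  ring

/-- Convergence of the rescaled contour integrals to the Airy profile. -/
lemma dominatedLimit_edgeAlpha (h : EdgeScaling l a b n p u lam w s) [l.IsCountablyGenerated]
    [l.NeBot] (hp : ∀ᶠ i in l, 0 < p i) {κ : ℝ} (hκ0 : 0 < κ) (hκ : 0 < κ + w) :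
    ∃ C, DominatedLimit l (fun i => edgeAlpha a b (n i) (p i) (u i) (lam i)) (phi w s) C κ := by
  have ha := h.ha
  have hb := h.hb
  have hz : Tendsto (fun i => κ / lam i) l (𝓝 0) := by
    simpa [div_eq_mul_inv] using h.inv_lam.const_mul κ
  have hzb : ∀ᶠ i in l, κ / lam i < b := hz.eventually (gt_mem_nhds hb)
  have hcurv := h.eventually_curvature hκ
  set M := Real.exp (κ ^ 3 / 3 + w * κ ^ 2 - s * κ) + 1 with hM
  -- The circle passes through z₀ = κ/λ, so the prefactor of the bound is the normalised integrand
  -- at that point, which converges. The same choice turns e^{-z₀λX} into e^{-κX}.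
  have hsaddle : ∀ᶠ i in l, Real.exp (-(κ / lam i) * u i) *
      ((a + κ / lam i) ^ n i / (b - κ / lam i) ^ p i) * (b ^ p i / a ^ n i) ≤ M := by
    have h1 := (h.tendsto_laguerreIntegrand (ζ := fun _ => (κ : ℂ)) tendsto_const_nhds 0).norm
    rw [show ((κ : ℂ) ^ 3 / 3 + w * κ ^ 2 - (s + (0 : ℝ)) * κ) =
      ((κ ^ 3 / 3 + w * κ ^ 2 - s * κ : ℝ) : ℂ) by push_cast; ring, Complex.norm_exp_ofReal] at h1
    filter_upwards [h1.eventually (gt_mem_nhds (lt_add_one _)), h.lam_pos, hzb] with i hi hl hb'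
    refine le_trans (le_of_eq ?_) hi.le
    have h0 : 0 < b - κ / lam i := sub_pos.2 hb'
    rw [← Real.norm_of_nonneg (by positivity : 0 ≤ Real.exp (-(κ / lam i) * u i) *
      ((a + κ / lam i) ^ n i / (b - κ / lam i) ^ p i) * (b ^ p i / a ^ n i)), ← Complex.norm_real]
    congr 1
    rw [laguerreIntegrand]
    push_cast
    rw [mul_zero, add_zero, add_comm (a : ℂ)]
  set c := 2 / Real.pi ^ 2 * (b * (κ + w)) with hc
  have hc0 : 0 < c := by have := Real.pi_pos; positivity
  have hgauss := integrable_exp_neg_mul_sq hc0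
  have hdom : ∀ᶠ i in l, ∀ X, 0 ≤ X → ∀ y, ‖edgeIntegrand a b (n i) (p i) (u i) (lam i)
      (b - κ / lam i) X y‖ ≤ M * Real.exp (-κ * X) * Real.exp (-c * y ^ 2) := by
    filter_upwards [hsaddle, hcurv, h.lam_pos, hzb] with i h1 h2 hl h4 X hX y
    refine (norm_edgeIntegrand_le ha h.hab (by positivity) h4 (n i) (p i) hl hX
      (by positivity) h2 y).trans ?_
    rw [div_mul_cancel₀ _ hl.ne']
    gcongr
  have hlim : ∀ X, 0 ≤ X → Tendsto (fun i => edgeAlpha a b (n i) (p i) (u i) (lam i) X) l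
      (𝓝 (phi w s X)) := by
    intro X hX
    have hμ : Tendsto (fun i => (b - κ / lam i) * lam i) l atTop := by
      have : Tendsto (fun i => b - κ / lam i) l (𝓝 b) := by simpa using hz.const_sub b
      exact this.pos_mul_atTop hb h.lam_tendsto
    have h1 : Tendsto (fun i => ∫ y, edgeIntegrand a b (n i) (p i) (u i) (lam i)
        (b - κ / lam i) X y) l (𝓝 (∫ y : ℝ, Complex.exp ((κ + y * Complex.I) ^ 3 / 3 +
          w * (κ + y * Complex.I) ^ 2 - (s + X) * (κ + y * Complex.I)))) := by
      refine tendsto_integral_filter_of_dominated_convergence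
        (fun y => M * Real.exp (-κ * X) * Real.exp (-c * y ^ 2)) ?_ ?_ (hgauss.const_mul _) ?_
      · filter_upwards [hzb] with i hi
        exact aestronglyMeasurable_edgeIntegrand (sub_pos.2 hi) _ _ _ _ _ _
      · filter_upwards [hdom] with i hi
        exact ae_of_all _ (hi X hX)
      · refine ae_of_all _ fun y => ?_
        have hθ := tendsto_mul_one_sub_exp hμ y
        have hζ := (h.tendsto_laguerreIntegrand (hθ.const_add (κ : ℂ)) X).mul
          (((Complex.continuous_exp.tendsto _).comp
            (((Complex.continuous_ofReal.tendsto _).comp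
              ((tendsto_inv_atTop_zero.comp hμ).const_mul y)).mul_const Complex.I).neg))
        simp only [mul_zero, Complex.ofReal_zero, zero_mul, neg_zero, Complex.exp_zero,
          mul_one] at hζ
        refine hζ.congr' ?_
        -- Once Rλ exceeds |y|/π, the point y lies inside the cut-off window.
        filter_upwards [h.lam_pos, hzb, hμ.eventually_gt_atTop (|y| / Real.pi)] with i hl hb' hy
        have hR : 0 < b - κ / lam i := sub_pos.2 hb'
        have hmem : y ∈ Ioc (-Real.pi / ((b - κ / lam i) * lam i)⁻¹)
            (Real.pi / ((b - κ / lam i) * lam i)⁻¹) := by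
          rw [div_inv_eq_mul, div_inv_eq_mul]
          rw [div_lt_iff₀ Real.pi_pos] at hy
          have := abs_lt.1 hy
          constructor <;> nlinarith
        rw [edgeIntegrand, indicator_of_mem hmem]
        simp only [Function.comp]
        congr 3
        rw [circlePoint]
        have hl' : (lam i : ℂ) ≠ 0 := by exact_mod_cast hl.ne'
        push_cast
        field_simp
        ring
    have h2 := (Complex.continuous_re.tendsto _).comp (h1.const_mul (1 / (2 * Real.pi : ℂ)))
    rw [← phi_eq_integral hκ, Complex.ofReal_re] at h2
    refine h2.congr' ?_
    filter_upwards [h.lam_pos, hzb] with i hl hb'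
    exact (edgeAlpha_eq_integral a b _ _ _ hl (sub_pos.2 hb') X).symm
  set I := ∫ y : ℝ, Real.exp (-c * y ^ 2) with hI
  have hbound : ∀ᶠ i in l, ∀ X, 0 ≤ X → |edgeAlpha a b (n i) (p i) (u i) (lam i) X| ≤
      1 / (2 * Real.pi) * (M * I) * Real.exp (-κ * X) := by
    filter_upwards [hdom, h.lam_pos, hzb] with i h1 hl hb' X hX
    rw [edgeAlpha_eq_integral a b _ _ _ hl (sub_pos.2 hb') X]
    refine (Complex.abs_re_le_norm _).trans ?_
    have h2 := norm_integral_le_of_norm_le (hgauss.const_mul (M * Real.exp (-κ * X)))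
      (ae_of_all _ (h1 X hX))
    rw [integral_const_mul] at h2
    have h3 : ‖(1 / (2 * Real.pi) : ℂ)‖ = 1 / (2 * Real.pi) := by
      rw [show (1 / (2 * Real.pi) : ℂ) = ((1 / (2 * Real.pi) : ℝ) : ℂ) by push_cast; rfl,
        Complex.norm_real, Real.norm_of_nonneg (by have := Real.pi_pos; positivity)]
    rw [norm_mul, h3]
    refine (mul_le_mul_of_nonneg_left h2 (by have := Real.pi_pos; positivity)).trans (le_of_eq ?_)
    ring
  refine ⟨1 / (2 * Real.pi) * (M * I), ⟨?_, (continuous_phi w s).measurable, hbound, ?_, hlim⟩⟩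
  · filter_upwards [hp] with i hi
    exact (continuous_edgeAlpha a b _ hi _ _).measurable
  · intro X hX
    exact le_of_tendsto (hlim X hX).abs (hbound.mono fun i hi => hi X hX)

end EdgeScaling

end StationaryTASEP

end


noncomputable section

namespace StationaryTASEP

/-! ### Action on exponentials -/

lemma opTMinus_psi {b : ℝ} (hb : -1 / 2 < b) (c : ℝ) :
    opTMinus (fun x => c * psi b x) = fun x => c / (1 / 2 + b) * psi b x := by
  funext x
  have h0 : -(1 / 2 + b) < 0 := by linarith
  have e : ∀ y, Real.exp (-(y - x) / 2) * (c * psi b y) =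
      c * Real.exp (x / 2) * Real.exp (-(1 / 2 + b) * y) := by
    intro y
    rw [psi, mul_left_comm, ← Real.exp_add, mul_assoc, ← Real.exp_add]
    congr 2; ring
  simp only [opTMinus, e]
  rw [integral_const_mul, integral_exp_mul_Ioi h0, psi, neg_div_neg_eq]
  have : Real.exp (-b * x) = Real.exp (x / 2) * Real.exp (-(1 / 2 + b) * x) := by
    rw [← Real.exp_add]; congr 1; ring
  rw [this]
  ring

lemma opTPlusInv_psi (b c : ℝ) :
    opTPlusInv (fun x => c * psi b x) = fun x => c * (1 / 2 - b) * psi b x := by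
  funext x
  have h : HasDerivAt (fun x => c * psi b x) (c * (Real.exp (-b * x) * (-b))) x := by
    have := ((hasDerivAt_id x).const_mul (-b)).exp.const_mul c
    simpa [psi] using this
  rw [opTPlusInv, h.deriv, psi]
  ring

lemma iterate_opTMinus_psi {b : ℝ} (hb : -1 / 2 < b) (c : ℝ) (k : ℕ) :
    opTMinus^[k] (fun x => c * psi b x) = fun x => c / (1 / 2 + b) ^ k * psi b x := by
  induction k generalizing c with
  | zero => simp
  | succ k ih =>
    rw [Function.iterate_succ_apply, opTMinus_psi hb, ih, div_div, pow_succ']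

lemma iterate_opTPlusInv_psi (b c : ℝ) (k : ℕ) :
    opTPlusInv^[k] (fun x => c * psi b x) = fun x => c * (1 / 2 - b) ^ k * psi b x := by
  induction k generalizing c with
  | zero => simp
  | succ k ih =>
    rw [Function.iterate_succ_apply, opTPlusInv_psi, ih, mul_assoc, pow_succ']

/-- The eigenvalue `(1/2-b)^p / (1/2+b)^n`. -/
def expEigen (n p : ℕ) (b : ℝ) : ℝ := (1 / 2 - b) ^ p / (1 / 2 + b) ^ n

lemma expEigen_pos (n p : ℕ) {b : ℝ} (hb : b ∈ Ioo (-1 / 2 : ℝ) (1 / 2)) : 0 < expEigen n p b := by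
  have h1 : 0 < 1 / 2 - b := by linarith [hb.2]
  have h2 : 0 < 1 / 2 + b := by linarith [hb.1]
  unfold expEigen; positivity

/-- On e^{-bx} the operator T₋ acts as 1/(1/2+b) and T₊⁻¹ as 1/2 - b. -/
lemma opR_psi {m d : ℤ} {n p : ℕ} (hn : m - d = n) (hp : m + d = p) {b : ℝ} (hb : -1 / 2 < b) :
    opR m d (psi b) = fun x => expEigen n p b * psi b x := by
  have := iterate_opTMinus_psi hb 1 n
  simp only [one_mul] at this
  rw [opR, hn, hp, Int.toNat_natCast, Int.toNat_natCast, show psi b = fun x => psi b x from rfl,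
    this, iterate_opTPlusInv_psi]
  funext x
  rw [expEigen]
  ring

lemma opLStar_psi {m d : ℤ} {n p : ℕ} (hn : m - d = n) (hp : m + d = p) {b : ℝ}
    (hb : -1 / 2 < b) : opLStar m d (psi b) = fun x => expEigen p n b * psi b x := by
  have := iterate_opTPlusInv_psi b 1 n
  simp only [one_mul] at this
  rw [opLStar, hn, hp, Int.toNat_natCast, Int.toNat_natCast, show psi b = fun x => psi b x from rfl,
    this, iterate_opTMinus_psi hb]
  funext x
  rw [expEigen]

lemma normZ_eq {m d : ℤ} {n p : ℕ} (hn : m - d = n) (hp : m + d = p) {a b : ℝ}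
    (ha : a ∈ Ioo (-1 / 2 : ℝ) (1 / 2)) (hb : b ∈ Ioo (-1 / 2 : ℝ) (1 / 2)) :
    normZ m d a b = expEigen p n a * expEigen n p b / (a + b) := by
  have ha1 : 1 / 2 - a ≠ 0 := by linarith [ha.2]
  have ha2 : 1 / 2 + a ≠ 0 := by linarith [ha.1]
  have hb1 : 1 / 2 - b ≠ 0 := by linarith [hb.2]
  have hb2 : 1 / 2 + b ≠ 0 := by linarith [hb.1]
  have e1 : (1 - 2 * a) / (1 + 2 * a) = (1 / 2 - a) / (1 / 2 + a) := by
    rw [show 1 - 2 * a = 2 * (1 / 2 - a) by ring, show 1 + 2 * a = 2 * (1 / 2 + a) by ring,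
      mul_div_mul_left _ _ two_ne_zero]
  have e2 : (1 - 2 * b) / (1 + 2 * b) = (1 / 2 - b) / (1 / 2 + b) := by
    rw [show 1 - 2 * b = 2 * (1 / 2 - b) by ring, show 1 + 2 * b = 2 * (1 / 2 + b) by ring,
      mul_div_mul_left _ _ two_ne_zero]
  rw [normZ, expEigen, expEigen, e1, e2, show 1 / 4 - a ^ 2 = (1 / 2 - a) * (1 / 2 + a) by ring,
    show 1 / 4 - b ^ 2 = (1 / 2 - b) * (1 / 2 + b) by ring]
  simp only [← zpow_natCast, ← hn, ← hp]
  rw [div_zpow, div_zpow, mul_zpow, mul_zpow, zpow_sub₀ ha1, zpow_add₀ ha2, zpow_add₀ hb1,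
    zpow_sub₀ hb2, zpow_neg, zpow_neg]
  generalize (1 / 2 - a) ^ m = A1
  generalize (1 / 2 + a) ^ m = A2
  generalize (1 / 2 - b) ^ m = A3
  generalize (1 / 2 + b) ^ m = A4
  generalize (1 / 2 - a) ^ d = A5
  generalize (1 / 2 + a) ^ d = A6
  generalize (1 / 2 - b) ^ d = A7
  generalize (1 / 2 + b) ^ d = A8
  generalize a + b = A9
  simp only [div_eq_mul_inv, mul_inv, inv_inv, one_mul]
  ring

/-! ### Exponential polynomials -/

/-- `e^{-x/2} P(x)`. -/
def expPoly (P : Polynomial ℝ) (x : ℝ) : ℝ := Real.exp (-(1 / 2) * x) * P.eval x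

lemma continuous_expPoly (P : Polynomial ℝ) : Continuous (expPoly P) := by
  unfold expPoly; fun_prop

lemma abs_eval_le (P : Polynomial ℝ) {ε : ℝ} (hε : 0 < ε) :
    ∃ C, 0 ≤ C ∧ ∀ x, 0 ≤ x → |P.eval x| ≤ C * Real.exp (ε * x) := by
  induction P using Polynomial.induction_on' with
  | add P Q hP hQ =>
    obtain ⟨C, hC0, hC⟩ := hP
    obtain ⟨D, hD0, hD⟩ := hQ
    refine ⟨C + D, by positivity, fun x hx => ?_⟩
    rw [Polynomial.eval_add, add_mul]
    exact (abs_add_le _ _).trans (add_le_add (hC x hx) (hD x hx))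
  | monomial k c =>
    refine ⟨|c| * (k.factorial / ε ^ k), by positivity, fun x hx => ?_⟩
    rw [Polynomial.eval_monomial, abs_mul, mul_assoc, abs_of_nonneg (pow_nonneg hx k)]
    refine mul_le_mul_of_nonneg_left ?_ (abs_nonneg c)
    have := Real.pow_div_factorial_le_exp (ε * x) (by positivity) k
    rw [div_le_iff₀ (by positivity), mul_pow] at this
    rw [div_mul_eq_mul_div, le_div_iff₀ (by positivity)]
    linarith

lemma abs_expPoly_le (P : Polynomial ℝ) {κ : ℝ} (hκ : κ < 1 / 2) :
    ∃ C, 0 ≤ C ∧ ∀ x, 0 ≤ x → |expPoly P x| ≤ C * Real.exp (-κ * x) := by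
  obtain ⟨C, hC0, hC⟩ := abs_eval_le P (sub_pos.2 hκ)
  refine ⟨C, hC0, fun x hx => ?_⟩
  rw [expPoly, abs_mul, Real.abs_exp]
  calc _ ≤ Real.exp (-(1 / 2) * x) * (C * Real.exp ((1 / 2 - κ) * x)) :=
        mul_le_mul_of_nonneg_left (hC x hx) (Real.exp_nonneg _)
    _ = C * (Real.exp (-(1 / 2) * x) * Real.exp ((1 / 2 - κ) * x)) := by ring
    _ = _ := by rw [← Real.exp_add]; congr 2; ring

lemma memLp_expPoly (P : Polynomial ℝ) : MemLp (expPoly P) 2 halfLine := by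
  obtain ⟨C, -, hC⟩ := abs_expPoly_le P (show (1 / 4 : ℝ) < 1 / 2 by norm_num)
  exact memLp_halfLine_of_bound (continuous_expPoly P).aestronglyMeasurable (by norm_num) hC

lemma integrable_expPoly_mul_exp (P : Polynomial ℝ) {b : ℝ} (hb : b < 1 / 2) :
    Integrable (fun x => expPoly P x * Real.exp (b * x)) halfLine := by
  obtain ⟨κ, h1, h2⟩ := exists_between hb
  obtain ⟨C, -, hC⟩ := abs_expPoly_le P h2
  have := continuous_expPoly P
  refine integrable_halfLine_of_bound (C := C) (κ := κ - b)
    (by fun_prop : Continuous fun x => expPoly P x * Real.exp (b * x)).aestronglyMeasurable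
    (sub_pos.2 h1) fun x hx => ?_
  rw [abs_mul, Real.abs_exp]
  calc _ ≤ C * Real.exp (-κ * x) * Real.exp (b * x) :=
        mul_le_mul_of_nonneg_right (hC x hx) (Real.exp_nonneg _)
    _ = _ := by rw [mul_assoc, ← Real.exp_add]; congr 2; ring

lemma halfLine_mono {u : ℝ} (hu : 0 ≤ u) : volume.restrict (Ici u) ≤ halfLine :=
  Measure.restrict_mono (Ici_subset_Ici.2 hu) le_rfl

/-- The shifted argument separates. -/
lemma expPoly_add {P : Polynomial ℝ} {N : ℕ} (hN : P.natDegree < N) (x v : ℝ) :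
    expPoly P (x + v) = ∑ i ∈ Finset.range N,
      expPoly (Polynomial.X ^ i) x * expPoly (Polynomial.hasseDeriv i P) v := by
  simp only [expPoly]
  -- The Taylor expansion of P at v separates the variables; its coefficients are Hasse derivatives.
  rw [mul_add, Real.exp_add, ← Polynomial.taylor_eval,
    Polynomial.eval_eq_sum_range' (n := N) (by rwa [Polynomial.natDegree_taylor]), Finset.mul_sum]
  refine Finset.sum_congr rfl fun i _ => ?_
  rw [Polynomial.taylor_coeff, Polynomial.eval_pow, Polynomial.eval_X]
  ring

lemma integral_pow_mul_exp_halfLine (k : ℕ) {c : ℝ} (hc : 0 < c) :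
    Integrable (fun x : ℝ => x ^ k * Real.exp (-c * x)) halfLine ∧
    ∫ x, x ^ k * Real.exp (-c * x) ∂halfLine = k.factorial / c ^ (k + 1) := by
  constructor
  · obtain ⟨C, -, hC⟩ := abs_eval_le (Polynomial.X ^ k) (half_pos hc)
    refine integrable_halfLine_of_bound (C := C) (κ := c / 2)
      (by fun_prop : Continuous fun x : ℝ => x ^ k * Real.exp (-c * x)).aestronglyMeasurable
      (half_pos hc) fun x hx => ?_
    have := hC x hx
    rw [Polynomial.eval_pow, Polynomial.eval_X] at this
    rw [abs_mul, Real.abs_exp]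
    calc _ ≤ C * Real.exp (c / 2 * x) * Real.exp (-c * x) :=
          mul_le_mul_of_nonneg_right this (Real.exp_nonneg _)
      _ = _ := by rw [mul_assoc, ← Real.exp_add]; congr 2; ring
  · have h := Real.integral_rpow_mul_exp_neg_mul_Ioi (a := k + 1) (by positivity) hc
    rw [integral_Ici_eq_integral_Ioi]
    rw [Real.Gamma_nat_eq_factorial, Real.rpow_add_one (by positivity), Real.rpow_natCast] at h
    have e : ∀ x : ℝ, x ^ ((k + 1 : ℝ) - 1) * Real.exp (-(c * x)) = x ^ k * Real.exp (-c * x) := by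
      intro x
      rw [add_sub_cancel_right, Real.rpow_natCast, neg_mul]
    simp only [e] at h
    rw [h, div_pow, one_pow, pow_succ]
    field_simp

/-- Monomials integrate to k!/c^{k+1}, so the function is a polynomial in 1/c. -/
lemma analyticAt_integral_eval_mul_exp (P : Polynomial ℝ) {c₀ : ℝ} (hc : 0 < c₀) :
    AnalyticAt ℝ (fun c => ∫ x, P.eval x * Real.exp (-c * x) ∂halfLine) c₀ := by
  have h : (fun c => ∑ k ∈ Finset.range (P.natDegree + 1),
      P.coeff k * (k.factorial / c ^ (k + 1))) =ᶠ[𝓝 c₀]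
      fun c => ∫ x, P.eval x * Real.exp (-c * x) ∂halfLine := by
    filter_upwards [lt_mem_nhds hc] with c hc
    simp only [Polynomial.eval_eq_sum_range, Finset.sum_mul, mul_assoc]
    rw [integral_finsetSum _ fun k _ => (integral_pow_mul_exp_halfLine k hc).1.const_mul _]
    refine Finset.sum_congr rfl fun k _ => ?_
    rw [integral_const_mul, (integral_pow_mul_exp_halfLine k hc).2]
  refine AnalyticAt.congr ?_ h
  refine Finset.analyticAt_fun_sum _ fun k _ => ?_
  exact analyticAt_const.mul (analyticAt_const.div (analyticAt_id.pow _) (pow_ne_zero _ hc.ne'))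

lemma analyticAt_integral_expPoly_mul_exp (P : Polynomial ℝ) {b : ℝ} (hb : b < 1 / 2) :
    AnalyticAt ℝ (fun b => ∫ x, expPoly P x * Real.exp (b * x) ∂halfLine) b := by
  have h := (analyticAt_integral_eval_mul_exp P (sub_pos.2 hb)).fun_comp_of_eq
    (f := fun b => 1 / 2 - b) (analyticAt_const.sub analyticAt_id) rfl
  refine h.congr (Eventually.of_forall fun b => ?_)
  simp only
  congr 1; funext x
  rw [expPoly, mul_right_comm, ← Real.exp_add, mul_comm]
  congr 2; ring

lemma integral_Ici_eq_halfLine (f : ℝ → ℝ) (u : ℝ) :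
    ∫ x in Ici u, f x = ∫ x, f (u + x) ∂halfLine := by
  rw [← integral_indicator measurableSet_Ici, ← integral_indicator measurableSet_Ici,
    ← integral_add_left_eq_self _ u]
  congr 1; funext x
  simp [indicator]

lemma analyticAt_integral_Ici_expPoly_mul_exp (P : Polynomial ℝ) (u : ℝ) {b : ℝ}
    (hb : -1 / 2 < b) :
    AnalyticAt ℝ (fun b => ∫ x in Ici u, expPoly P x * Real.exp (-b * x)) b := by
  have h := ((analyticAt_integral_eval_mul_exp (Polynomial.taylor u P)
    (show 0 < 1 / 2 + b by linarith)).fun_comp_of_eq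
    (f := fun b => 1 / 2 + b) (analyticAt_const.add analyticAt_id) rfl)
  have h2 : AnalyticAt ℝ (fun b : ℝ => Real.exp (-(1 / 2 + b) * u)) b :=
    ((analyticAt_const.add analyticAt_id).neg.mul analyticAt_const).rexp
  refine (h2.mul h).congr (Eventually.of_forall fun b => ?_)
  simp only [Pi.mul_apply]
  rw [integral_Ici_eq_halfLine _ u, ← integral_const_mul]
  congr 1; funext x
  rw [expPoly, Polynomial.taylor_eval, mul_left_comm, ← Real.exp_add, mul_right_comm,
    ← Real.exp_add, mul_comm, add_comm x u]
  congr 2; ring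

end StationaryTASEP

end


noncomputable section

namespace StationaryTASEP

/-! ### The finite rank structure at finite time -/

/-- `∫_0^∞ ℓ(x+v) k(v+y) dv` for exponential polynomials `ℓ`, `k`. -/
def expKernel (P Q : Polynomial ℝ) (x y : ℝ) : ℝ :=
  ∫ v, expPoly P (x + v) * expPoly Q (v + y) ∂halfLine

/-- `∫_0^∞ ℓ(x+v) e^{bv} dv`. -/
def expTail (P : Polynomial ℝ) (b x : ℝ) : ℝ :=
  ∫ v, expPoly P (x + v) * Real.exp (b * v) ∂halfLine

/-- `e^{-bx} - c ∫_0^∞ ℓ(x+v) e^{bv} dv`. -/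
def dressedExp (P : Polynomial ℝ) (c b x : ℝ) : ℝ := Real.exp (-b * x) - c * expTail P b x

/-- `∫_u^∞ ℓ(x+v) e^{-ax} dx`. -/
def cutTail (P : Polynomial ℝ) (u a v : ℝ) : ℝ :=
  ∫ x in Ici u, expPoly P (x + v) * Real.exp (-a * x)

/-- `∫_0^∞ k(v+y) (e^{av} - c⁻¹ ∫_u^∞ ℓ(x+v) e^{-ax} dx) dv`. -/
def cutRemainder (P Q : Polynomial ℝ) (c u a y : ℝ) : ℝ :=
  ∫ v, expPoly Q (v + y) * (Real.exp (a * v) - c⁻¹ * cutTail P u a v) ∂halfLine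

def expMoment (P : Polynomial ℝ) (b : ℝ) : ℝ := ∫ x, expPoly P x * Real.exp (b * x) ∂halfLine

def cutMoment (P : Polynomial ℝ) (u b : ℝ) : ℝ :=
  ∫ x in Ici u, expPoly P x * Real.exp (-b * x)

def expGram (P Q : Polynomial ℝ) : ℝ := ∫ x, expPoly P x * expPoly Q x ∂halfLine

lemma integrable_expPoly_mul (P Q : Polynomial ℝ) :
    Integrable (fun x => expPoly P x * expPoly Q x) halfLine :=
  MemLp.integrable_fun_mul (memLp_expPoly P) (memLp_expPoly Q)

lemma integrable_Ici_expPoly_mul_exp (P : Polynomial ℝ) {u b : ℝ} (hu : 0 ≤ u) (hb : -1 / 2 < b) :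
    Integrable (fun x => expPoly P x * Real.exp (-b * x)) (volume.restrict (Ici u)) :=
  (integrable_expPoly_mul_exp P (by linarith)).mono_measure (halfLine_mono hu)

variable {P Q : Polynomial ℝ} {N : ℕ}

lemma expTail_eq_sum (hP : P.natDegree < N) {b : ℝ} (hb : b < 1 / 2) (x : ℝ) :
    expTail P b x = ∑ i ∈ Finset.range N,
      expPoly (Polynomial.X ^ i) x * expMoment (Polynomial.hasseDeriv i P) b := by
  simp only [expTail, expPoly_add hP, Finset.sum_mul, mul_assoc]
  rw [integral_finsetSum _ fun i _ => (integrable_expPoly_mul_exp _ hb).const_mul _]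
  simp only [integral_const_mul, expMoment]

lemma cutTail_eq_sum (hP : P.natDegree < N) {u a : ℝ} (hu : 0 ≤ u) (ha : -1 / 2 < a) (v : ℝ) :
    cutTail P u a v = ∑ i ∈ Finset.range N,
      expPoly (Polynomial.hasseDeriv i P) v * cutMoment (Polynomial.X ^ i) u a := by
  simp only [cutTail, expPoly_add hP, Finset.sum_mul, mul_right_comm _ _ (Real.exp _)]
  rw [integral_finsetSum _ fun i _ => (integrable_Ici_expPoly_mul_exp _ hu ha).mul_const _]
  simp only [integral_mul_const, cutMoment, mul_comm (expPoly (Polynomial.hasseDeriv _ _) _)]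

lemma integral_expPoly_mul_add (hQ : Q.natDegree < N) (S : Polynomial ℝ) (y : ℝ) :
    ∫ v, expPoly S v * expPoly Q (v + y) ∂halfLine = ∑ j ∈ Finset.range N,
      expPoly (Polynomial.X ^ j) y * expGram S (Polynomial.hasseDeriv j Q) := by
  simp only [add_comm _ y, expPoly_add hQ, Finset.mul_sum, mul_left_comm (expPoly S _)]
  rw [integral_finsetSum _ fun i _ => (integrable_expPoly_mul _ _).const_mul _]
  simp only [integral_const_mul, expGram]

lemma integrable_expPoly_mul_add (S Q : Polynomial ℝ) (y : ℝ) :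
    Integrable (fun v => expPoly S v * expPoly Q (v + y)) halfLine := by
  simp only [add_comm _ y, expPoly_add (Nat.lt_succ_self Q.natDegree), Finset.mul_sum,
    mul_left_comm (expPoly S _)]
  exact integrable_finsetSum _ fun i _ => (integrable_expPoly_mul _ _).const_mul _

lemma expKernel_eq_sum (hP : P.natDegree < N) (x y : ℝ) :
    expKernel P Q x y = ∑ i ∈ Finset.range N, expPoly (Polynomial.X ^ i) x *
      ∫ v, expPoly (Polynomial.hasseDeriv i P) v * expPoly Q (v + y) ∂halfLine := by
  simp only [expKernel, expPoly_add hP, Finset.sum_mul, mul_assoc]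
  rw [integral_finsetSum _ fun i _ => (integrable_expPoly_mul_add _ _ _).const_mul _]
  simp only [integral_const_mul]

/-- Finite rank in the functions x^i e^{-x/2}: every pairing below becomes a finite sum, with the
parameters a, b only in scalar coefficients. -/
lemma expKernel_eq_sum_sum (hP : P.natDegree < N) (hQ : Q.natDegree < N) (x y : ℝ) :
    expKernel P Q x y = ∑ i ∈ Finset.range N, ∑ j ∈ Finset.range N,
      expGram (Polynomial.hasseDeriv i P) (Polynomial.hasseDeriv j Q) *
        (expPoly (Polynomial.X ^ i) x * expPoly (Polynomial.X ^ j) y) := by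
  rw [expKernel_eq_sum hP]
  refine Finset.sum_congr rfl fun i _ => ?_
  rw [integral_expPoly_mul_add hQ, Finset.mul_sum]
  refine Finset.sum_congr rfl fun j _ => ?_
  ring

lemma memLp_expPoly_Ici (P : Polynomial ℝ) {u : ℝ} (hu : 0 ≤ u) :
    MemLp (expPoly P) 2 (volume.restrict (Ici u)) :=
  (memLp_expPoly P).mono_measure (halfLine_mono hu)

lemma memLp_expKernel (P Q : Polynomial ℝ) {u : ℝ} (hu : 0 ≤ u) :
    MemLp (Function.uncurry (expKernel P Q)) 2
      ((volume.restrict (Ici u)).prod (volume.restrict (Ici u))) := by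
  set N := max P.natDegree Q.natDegree + 1 with hN
  have h : Function.uncurry (expKernel P Q) = fun q : ℝ × ℝ =>
      ∑ i ∈ Finset.range N, ∑ j ∈ Finset.range N,
      expGram (Polynomial.hasseDeriv i P) (Polynomial.hasseDeriv j Q) *
        (expPoly (Polynomial.X ^ i) q.1 * expPoly (Polynomial.X ^ j) q.2) := by
    funext q
    exact expKernel_eq_sum_sum (by omega) (by omega) _ _
  rw [h]
  exact memLp_finsetSum _ fun i _ => memLp_finsetSum _ fun j _ =>
    (memLp_two_mul_prod (memLp_expPoly_Ici _ hu) (memLp_expPoly_Ici _ hu)).const_mul _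

lemma cutRemainder_eq (P Q : Polynomial ℝ) (c y : ℝ) {u a : ℝ} (hu : 0 ≤ u) (ha : a ∈ Ioo (-1 / 2 : ℝ) (1 / 2)) :
    cutRemainder P Q c u a y = expTail Q a y -
      c⁻¹ * ∫ v, cutTail P u a v * expPoly Q (v + y) ∂halfLine := by
  have h1 : Integrable (fun v => expPoly Q (v + y) * Real.exp (a * v)) halfLine := by
    simp only [add_comm _ y, expPoly_add (Nat.lt_succ_self Q.natDegree), Finset.sum_mul, mul_assoc]
    exact integrable_finsetSum _ fun i _ => (integrable_expPoly_mul_exp _ ha.2).const_mul _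
  have h2 : Integrable (fun v => cutTail P u a v * expPoly Q (v + y)) halfLine := by
    simp only [cutTail_eq_sum (Nat.lt_succ_self P.natDegree) hu ha.1, Finset.sum_mul,
      mul_right_comm _ _ (expPoly Q _)]
    exact integrable_finsetSum _ fun i _ => (integrable_expPoly_mul_add _ _ _).mul_const _
  rw [cutRemainder, expTail, ← integral_const_mul]
  simp only [add_comm y]
  rw [← integral_sub h1 (h2.const_mul _)]
  congr 1; funext v; ring

lemma integral_cutTail_mul (hP : P.natDegree < N) (hQ : Q.natDegree < N) {u a : ℝ} (hu : 0 ≤ u)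
    (ha : -1 / 2 < a) (y : ℝ) : ∫ v, cutTail P u a v * expPoly Q (v + y) ∂halfLine =
      ∑ j ∈ Finset.range N, expPoly (Polynomial.X ^ j) y * ∑ i ∈ Finset.range N,
        cutMoment (Polynomial.X ^ i) u a *
          expGram (Polynomial.hasseDeriv i P) (Polynomial.hasseDeriv j Q) := by
  simp only [cutTail_eq_sum hP hu ha, Finset.sum_mul, mul_right_comm _ _ (expPoly Q _)]
  rw [integral_finsetSum _ fun i _ => (integrable_expPoly_mul_add _ _ _).mul_const _]
  simp only [integral_mul_const, integral_expPoly_mul_add hQ, Finset.sum_mul, Finset.mul_sum]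
  rw [Finset.sum_comm]
  refine Finset.sum_congr rfl fun j _ => Finset.sum_congr rfl fun i _ => ?_
  ring

/-- The transposed kernel applied to an exponential. -/
lemma integral_expKernel_mul_psi (P Q : Polynomial ℝ) {u a : ℝ} (hu : 0 ≤ u) (ha : -1 / 2 < a)
    (y : ℝ) : ∫ x in Ici u, expKernel P Q x y * psi a x =
      ∫ v, cutTail P u a v * expPoly Q (v + y) ∂halfLine := by
  set N := max P.natDegree Q.natDegree + 1 with hN
  have hP : P.natDegree < N := by omega
  have hQ : Q.natDegree < N := by omega
  rw [integral_cutTail_mul hP hQ hu ha]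
  simp only [expKernel_eq_sum_sum hP hQ, Finset.sum_mul]
  have e : ∀ (c s x : ℝ) (i : ℕ), c * (expPoly (Polynomial.X ^ i) x * s) * psi a x =
      c * s * (expPoly (Polynomial.X ^ i) x * Real.exp (-a * x)) := by
    intro c s x i; rw [psi]; ring
  simp only [e]
  rw [integral_finsetSum _ fun i _ => integrable_finsetSum _ fun j _ =>
    (integrable_Ici_expPoly_mul_exp _ hu ha).const_mul _]
  simp only [Finset.mul_sum]
  rw [Finset.sum_comm]
  refine Finset.sum_congr rfl fun i _ => ?_
  rw [integral_finsetSum _ fun j _ => (integrable_Ici_expPoly_mul_exp _ hu ha).const_mul _]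
  refine Finset.sum_congr rfl fun j _ => ?_
  rw [integral_const_mul, cutMoment]
  ring

/-- The transposed operator on the whole half line differs from the one cut at u by a multiple of
`cutRemainder`, an exponential polynomial. Unlike ψ_a, the remainder decays for every a in
(-1/2,1/2), so it can be paired with the resolvent there. -/
lemma dressedExp_eq_sub (P Q : Polynomial ℝ) {c u a : ℝ} (hc : c ≠ 0) (hu : 0 ≤ u)
    (ha : a ∈ Ioo (-1 / 2 : ℝ) (1 / 2)) : dressedExp Q c a = fun y => psi a y -
      (∫ x in Ici u, expKernel P Q x y * psi a x) - c * cutRemainder P Q c u a y := by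
  funext y
  rw [integral_expKernel_mul_psi P Q hu ha.1, cutRemainder_eq P Q c y hu ha, dressedExp, psi,
    mul_sub, mul_inv_cancel_left₀ hc]
  ring

/-- The coefficients of `cutRemainder` in terms of `e^{-y/2} y^j`. -/
def remainderCoeff (P Q : Polynomial ℝ) (N : ℕ) (c u a : ℝ) (j : ℕ) : ℝ :=
  expMoment (Polynomial.hasseDeriv j Q) a - c⁻¹ * ∑ i ∈ Finset.range N,
    cutMoment (Polynomial.X ^ i) u a *
      expGram (Polynomial.hasseDeriv i P) (Polynomial.hasseDeriv j Q)

lemma cutRemainder_eq_sum (hP : P.natDegree < N) (hQ : Q.natDegree < N) (c : ℝ) {u a : ℝ}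
    (hu : 0 ≤ u) (ha : a ∈ Ioo (-1 / 2 : ℝ) (1 / 2)) : cutRemainder P Q c u a = fun y =>
      ∑ j ∈ Finset.range N, remainderCoeff P Q N c u a j * expPoly (Polynomial.X ^ j) y := by
  funext y
  rw [cutRemainder_eq P Q c y hu ha, expTail_eq_sum hQ ha.2, integral_cutTail_mul hP hQ hu ha.1,
    Finset.mul_sum, ← Finset.sum_sub_distrib]
  refine Finset.sum_congr rfl fun j _ => ?_
  rw [remainderCoeff]
  ring

/-- The moments `∫_u^∞ x^j e^{-x/2} F(x) dx` of the dressed exponential `F`. -/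
def dressedMoment (P : Polynomial ℝ) (N : ℕ) (c u b : ℝ) (j : ℕ) : ℝ :=
  cutMoment (Polynomial.X ^ j) u b - c * ∑ i ∈ Finset.range N,
    (∫ x in Ici u, expPoly (Polynomial.X ^ j) x * expPoly (Polynomial.X ^ i) x) *
      expMoment (Polynomial.hasseDeriv i P) b

lemma integral_expPoly_mul_dressedExp (hP : P.natDegree < N) (c : ℝ) {u b : ℝ} (hu : 0 ≤ u)
    (hb : b ∈ Ioo (-1 / 2 : ℝ) (1 / 2)) (j : ℕ) :
    Integrable (fun x => expPoly (Polynomial.X ^ j) x * dressedExp P c b x)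
      (volume.restrict (Ici u)) ∧
    ∫ x in Ici u, expPoly (Polynomial.X ^ j) x * dressedExp P c b x =
      dressedMoment P N c u b j := by
  have h1 := integrable_Ici_expPoly_mul_exp (Polynomial.X ^ j) hu hb.1
  have h2 : ∀ i, Integrable (fun x => expPoly (Polynomial.X ^ j) x * expPoly (Polynomial.X ^ i) x)
      (volume.restrict (Ici u)) := fun i =>
    (integrable_expPoly_mul _ _).mono_measure (halfLine_mono hu)
  have e : ∀ x, expPoly (Polynomial.X ^ j) x * dressedExp P c b x =
      expPoly (Polynomial.X ^ j) x * Real.exp (-b * x) - c * ∑ i ∈ Finset.range N,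
        expPoly (Polynomial.X ^ j) x * expPoly (Polynomial.X ^ i) x *
          expMoment (Polynomial.hasseDeriv i P) b := by
    intro x
    rw [dressedExp, expTail_eq_sum hP hb.2, mul_sub, mul_left_comm, Finset.mul_sum]
    simp only [mul_assoc]
  simp only [e]
  have h3 : Integrable (fun x => ∑ i ∈ Finset.range N,
        expPoly (Polynomial.X ^ j) x * expPoly (Polynomial.X ^ i) x *
          expMoment (Polynomial.hasseDeriv i P) b) (volume.restrict (Ici u)) :=
    integrable_finsetSum _ fun i _ => (h2 i).mul_const _
  refine ⟨h1.sub (h3.const_mul c), ?_⟩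
  rw [integral_sub h1 (h3.const_mul c), integral_const_mul,
    integral_finsetSum _ fun i _ => (h2 i).mul_const _]
  simp only [integral_mul_const]
  rfl

lemma integral_expKernel_mul_dressedExp (hP : P.natDegree < N) (hQ : Q.natDegree < N) (c : ℝ)
    {u b : ℝ} (hu : 0 ≤ u) (hb : b ∈ Ioo (-1 / 2 : ℝ) (1 / 2)) :
    (fun x => ∫ y in Ici u, expKernel P Q x y * dressedExp P c b y) = fun x =>
      ∑ i ∈ Finset.range N, (∑ j ∈ Finset.range N,
        expGram (Polynomial.hasseDeriv i P) (Polynomial.hasseDeriv j Q) *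
          dressedMoment P N c u b j) * expPoly (Polynomial.X ^ i) x := by
  funext x
  have e : ∀ y, expKernel P Q x y * dressedExp P c b y = ∑ i ∈ Finset.range N,
      ∑ j ∈ Finset.range N, expGram (Polynomial.hasseDeriv i P) (Polynomial.hasseDeriv j Q) *
        expPoly (Polynomial.X ^ i) x * (expPoly (Polynomial.X ^ j) y * dressedExp P c b y) := by
    intro y
    rw [expKernel_eq_sum_sum hP hQ, Finset.sum_mul]
    refine Finset.sum_congr rfl fun i _ => ?_
    rw [Finset.sum_mul]
    refine Finset.sum_congr rfl fun j _ => ?_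
    ring
  simp only [e]
  have h1 := fun j => (integral_expPoly_mul_dressedExp hP c hu hb j).1
  rw [integral_finsetSum _ fun i _ => integrable_finsetSum _ fun j _ => (h1 j).const_mul _]
  refine Finset.sum_congr rfl fun i _ => ?_
  rw [integral_finsetSum _ fun j _ => (h1 j).const_mul _, Finset.sum_mul]
  refine Finset.sum_congr rfl fun j _ => ?_
  rw [integral_const_mul, (integral_expPoly_mul_dressedExp hP c hu hb j).2]
  ring

lemma toL2_sum {μ : Measure ℝ} {κ : Type*} (t : Finset κ) (c : κ → ℝ) {f : κ → ℝ → ℝ}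
    (hf : ∀ i, MemLp (f i) 2 μ) :
    toL2 μ (fun x => ∑ i ∈ t, c i * f i x) = ∑ i ∈ t, c i • toL2 μ (f i) := by
  classical
  induction t using Finset.induction_on with
  | empty =>
    simp only [Finset.sum_empty]
    rw [toL2_of_memLp (MemLp.zero' : MemLp (fun _ : ℝ => (0 : ℝ)) 2 μ)]
    exact MemLp.toLp_zero _
  | insert i t hi ih =>
    have h1 : MemLp (fun x => c i * f i x) 2 μ := (hf i).const_mul _
    have h2 : MemLp (fun x => ∑ i ∈ t, c i * f i x) 2 μ :=
      memLp_finsetSum _ fun j _ => (hf j).const_mul _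
    simp only [Finset.sum_insert hi]
    rw [← ih, ← toL2_const_mul _ (hf i), toL2_of_memLp h1, toL2_of_memLp h2]
    exact toL2_of_memLp (h1.add h2)

lemma resolventPairing_eq_inner {ν : Measure ℝ} (k : ℝ → ℝ → ℝ) {f g : ℝ → ℝ} (hf : MemLp f 2 ν)
    (hfg : Integrable (fun x => f x * g x) ν) : resolventPairing ν k f g = (∫ x, f x * g x ∂ν) +
      inner ℝ (toL2 ν f) (Ring.inverse (1 - kernelOp ν k)
        (toL2 ν fun x' => ∫ y, k x' y * g y ∂ν)) := by
  rw [resolventPairing]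
  simp only [resolventApply, mul_add]
  rw [integral_add hfg (MemLp.integrable_fun_mul hf (Lp.memLp _)), toL2_of_memLp hf,
    Lp.inner_eq_integral]
  congr 1
  refine integral_congr_ae ?_
  filter_upwards [hf.coeFn_toLp] with x hx
  rw [hx]

/-- The matrix elements of the resolvent between x^j e^{-x/2} and x^i e^{-x/2} do not involve a or
b; analyticity in (a,b) is left to the explicit coefficients. -/
lemma resolventPairing_cutRemainder (hP : P.natDegree < N) (hQ : Q.natDegree < N) (c c' : ℝ)
    {u a b : ℝ} (hu : 0 ≤ u) (ha : a ∈ Ioo (-1 / 2 : ℝ) (1 / 2))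
    (hb : b ∈ Ioo (-1 / 2 : ℝ) (1 / 2)) :
    resolventPairing (volume.restrict (Ici u)) (expKernel P Q) (cutRemainder P Q c u a)
      (dressedExp P c' b) = ∑ j ∈ Finset.range N, remainderCoeff P Q N c u a j *
        (dressedMoment P N c' u b j + ∑ i ∈ Finset.range N, (∑ k ∈ Finset.range N,
          expGram (Polynomial.hasseDeriv i P) (Polynomial.hasseDeriv k Q) *
            dressedMoment P N c' u b k) *
          inner ℝ (toL2 (volume.restrict (Ici u)) (expPoly (Polynomial.X ^ j)))
            (Ring.inverse (1 - kernelOp (volume.restrict (Ici u)) (expKernel P Q))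
              (toL2 (volume.restrict (Ici u)) (expPoly (Polynomial.X ^ i))))) := by
  have hL : ∀ j : ℕ, MemLp (expPoly (Polynomial.X ^ j)) 2 (volume.restrict (Ici u)) :=
    fun j => memLp_expPoly_Ici _ hu
  have h1 := fun j => (integral_expPoly_mul_dressedExp hP c' hu hb j).1
  have e := cutRemainder_eq_sum hP hQ c hu ha
  have hi : ∀ x, cutRemainder P Q c u a x * dressedExp P c' b x = ∑ j ∈ Finset.range N,
      remainderCoeff P Q N c u a j * (expPoly (Polynomial.X ^ j) x * dressedExp P c' b x) := by
    intro x
    rw [e, Finset.sum_mul]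
    simp only [mul_assoc]
  rw [resolventPairing_eq_inner, integral_expKernel_mul_dressedExp hP hQ c' hu hb, e, toL2_sum _ _ hL,
    toL2_sum _ _ hL, ← e]
  · simp only [hi]
    rw [integral_finsetSum _ fun j _ => (h1 j).const_mul _, sum_inner, ← Finset.sum_add_distrib]
    refine Finset.sum_congr rfl fun j _ => ?_
    rw [integral_const_mul, (integral_expPoly_mul_dressedExp hP c' hu hb j).2,
      real_inner_smul_left, map_sum, inner_sum, mul_add]
    simp only [map_smul, real_inner_smul_right]
  · rw [e]
    exact memLp_finsetSum _ fun j _ => (hL j).const_mul _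
  · simp only [hi]
    exact integrable_finsetSum _ fun j _ => (h1 j).const_mul _

end StationaryTASEP

end


noncomputable section

namespace StationaryTASEP

/-! ### The analytic extension -/

/-- The analytic extension of
`(1 - e^{-(a+b)u} ((1/2+a)/(1/2-b))^p ((1/2+b)/(1/2-a))^n) / (a+b)`. -/
def extFree (n p : ℕ) (u : ℝ) (x : ℝ × ℝ) : ℝ :=
  u * dslope Real.exp 0 (-((x.1 + x.2) * u)) - Real.exp (-((x.1 + x.2) * u)) *
    ((∑ i ∈ Finset.range p, ((1 / 2 + x.1) / (1 / 2 - x.2)) ^ i) / (1 / 2 - x.2) +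
      ((1 / 2 + x.1) / (1 / 2 - x.2)) ^ p *
        ((∑ i ∈ Finset.range n, ((1 / 2 + x.2) / (1 / 2 - x.1)) ^ i) / (1 / 2 - x.1)))

/-- With A = (1/2+a)/(1/2-b), B = (1/2+b)/(1/2-a) and E the exponential, 1 - EAᵖBⁿ = (1-E) + E(1-Aᵖ)
+ EAᵖ(1-Bⁿ). Each bracket contains the factor a+b, since A-1 = (a+b)/(1/2-b), B-1 = (a+b)/(1/2-a),
and the powers are geometric sums. -/
lemma extFree_eq (n p : ℕ) (u : ℝ) {a b : ℝ} (ha : a ∈ Ioo (-1 / 2 : ℝ) (1 / 2))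
    (hb : b ∈ Ioo (-1 / 2 : ℝ) (1 / 2)) (hab : a + b ≠ 0) : extFree n p u (a, b) =
      (1 - Real.exp (-((a + b) * u)) / (expEigen p n a * expEigen n p b)) / (a + b) := by
  have ha1 : 1 / 2 - a ≠ 0 := by linarith [ha.2]
  have ha2 : 1 / 2 + a ≠ 0 := by linarith [ha.1]
  have hb1 : 1 / 2 - b ≠ 0 := by linarith [hb.2]
  have hb2 : 1 / 2 + b ≠ 0 := by linarith [hb.1]
  have h1 := sub_smul_dslope Real.exp 0 (-((a + b) * u))
  rw [sub_zero, smul_eq_mul, Real.exp_zero] at h1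
  have h2 := geom_sum_mul ((1 / 2 + a) / (1 / 2 - b)) p
  have h3 := geom_sum_mul ((1 / 2 + b) / (1 / 2 - a)) n
  have h4 : (1 / 2 + a) / (1 / 2 - b) - 1 = (a + b) / (1 / 2 - b) := by
    rw [div_sub_one hb1]; congr 1; ring
  have h5 : (1 / 2 + b) / (1 / 2 - a) - 1 = (a + b) / (1 / 2 - a) := by
    rw [div_sub_one ha1]; congr 1; ring
  rw [h4] at h2
  rw [h5] at h3
  have h6 : (expEigen p n a * expEigen n p b)⁻¹ =
      ((1 / 2 + a) / (1 / 2 - b)) ^ p * ((1 / 2 + b) / (1 / 2 - a)) ^ n := by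
    rw [expEigen, expEigen, div_pow, div_pow, mul_inv, inv_div, inv_div]
    ring
  rw [extFree, eq_div_iff hab, div_eq_mul_inv _ (expEigen p n a * expEigen n p b), h6]
  simp only
  generalize Real.exp (-((a + b) * u)) = E at *
  generalize dslope Real.exp 0 (-((a + b) * u)) = D at *
  linear_combination -h1 - E * h2 - E * ((1 / 2 + a) / (1 / 2 - b)) ^ p * h3

/-- On the antidiagonal both ratios are 1, so the geometric sums just count p and n. -/
lemma extFree_neg (n p : ℕ) (u a : ℝ) (ha : a ∈ Ioo (-1 / 2 : ℝ) (1 / 2)) :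
    extFree n p u (a, -a) = u - (p / (1 / 2 + a) + n / (1 / 2 - a)) := by
  have ha1 : 1 / 2 - a ≠ 0 := by linarith [ha.2]
  have ha2 : 1 / 2 + a ≠ 0 := by linarith [ha.1]
  rw [extFree]
  simp only [add_neg_cancel, zero_mul, neg_zero, dslope_same, Real.deriv_exp, Real.exp_zero,
    sub_neg_eq_add, mul_one, one_mul, div_self ha2, ← sub_eq_add_neg, div_self ha1, one_pow,
    Finset.sum_const, Finset.card_range, nsmul_eq_mul]

lemma analyticAt_dslope_exp (x : ℝ) : AnalyticAt ℝ (dslope Real.exp 0) x := by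
  rcases eq_or_ne x 0 with rfl | hx
  · obtain ⟨q, hq⟩ := (analyticAt_rexp : AnalyticAt ℝ Real.exp 0)
    exact ⟨_, hq.has_fpower_series_dslope_fslope⟩
  · have h : AnalyticAt ℝ (fun y => (Real.exp y - 1) / y) x :=
      (analyticAt_rexp.sub analyticAt_const).div analyticAt_id hx
    refine h.congr ?_
    filter_upwards [isOpen_ne.mem_nhds hx] with y hy
    rw [dslope_of_ne _ hy, slope_def_field, Real.exp_zero, sub_zero]

lemma analyticAt_extFree (n p : ℕ) (u : ℝ) {x : ℝ × ℝ} (h1 : x.1 ∈ Ioo (-1 / 2 : ℝ) (1 / 2))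
    (h2 : x.2 ∈ Ioo (-1 / 2 : ℝ) (1 / 2)) : AnalyticAt ℝ (extFree n p u) x := by
  have ha1 : 1 / 2 - x.1 ≠ 0 := by linarith [h1.2]
  have hb1 : 1 / 2 - x.2 ≠ 0 := by linarith [h2.2]
  have f1 : AnalyticAt ℝ (fun x : ℝ × ℝ => x.1) x := analyticAt_fst
  have f2 : AnalyticAt ℝ (fun x : ℝ × ℝ => x.2) x := analyticAt_snd
  have e : AnalyticAt ℝ (fun x : ℝ × ℝ => -((x.1 + x.2) * u)) x :=
    ((f1.add f2).mul analyticAt_const).neg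
  have d1 : AnalyticAt ℝ (fun x : ℝ × ℝ => 1 / 2 - x.1) x := analyticAt_const.sub f1
  have d2 : AnalyticAt ℝ (fun x : ℝ × ℝ => 1 / 2 - x.2) x := analyticAt_const.sub f2
  have A : AnalyticAt ℝ (fun x : ℝ × ℝ => (1 / 2 + x.1) / (1 / 2 - x.2)) x :=
    (analyticAt_const.add f1).div d2 hb1
  have B : AnalyticAt ℝ (fun x : ℝ × ℝ => (1 / 2 + x.2) / (1 / 2 - x.1)) x :=
    (analyticAt_const.add f2).div d1 ha1
  exact (analyticAt_const.mul ((analyticAt_dslope_exp _).comp e)).sub (e.rexp.mul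
    (((Finset.analyticAt_fun_sum _ fun i _ => A.pow i).div d2 hb1).add
      ((A.pow p).mul ((Finset.analyticAt_fun_sum _ fun i _ => B.pow i).div d1 ha1))))

/-- The analytic extension of `G^{a,b}(u)`. -/
def extG (P Q : Polynomial ℝ) (n p : ℕ) (u : ℝ) (x : ℝ × ℝ) : ℝ :=
  extFree n p u x + (expEigen p n x.1)⁻¹ * (∫ y in Ici u, psi x.1 y * expTail P x.2 y) +
    (expEigen n p x.2)⁻¹ * resolventPairing (volume.restrict (Ici u)) (expKernel P Q)
      (cutRemainder P Q (expEigen p n x.1) u x.1) (dressedExp P (expEigen n p x.2) x.2)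

lemma integral_psi_mul_expTail (P : Polynomial ℝ) {u a b : ℝ} (hu : 0 ≤ u)
    (ha : a ∈ Ioo (-1 / 2 : ℝ) (1 / 2)) (hb : b ∈ Ioo (-1 / 2 : ℝ) (1 / 2)) :
    Integrable (fun y => psi a y * expTail P b y) (volume.restrict (Ici u)) ∧
    ∫ y in Ici u, psi a y * expTail P b y = ∑ i ∈ Finset.range (P.natDegree + 1),
      cutMoment (Polynomial.X ^ i) u a * expMoment (Polynomial.hasseDeriv i P) b := by
  have e : ∀ y, psi a y * expTail P b y = ∑ i ∈ Finset.range (P.natDegree + 1),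
      (expPoly (Polynomial.X ^ i) y * Real.exp (-a * y)) *
        expMoment (Polynomial.hasseDeriv i P) b := by
    intro y
    rw [expTail_eq_sum (Nat.lt_succ_self _) hb.2, psi, Finset.mul_sum]
    refine Finset.sum_congr rfl fun i _ => ?_
    ring
  have h := fun i => (integrable_Ici_expPoly_mul_exp (Polynomial.X ^ i) hu ha.1)
  simp only [e]
  refine ⟨integrable_finsetSum _ fun i _ => (h i).mul_const _, ?_⟩
  rw [integral_finsetSum _ fun i _ => (h i).mul_const _]
  simp only [integral_mul_const, cutMoment]

lemma analyticAt_expEigen (n p : ℕ) {b : ℝ} (hb : b ∈ Ioo (-1 / 2 : ℝ) (1 / 2)) :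
    AnalyticAt ℝ (expEigen n p) b := by
  have h2 : (1 / 2 + b) ^ n ≠ 0 := pow_ne_zero _ (by linarith [hb.1])
  exact ((analyticAt_const.sub analyticAt_id).pow p).div
    ((analyticAt_const.add analyticAt_id).pow n) h2

lemma analyticAt_remainderCoeff (P Q : Polynomial ℝ) (N n p : ℕ) (u : ℝ) (j : ℕ) {a : ℝ}
    (ha : a ∈ Ioo (-1 / 2 : ℝ) (1 / 2)) :
    AnalyticAt ℝ (fun a => remainderCoeff P Q N (expEigen p n a) u a j) a := by
  refine (analyticAt_integral_expPoly_mul_exp _ ha.2).sub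
    (((analyticAt_expEigen p n ha).inv (expEigen_pos p n ha).ne').mul
      (Finset.analyticAt_fun_sum _ fun i _ => ?_))
  exact (analyticAt_integral_Ici_expPoly_mul_exp _ u ha.1).mul analyticAt_const

lemma analyticAt_dressedMoment (P : Polynomial ℝ) (N n p : ℕ) (u : ℝ) (j : ℕ) {b : ℝ}
    (hb : b ∈ Ioo (-1 / 2 : ℝ) (1 / 2)) :
    AnalyticAt ℝ (fun b => dressedMoment P N (expEigen n p b) u b j) b := by
  refine (analyticAt_integral_Ici_expPoly_mul_exp _ u hb.1).sub
    ((analyticAt_expEigen n p hb).mul (Finset.analyticAt_fun_sum _ fun i _ => ?_))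
  exact analyticAt_const.mul (analyticAt_integral_expPoly_mul_exp _ hb.2)

lemma analyticOnNhd_extG (P Q : Polynomial ℝ) (n p : ℕ) {u : ℝ} (hu : 0 ≤ u) :
    AnalyticOnNhd ℝ (extG P Q n p u) (Ioo (-1 / 2) (1 / 2) ×ˢ Ioo (-1 / 2) (1 / 2)) := by
  rintro x ⟨h1, h2⟩
  set N := max P.natDegree Q.natDegree + 1 with hN
  have hP : P.natDegree < N := by omega
  have hQ : Q.natDegree < N := by omega
  have hnhds : ∀ᶠ y : ℝ × ℝ in 𝓝 x, y ∈ Ioo (-1 / 2 : ℝ) (1 / 2) ×ˢ Ioo (-1 / 2 : ℝ) (1 / 2) :=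
    (isOpen_Ioo.prod isOpen_Ioo).mem_nhds ⟨h1, h2⟩
  have f1 : AnalyticAt ℝ (fun x : ℝ × ℝ => x.1) x := analyticAt_fst
  have f2 : AnalyticAt ℝ (fun x : ℝ × ℝ => x.2) x := analyticAt_snd
  refine ((analyticAt_extFree n p u h1 h2).add ((((analyticAt_expEigen p n h1).inv
    (expEigen_pos p n h1).ne').fun_comp_of_eq f1 rfl).mul ?_)).add ((((analyticAt_expEigen n p h2).inv
    (expEigen_pos n p h2).ne').fun_comp_of_eq f2 rfl).mul ?_)
  · have h : AnalyticAt ℝ (fun x : ℝ × ℝ => ∑ i ∈ Finset.range (P.natDegree + 1),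
        cutMoment (Polynomial.X ^ i) u x.1 * expMoment (Polynomial.hasseDeriv i P) x.2) x :=
      Finset.analyticAt_fun_sum _ fun i _ =>
        ((analyticAt_integral_Ici_expPoly_mul_exp _ u h1.1).fun_comp_of_eq f1 rfl).mul
          ((analyticAt_integral_expPoly_mul_exp _ h2.2).fun_comp_of_eq f2 rfl)
    refine h.congr ?_
    filter_upwards [hnhds] with y hy
    exact (integral_psi_mul_expTail P hu hy.1 hy.2).2.symm
  · have hm := fun j => (analyticAt_dressedMoment P N n p u j h2).fun_comp_of_eq f2 rfl
    have hr := fun j => (analyticAt_remainderCoeff P Q N n p u j h1).fun_comp_of_eq f1 rfl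
    refine AnalyticAt.congr (Finset.analyticAt_fun_sum (Finset.range N) fun j _ =>
      (hr j).mul ((hm j).add (Finset.analyticAt_fun_sum (Finset.range N) fun i _ =>
        (Finset.analyticAt_fun_sum (Finset.range N) fun k _ =>
          (analyticAt_const (v := expGram (Polynomial.hasseDeriv i P)
            (Polynomial.hasseDeriv k Q))).mul (hm k)).mul
          (analyticAt_const (v := inner ℝ
            (toL2 (volume.restrict (Ici u)) (expPoly (Polynomial.X ^ j)))
            (Ring.inverse (1 - kernelOp (volume.restrict (Ici u)) (expKernel P Q))
              (toL2 (volume.restrict (Ici u)) (expPoly (Polynomial.X ^ i))))))))) ?_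
    filter_upwards [hnhds] with y hy
    exact (resolventPairing_cutRemainder hP hQ _ _ hu hy.1 hy.2).symm

lemma integral_Iio_eq_halfLine (f : ℝ → ℝ) : ∫ x in Iio (0 : ℝ), f x = ∫ x, f (-x) ∂halfLine := by
  rw [← integral_Iic_eq_integral_Iio, integral_Ici_eq_integral_Ioi]
  have := integral_comp_neg_Ioi (0 : ℝ) f
  rw [neg_zero] at this
  exact this.symm

section Extension

variable {ρ : ℝ} {m d : ℤ} {n p : ℕ} {P Q : Polynomial ℝ}

lemma kernelK_eq_expKernel (hP : ∀ r, kernelL ρ m d r = expPoly P r)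
    (hQ : ∀ r, kernelR ρ m d (-r) = expPoly Q r) : kernelK ρ m d = expKernel P Q := by
  funext x y
  rw [kernelK, integral_Iio_eq_halfLine, expKernel]
  congr 1; funext v
  rw [hP, sub_neg_eq_add, ← hQ]
  congr 2; ring

lemma oneSubK_eq_dressedExp (hn : m - d = n) (hp : m + d = p)
    (hP : ∀ r, kernelL ρ m d r = expPoly P r) {b : ℝ} (hb : -1 / 2 < b) :
    oneSubK ρ m d (psi b) = dressedExp P (expEigen n p b) b := by
  funext x
  rw [oneSubK, integral_Iio_eq_halfLine, dressedExp, expTail, opR_psi hn hp hb,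
    ← integral_const_mul, psi]
  congr 2; funext v
  simp only [hP, sub_neg_eq_add, psi, neg_mul_neg]
  ring

lemma oneSubKStar_eq_dressedExp (hn : m - d = n) (hp : m + d = p)
    (hQ : ∀ r, kernelR ρ m d (-r) = expPoly Q r) {a : ℝ} (ha : -1 / 2 < a) :
    oneSubKStar ρ m d (psi a) = dressedExp Q (expEigen p n a) a := by
  funext x
  rw [oneSubKStar, integral_Iio_eq_halfLine, dressedExp, expTail, opLStar_psi hn hp ha,
    ← integral_const_mul, psi]
  congr 2; funext v
  simp only [← neg_add', hQ, add_comm v, psi, neg_mul_neg]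
  ring

lemma memLp_psi {u a : ℝ} (hu : 0 ≤ u) (ha : 0 < a) : MemLp (psi a) 2 (volume.restrict (Ici u)) :=
  (memLp_exp_halfLine ha).mono_measure (halfLine_mono hu)

lemma memLp_expTail (P : Polynomial ℝ) {u b : ℝ} (hu : 0 ≤ u) (hb : b < 1 / 2) :
    MemLp (expTail P b) 2 (volume.restrict (Ici u)) := by
  rw [show expTail P b = fun x => ∑ i ∈ Finset.range (P.natDegree + 1),
    expPoly (Polynomial.X ^ i) x * expMoment (Polynomial.hasseDeriv i P) b from
      funext (expTail_eq_sum (Nat.lt_succ_self _) hb)]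
  exact memLp_finsetSum _ fun i _ => (memLp_expPoly_Ici _ hu).mul_const _

lemma memLp_cutRemainder (P Q : Polynomial ℝ) (c : ℝ) {u a : ℝ} (hu : 0 ≤ u)
    (ha : a ∈ Ioo (-1 / 2 : ℝ) (1 / 2)) :
    MemLp (cutRemainder P Q c u a) 2 (volume.restrict (Ici u)) := by
  rw [cutRemainder_eq_sum (N := max P.natDegree Q.natDegree + 1) (by omega) (by omega) c hu ha]
  exact memLp_finsetSum _ fun i _ => (memLp_expPoly_Ici _ hu).const_mul _

/-- The pairing with ψ_a is elementary and produces e^{-(a+b)u}/(a+b); division by Z, which carries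
1/(a+b) and both eigenvalues, leaves 1/(a+b) only in the free term. -/
lemma extG_eq_Gab (hn : m - d = n) (hp : m + d = p) (hP : ∀ r, kernelL ρ m d r = expPoly P r)
    (hQ : ∀ r, kernelR ρ m d (-r) = expPoly Q r) {u : ℝ} (hu : 0 ≤ u)
    (hunit : IsUnit (1 - kernelOp (volume.restrict (Ici u)) (expKernel P Q))) {a b : ℝ}
    (ha : a ∈ Ioo (0 : ℝ) (1 / 2)) (hb : b ∈ Ioo (0 : ℝ) (1 / 2)) :
    extG P Q n p u (a, b) = Gab ρ m d u a b := by
  have ha' : a ∈ Ioo (-1 / 2 : ℝ) (1 / 2) := ⟨by linarith [ha.1], ha.2⟩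
  have hb' : b ∈ Ioo (-1 / 2 : ℝ) (1 / 2) := ⟨by linarith [hb.1], hb.2⟩
  have hab : 0 < a + b := add_pos ha.1 hb.1
  have hca := expEigen_pos p n ha'
  have hcb := expEigen_pos n p hb'
  obtain ⟨ca, hca'⟩ : ∃ c, expEigen p n a = c := ⟨_, rfl⟩
  obtain ⟨cb, hcb'⟩ : ∃ c, expEigen n p b = c := ⟨_, rfl⟩
  rw [hca'] at hca
  rw [hcb'] at hcb
  have hFb : MemLp (dressedExp P cb b) 2 (volume.restrict (Ici u)) :=
    (memLp_psi hu hb.1).sub ((memLp_expTail P hu hb.2).const_mul cb)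
  have h1 := resolventPairing_one_sub_transpose (memLp_expKernel P Q hu) hunit
    (memLp_psi hu ha.1) ((memLp_cutRemainder P Q ca hu ha').const_mul ca) hFb
  have h2 := resolventPairing_const_mul (ν := volume.restrict (Ici u)) (expKernel P Q) ca
    one_ne_zero (cutRemainder P Q ca u a) (dressedExp P cb b)
  simp only [one_mul, mul_one] at h2
  have h3 : ∫ x in Ici u, psi a x * dressedExp P cb b x =
      Real.exp (-((a + b) * u)) / (a + b) - cb * ∫ y in Ici u, psi a y * expTail P b y := by
    have e : ∀ x, psi a x * dressedExp P cb b x =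
        Real.exp (-(a + b) * x) - cb * (psi a x * expTail P b x) := by
      intro x
      rw [dressedExp, mul_sub, psi, ← Real.exp_add]
      congr 1
      · congr 1; ring
      · ring
    have hi1 : Integrable (fun x => Real.exp (-(a + b) * x)) (volume.restrict (Ici u)) :=
      (integrable_exp_halfLine hab).mono_measure (halfLine_mono hu)
    simp only [e]
    rw [integral_sub hi1 ((integral_psi_mul_expTail P hu ha' hb').1.const_mul cb),
      integral_const_mul, integral_Ici_eq_integral_Ioi, integral_exp_mul_Ioi (by linarith),
      neg_div_neg_eq, neg_mul]
  rw [Gab, kernelK_eq_expKernel hP hQ, oneSubK_eq_dressedExp hn hp hP hb'.1,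
    oneSubKStar_eq_dressedExp hn hp hQ ha'.1, hca', hcb', dressedExp_eq_sub P Q hca.ne' hu ha', h1,
    h2, h3, normZ_eq hn hp ha' hb', extG, extFree_eq n p u ha' hb' hab.ne']
  simp only [hca', hcb']
  field_simp
  ring

lemma isAnalyticExtension_extG (hn : m - d = n) (hp : m + d = p)
    (hP : ∀ r, kernelL ρ m d r = expPoly P r) (hQ : ∀ r, kernelR ρ m d (-r) = expPoly Q r) {u : ℝ}
    (hu : 0 ≤ u) (hunit : IsUnit (1 - kernelOp (volume.restrict (Ici u)) (expKernel P Q))) :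
    IsAnalyticExtension ρ m d u (extG P Q n p u) :=
  ⟨analyticOnNhd_extG P Q n p hu, fun _ ha _ hb => extG_eq_Gab hn hp hP hQ hu hunit ha hb⟩

end Extension

/-- Identity theorem on the connected square, from agreement near (1/4,1/4). -/
lemma IsAnalyticExtension.eqOn {ρ : ℝ} {m d : ℤ} {u : ℝ} {H H' : ℝ × ℝ → ℝ}
    (h : IsAnalyticExtension ρ m d u H) (h' : IsAnalyticExtension ρ m d u H') :
    EqOn H H' (Ioo (-1 / 2) (1 / 2) ×ˢ Ioo (-1 / 2) (1 / 2)) := by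
  refine h.1.eqOn_of_preconnected_of_eventuallyEq h'.1
    ((convex_Ioo _ _).prod (convex_Ioo _ _)).isPreconnected (z₀ := (1 / 4, 1 / 4))
    ⟨by norm_num, by norm_num⟩ ?_
  have : Ioo (0 : ℝ) (1 / 2) ×ˢ Ioo (0 : ℝ) (1 / 2) ∈ 𝓝 ((1 / 4 : ℝ), (1 / 4 : ℝ)) :=
    (isOpen_Ioo.prod isOpen_Ioo).mem_nhds ⟨by norm_num, by norm_num⟩
  filter_upwards [this] with x hx
  exact (h.2 x.1 hx.1 x.2 hx.2).trans (h'.2 x.1 hx.1 x.2 hx.2).symm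

/-- By uniqueness the choice of extension is immaterial, and by continuity the limit is a value. -/
lemma IsAnalyticExtension.GZero_eq {ρ : ℝ} (hρ0 : 0 < ρ) (hρ1 : ρ < 1) {m d : ℤ} {u : ℝ}
    {H : ℝ × ℝ → ℝ} (h : IsAnalyticExtension ρ m d u H) :
    GZero ρ m d u = H (1 / 2 - ρ, -(1 / 2 - ρ)) := by
  have hex : ∃ H, IsAnalyticExtension ρ m d u H := ⟨H, h⟩
  have h0 : (1 / 2 - ρ, -(1 / 2 - ρ)) ∈ Ioo (-1 / 2 : ℝ) (1 / 2) ×ˢ Ioo (-1 / 2 : ℝ) (1 / 2) :=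
    ⟨⟨by linarith, by linarith⟩, ⟨by linarith, by linarith⟩⟩
  rw [GZero, dif_pos hex, ← hex.choose_spec.eqOn h h0]
  refine Tendsto.limUnder_eq (Tendsto.mono_left ?_ nhdsWithin_le_nhds)
  exact ((hex.choose_spec.1 _ h0).continuousAt.tendsto).comp
    (tendsto_const_nhds.prodMk_nhds tendsto_id)

end StationaryTASEP

end


noncomputable section

namespace StationaryTASEP

/-! ### The finite time quantity in edge variables -/

lemma integral_halfLine_comp_mul (f : ℝ → ℝ) {lam : ℝ} (hlam : 0 < lam) :
    ∫ v, f v ∂halfLine = lam * ∫ v, f (lam * v) ∂halfLine := by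
  rw [halfLine, integral_Ici_eq_integral_Ioi, integral_Ici_eq_integral_Ioi,
    integral_comp_mul_left_Ioi f 0 hlam, mul_zero, smul_eq_mul, mul_inv_cancel_left₀ hlam.ne']

lemma integral_Ici_comp_mul (f : ℝ → ℝ) (u : ℝ) {lam : ℝ} (hlam : 0 < lam) :
    ∫ x in Ici u, f x = lam * ∫ X, f (u + lam * X) ∂halfLine := by
  rw [integral_Ici_eq_halfLine f u, integral_halfLine_comp_mul (fun x => f (u + x)) hlam]

lemma memLp_kernel_of_bound_mul {k : ℝ → ℝ → ℝ} {μ ν : Measure ℝ} [SFinite μ] [SFinite ν]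
    (hμ : μ ≤ halfLine) (hν : ν ≤ halfLine) (hk : Continuous (Function.uncurry k)) {C κ κ' : ℝ}
    (hκ : 0 < κ) (hκ' : 0 < κ')
    (h : ∀ x y, 0 ≤ x → 0 ≤ y → |k x y| ≤ C * (Real.exp (-κ * x) * Real.exp (-κ' * y))) :
    MemLp (Function.uncurry k) 2 (μ.prod ν) := by
  have h0 : MemLp (Function.uncurry k) 2 (halfLine.prod halfLine) :=
    ((memLp_two_mul_prod (memLp_exp_halfLine hκ) (memLp_exp_halfLine hκ')).const_mul C).mono'
      hk.aestronglyMeasurable (ae_halfLine_prod.mono fun p hp => h p.1 p.2 hp.1 hp.2)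
  exact h0.mono_measure (Measure.prod_mono hμ hν)

lemma sum_expPoly_eq (c : ℕ → ℝ) (N : ℕ) (x : ℝ) :
    ∑ i ∈ Finset.range N, expPoly (Polynomial.X ^ i) x * c i =
      expPoly (∑ i ∈ Finset.range N, Polynomial.C (c i) * Polynomial.X ^ i) x := by
  simp only [expPoly, Polynomial.eval_finsetSum, Polynomial.eval_mul, Polynomial.eval_C,
    Polynomial.eval_pow, Polynomial.eval_X, Finset.mul_sum]
  refine Finset.sum_congr rfl fun i _ => ?_
  ring

lemma exists_expTail_eq (P : Polynomial ℝ) {b : ℝ} (hb : b < 1 / 2) :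
    ∃ S, expTail P b = expPoly S :=
  ⟨_, funext fun x => (expTail_eq_sum (Nat.lt_succ_self _) hb x).trans (sum_expPoly_eq _ _ x)⟩

lemma exists_cutRemainder_eq (P Q : Polynomial ℝ) (c : ℝ) {u a : ℝ} (hu : 0 ≤ u)
    (ha : a ∈ Ioo (-1 / 2 : ℝ) (1 / 2)) : ∃ S, cutRemainder P Q c u a = expPoly S := by
  have h := cutRemainder_eq_sum (P := P) (Q := Q) (N := max P.natDegree Q.natDegree + 1)
    (by omega) (by omega) c hu ha
  simp only [mul_comm _ (expPoly _ _)] at h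
  exact ⟨_, h.trans (funext fun x => sum_expPoly_eq _ _ x)⟩

section Rescaling

variable {P Q : Polynomial ℝ} {b c u lam : ℝ} {α β : ℝ → ℝ}

lemma expTail_eq_hankel (hlam : 0 < lam) (hc : c ≠ 0)
    (hα : ∀ X, α X = lam * c * Real.exp (b * (u + lam * X)) * expPoly P (u + lam * X)) (X : ℝ) :
    expTail P b (u + lam * X) =
      c⁻¹ * Real.exp (-b * (u + lam * X)) * hankel α (fun _ => 1) X := by
  rw [expTail, integral_halfLine_comp_mul _ hlam, hankel, ← integral_const_mul,
    ← integral_const_mul]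
  congr 1; funext V
  have h : Real.exp (-b * (u + lam * X)) * Real.exp (b * (u + lam * (X + V))) =
      Real.exp (b * (lam * V)) := by
    rw [← Real.exp_add]; congr 1; ring
  rw [hα, ← h, show u + lam * (X + V) = u + lam * X + lam * V by ring]
  field_simp

lemma dressedExp_eq_edgePsi (hlam : 0 < lam) (hc : c ≠ 0)
    (hα : ∀ X, α X = lam * c * Real.exp (b * (u + lam * X)) * expPoly P (u + lam * X)) (X : ℝ) :
    dressedExp P c b (u + lam * X) = Real.exp (-b * (u + lam * X)) * edgePsi α X := by
  rw [dressedExp, expTail_eq_hankel hlam hc hα, edgePsi]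
  field_simp

lemma integral_psi_mul_expTail_eq_hankel (hlam : 0 < lam) (hc : c ≠ 0)
    (hα : ∀ X, α X = lam * c * Real.exp (b * (u + lam * X)) * expPoly P (u + lam * X)) :
    ∫ y in Ici u, psi (-b) y * expTail P b y =
      lam * c⁻¹ * ∫ x, hankel α (fun _ => 1) x ∂halfLine := by
  rw [integral_Ici_comp_mul _ u hlam, mul_assoc, ← integral_const_mul c⁻¹]
  congr 2; funext X
  rw [expTail_eq_hankel hlam hc hα, psi, neg_neg, mul_comm c⁻¹, mul_assoc, ← mul_assoc,
    ← Real.exp_add, neg_mul, add_neg_cancel, Real.exp_zero, one_mul]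

lemma cutTail_eq_hankel (hlam : 0 < lam) (hc : c ≠ 0)
    (hα : ∀ X, α X = lam * c * Real.exp (b * (u + lam * X)) * expPoly P (u + lam * X)) (V : ℝ) :
    cutTail P u (-b) (lam * V) =
      c⁻¹ * Real.exp (-b * (lam * V)) * hankel α (fun _ => 1) V := by
  rw [cutTail, integral_Ici_comp_mul _ u hlam, hankel, ← integral_const_mul, ← integral_const_mul]
  congr 1; funext X
  have h : Real.exp (-b * (lam * V)) * Real.exp (b * (u + lam * (V + X))) =
      Real.exp (- -b * (u + lam * X)) := by
    rw [← Real.exp_add]; congr 1; ring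
  rw [hα, ← h, show u + lam * (V + X) = u + lam * X + lam * V by ring]
  field_simp

lemma cutRemainder_eq_hankel (hlam : 0 < lam) (hc : c ≠ 0)
    (hα : ∀ X, α X = lam * c * Real.exp (b * (u + lam * X)) * expPoly P (u + lam * X))
    (hβ : ∀ Y, β Y = lam * c⁻¹ * Real.exp (-b * (u + lam * Y)) * expPoly Q (u + lam * Y)) (Y : ℝ) :
    cutRemainder P Q c⁻¹ u (-b) (u + lam * Y) =
      c * Real.exp (b * (u + lam * Y)) * hankel β (edgePsi α) Y := by
  rw [cutRemainder, integral_halfLine_comp_mul _ hlam, hankel, ← integral_const_mul,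
    ← integral_const_mul]
  congr 1; funext V
  have h : Real.exp (b * (u + lam * Y)) * Real.exp (-b * (u + lam * (Y + V))) =
      Real.exp (-b * (lam * V)) := by
    rw [← Real.exp_add]; congr 1; ring
  rw [hβ, cutTail_eq_hankel hlam hc hα, ← h, edgePsi,
    show u + lam * (Y + V) = lam * V + (u + lam * Y) by ring]
  field_simp

/-- The left factor of the kernel `expKernel P Q`. -/
def leftFactor (P : Polynomial ℝ) (lam δ x V : ℝ) : ℝ :=
  √lam * expPoly P (x + lam * V) * Real.exp (δ * (lam * V))

/-- The right factor of the kernel `expKernel P Q`. -/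
def rightFactor (Q : Polynomial ℝ) (lam δ V y : ℝ) : ℝ :=
  √lam * expPoly Q (lam * V + y) * Real.exp (-δ * (lam * V))

lemma leftFactor_mul_rightFactor (P Q : Polynomial ℝ) (hlam : 0 < lam) (δ x y : ℝ) :
    ∫ V, leftFactor P lam δ x V * rightFactor Q lam δ V y ∂halfLine = expKernel P Q x y := by
  rw [expKernel, integral_halfLine_comp_mul (fun v => expPoly P (x + v) * expPoly Q (v + y)) hlam,
    ← integral_const_mul]
  congr 1; funext V
  have h : Real.exp (δ * (lam * V)) * Real.exp (-δ * (lam * V)) = 1 := by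
    rw [← Real.exp_add, neg_mul, add_neg_cancel, Real.exp_zero]
  have h2 := Real.mul_self_sqrt hlam.le
  rw [leftFactor, rightFactor]
  linear_combination (expPoly P (x + lam * V) * expPoly Q (lam * V + y)) *
    (√lam * √lam * h + h2)

/-- The weights e^{±δλV} do not change K but conjugate the exchanged product. Taking δ = b - w/λ
replaces the weight bλ, which generally grows with λ, by the fixed weight w. -/
lemma rightFactor_mul_leftFactor (hlam : 0 < lam) (hc : c ≠ 0)
    (hα : ∀ X, α X = lam * c * Real.exp (b * (u + lam * X)) * expPoly P (u + lam * X))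
    (hβ : ∀ Y, β Y = lam * c⁻¹ * Real.exp (-b * (u + lam * Y)) * expPoly Q (u + lam * Y))
    {δ w : ℝ} (hδ : (b - δ) * lam = w) (V V' : ℝ) :
    ∫ x in Ici u, rightFactor Q lam δ V x * leftFactor P lam δ x V' = edgeKernel α β w V V' := by
  rw [integral_Ici_comp_mul _ u hlam, edgeKernel, ← integral_const_mul, ← integral_const_mul]
  congr 1; funext X
  have h : Real.exp (w * (V - V')) * Real.exp (-b * (u + lam * (V + X))) *
      Real.exp (b * (u + lam * (X + V'))) =
      Real.exp (-δ * (lam * V)) * Real.exp (δ * (lam * V')) := by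
    rw [← Real.exp_add, ← Real.exp_add, ← Real.exp_add, ← hδ]; congr 1; ring
  have h2 := Real.mul_self_sqrt hlam.le
  have e1 : u + lam * (V + X) = lam * V + (u + lam * X) := by ring
  have e2 : u + lam * (X + V') = u + lam * X + lam * V' := by ring
  rw [e1, e2] at h
  rw [leftFactor, rightFactor, hα, hβ, e1, e2]
  have hcc : c * c⁻¹ = 1 := mul_inv_cancel₀ hc
  generalize expPoly P _ = p at *
  generalize expPoly Q _ = q at *
  linear_combination (lam * p * q * Real.exp (-δ * (lam * V)) * Real.exp (δ * (lam * V'))) * h2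
    - (lam ^ 2 * p * q) * h - (lam ^ 2 * p * q * Real.exp (w * (V - V')) *
      Real.exp (-b * (lam * V + (u + lam * X))) * Real.exp (b * (u + lam * X + lam * V'))) * hcc

lemma integral_leftFactor_mul (hlam : 0 < lam) (hc : c ≠ 0)
    (hα : ∀ X, α X = lam * c * Real.exp (b * (u + lam * X)) * expPoly P (u + lam * X))
    (hβ : ∀ Y, β Y = lam * c⁻¹ * Real.exp (-b * (u + lam * Y)) * expPoly Q (u + lam * Y))
    {δ w : ℝ} (hδ : (b - δ) * lam = w) (V : ℝ) :
    ∫ x in Ici u, leftFactor P lam δ x V * cutRemainder P Q c⁻¹ u (-b) x =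
      √lam * (Real.exp (-w * V) * hankel α (hankel β (edgePsi α)) V) := by
  rw [integral_Ici_comp_mul _ u hlam, hankel, ← integral_const_mul, ← integral_const_mul,
    ← integral_const_mul]
  congr 1; funext X
  have h : Real.exp (-w * V) * Real.exp (b * (u + lam * (V + X))) =
      Real.exp (δ * (lam * V)) * Real.exp (b * (u + lam * X)) := by
    rw [← Real.exp_add, ← Real.exp_add, ← hδ]; congr 1; ring
  rw [leftFactor, cutRemainder_eq_hankel hlam hc hα hβ, hα,
    show u + lam * (V + X) = u + lam * X + lam * V by ring] at *
  generalize hankel β (edgePsi α) X = q at *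
  generalize expPoly P _ = p at *
  linear_combination (-lam * √lam * c * p * q) * h

lemma integral_rightFactor_mul (hlam : 0 < lam) (hc : c ≠ 0)
    (hα : ∀ X, α X = lam * c * Real.exp (b * (u + lam * X)) * expPoly P (u + lam * X))
    (hβ : ∀ Y, β Y = lam * c⁻¹ * Real.exp (-b * (u + lam * Y)) * expPoly Q (u + lam * Y))
    {δ w : ℝ} (hδ : (b - δ) * lam = w) (V : ℝ) :
    ∫ y in Ici u, rightFactor Q lam δ V y * dressedExp P c b y =
      √lam * c * (Real.exp (w * V) * hankel β (edgePsi α) V) := by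
  rw [integral_Ici_comp_mul _ u hlam, hankel, ← integral_const_mul, ← integral_const_mul,
    ← integral_const_mul]
  congr 1; funext Y
  have h : Real.exp (w * V) * Real.exp (-b * (u + lam * (V + Y))) =
      Real.exp (-δ * (lam * V)) * Real.exp (-b * (u + lam * Y)) := by
    rw [← Real.exp_add, ← Real.exp_add, ← hδ]; congr 1; ring
  have hcc : c * c⁻¹ = 1 := mul_inv_cancel₀ hc
  have e1 : u + lam * (V + Y) = lam * V + (u + lam * Y) := by ring
  rw [e1] at h
  rw [rightFactor, dressedExp_eq_edgePsi hlam hc hα, hβ, e1]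
  generalize edgePsi α Y = q at *
  generalize expPoly Q _ = p at *
  linear_combination (-lam * √lam * p * q) * h - (lam * √lam * p * q * Real.exp (w * V) *
      Real.exp (-b * (lam * V + (u + lam * Y)))) * hcc

/-- ℓ decays at every rate below 1/2, which absorbs the weight as long as δ < 1/2; some of the decay
remains for x. -/
lemma memLp_leftFactor (P : Polynomial ℝ) (hu : 0 ≤ u) (hlam : 0 < lam) {δ : ℝ} (hδ : δ < 1 / 2) :
    MemLp (Function.uncurry (leftFactor P lam δ)) 2 ((volume.restrict (Ici u)).prod halfLine) := by
  obtain ⟨κ, h1, h2⟩ := exists_between (max_lt hδ (by norm_num : (0 : ℝ) < 1 / 2))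
  obtain ⟨h3, h4⟩ := max_lt_iff.1 h1
  obtain ⟨C, hC0, hC⟩ := abs_expPoly_le P h2
  have hc := continuous_expPoly P
  refine memLp_kernel_of_bound_mul (C := √lam * C) (halfLine_mono hu) le_rfl ?_ h4
    (mul_pos (sub_pos.2 h3) hlam) fun x V hx hV => ?_
  · unfold leftFactor
    simp only [Function.uncurry_def]
    fun_prop
  · rw [leftFactor, abs_mul, abs_mul, Real.abs_exp, abs_of_nonneg (Real.sqrt_nonneg _)]
    refine (mul_le_mul_of_nonneg_right (mul_le_mul_of_nonneg_left
      (hC _ (by positivity)) (Real.sqrt_nonneg _)) (Real.exp_nonneg _)).trans (le_of_eq ?_)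
    rw [mul_assoc, mul_assoc, mul_assoc, ← Real.exp_add, ← Real.exp_add]
    congr 3; ring

/-- The spare decay in y can absorb a function growing more slowly than e^{y/2}; this is used with g
= 1 and with the dressed exponential. -/
lemma memLp_rightFactor_mul (Q : Polynomial ℝ) (hu : 0 ≤ u) (hlam : 0 < lam) {δ γ : ℝ}
    (hδ : -δ < 1 / 2) {g : ℝ → ℝ} (hg : Continuous g) {D : ℝ}
    (hgD : ∀ x, 0 ≤ x → |g x| ≤ D * Real.exp (γ * x)) (hγ : γ < 1 / 2) :
    MemLp (Function.uncurry fun V y => rightFactor Q lam δ V y * g y) 2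
      (halfLine.prod (volume.restrict (Ici u))) := by
  obtain ⟨κ, h1, h2⟩ := exists_between (max_lt hδ hγ)
  obtain ⟨h3, h4⟩ := max_lt_iff.1 h1
  obtain ⟨C, hC0, hC⟩ := abs_expPoly_le Q h2
  have hc := continuous_expPoly Q
  refine memLp_kernel_of_bound_mul (C := √lam * C * D) le_rfl (halfLine_mono hu) ?_
    (mul_pos (sub_pos.2 h3) hlam) (sub_pos.2 h4) fun V x hV hx => ?_
  · unfold rightFactor
    simp only [Function.uncurry_def]
    fun_prop
  · rw [rightFactor, abs_mul, abs_mul, abs_mul, Real.abs_exp, abs_of_nonneg (Real.sqrt_nonneg _)]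
    have hle := mul_le_mul (mul_le_mul_of_nonneg_right (mul_le_mul_of_nonneg_left
      (hC (lam * V + x) (by positivity)) (Real.sqrt_nonneg lam)) (Real.exp_nonneg (-δ * (lam * V))))
      (hgD x hx) (abs_nonneg _) (by positivity)
    refine hle.trans (le_of_eq ?_)
    have h : Real.exp (-κ * (lam * V + x)) * Real.exp (-δ * (lam * V)) * Real.exp (γ * x) =
        Real.exp (-((κ - -δ) * lam) * V) * Real.exp (-(κ - γ) * x) := by
      rw [← Real.exp_add, ← Real.exp_add, ← Real.exp_add]; congr 1; ring
    rw [← h]; ring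

lemma isUnit_one_sub_expKernel (hlam : 0 < lam) (hc : c ≠ 0) (hu : 0 ≤ u)
    (hα : ∀ X, α X = lam * c * Real.exp (b * (u + lam * X)) * expPoly P (u + lam * X))
    (hβ : ∀ Y, β Y = lam * c⁻¹ * Real.exp (-b * (u + lam * Y)) * expPoly Q (u + lam * Y))
    {δ w : ℝ} (hδ : (b - δ) * lam = w) (hδ2 : |δ| < 1 / 2)
    (hunit : IsUnit (1 - kernelOp halfLine (edgeKernel α β w))) :
    IsUnit (1 - kernelOp (volume.restrict (Ici u)) (expKernel P Q)) := by
  have hX := memLp_leftFactor P hu hlam (abs_lt.1 hδ2).2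
  have hY : MemLp (Function.uncurry (rightFactor Q lam δ)) 2
      (halfLine.prod (volume.restrict (Ici u))) := by
    simpa using memLp_rightFactor_mul Q hu hlam (by linarith [(abs_lt.1 hδ2).1])
      (continuous_const (y := (1 : ℝ))) (D := 1) (γ := 0) (by simp) (by norm_num)
  have := isUnit_one_sub_kernelOp_factor hX hY
  simp only [leftFactor_mul_rightFactor P Q hlam,
    rightFactor_mul_leftFactor hlam hc hα hβ hδ] at this
  exact this hunit

/-- At the point (-b,b) the two eigenvalues are c⁻¹ and c, so all normalisations cancel. Exchanging
the factors of K moves the resolvent to the rescaled half line. -/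
lemma extG_eq_edgeForm {n p : ℕ} (hb : b ∈ Ioo (-1 / 2 : ℝ) (1 / 2)) (hcb : expEigen n p b = c)
    (hlam : 0 < lam) (hu : 0 ≤ u)
    (hα : ∀ X, α X = lam * c * Real.exp (b * (u + lam * X)) * expPoly P (u + lam * X))
    (hβ : ∀ Y, β Y = lam * c⁻¹ * Real.exp (-b * (u + lam * Y)) * expPoly Q (u + lam * Y))
    {δ w : ℝ} (hδ : (b - δ) * lam = w) (hδ2 : |δ| < 1 / 2)
    (hunit : IsUnit (1 - kernelOp halfLine (edgeKernel α β w))) :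
    extG P Q n p u (-b, b) =
      lam * edgeForm α β w ((u - (p / (1 / 2 - b) + n / (1 / 2 + b))) / lam) := by
  have hc : 0 < c := hcb ▸ expEigen_pos n p hb
  have hnb : -b ∈ Ioo (-1 / 2 : ℝ) (1 / 2) := ⟨by linarith [hb.2], by linarith [hb.1]⟩
  have hca : expEigen p n (-b) = c⁻¹ := by
    rw [← hcb, expEigen, expEigen, inv_div, sub_neg_eq_add, ← sub_eq_add_neg]
  have hX := memLp_leftFactor P hu hlam (abs_lt.1 hδ2).2
  have hδ' : -δ < 1 / 2 := by linarith [(abs_lt.1 hδ2).1]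
  have hY : MemLp (Function.uncurry (rightFactor Q lam δ)) 2
      (halfLine.prod (volume.restrict (Ici u))) := by
    simpa using memLp_rightFactor_mul Q hu hlam hδ' (continuous_const (y := (1 : ℝ)))
      (D := 1) (γ := 0) (by simp) (by norm_num)
  obtain ⟨S, hS⟩ := exists_expTail_eq P hb.2
  obtain ⟨T, hT⟩ := exists_cutRemainder_eq P Q c⁻¹ hu hnb
  have hg : ∀ x, dressedExp P c b x = Real.exp (-b * x) - c * expPoly S x := fun x => by
    rw [dressedExp, hS]
  have hgc : Continuous (dressedExp P c b) := by
    have := continuous_expPoly S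
    rw [show dressedExp P c b = fun x => Real.exp (-b * x) - c * expPoly S x from funext hg]
    fun_prop
  have hfg : Integrable (fun x => cutRemainder P Q c⁻¹ u (-b) x * dressedExp P c b x)
      (volume.restrict (Ici u)) := by
    have h1 := integrable_Ici_expPoly_mul_exp T hu hb.1
    have h2 := ((integrable_expPoly_mul T S).mono_measure (halfLine_mono hu)).const_mul c
    refine (h1.sub h2).congr (ae_of_all _ fun x => ?_)
    simp only [Pi.sub_apply, hT, hg]
    ring
  obtain ⟨D, hD⟩ : ∃ D, ∀ x, 0 ≤ x → |dressedExp P c b x| ≤ D * Real.exp (-b * x) := by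
    obtain ⟨C, hC0, hC⟩ := abs_expPoly_le S hb.2
    refine ⟨1 + c * C, fun x hx => ?_⟩
    rw [hg]
    refine (abs_sub _ _).trans ?_
    rw [Real.abs_exp, abs_mul, abs_of_pos hc, add_mul, one_mul, mul_assoc]
    gcongr
    exact hC x hx
  -- The dressed exponential is only O(e^{-bx}) and may lie outside L². With -b < γ < 1/2 it splits
  -- into an L² factor e^{-(γ+b)y} and a part of growth e^{γy} absorbed by the right factor.
  obtain ⟨γ, hγ1, hγ2⟩ := exists_between hnb.2
  have hg' : MemLp (Function.uncurry fun V y => rightFactor Q lam δ V y *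
      (dressedExp P c b y * Real.exp ((γ + b) * y))) 2
      (halfLine.prod (volume.restrict (Ici u))) := by
    refine memLp_rightFactor_mul Q hu hlam hδ' (by fun_prop) (D := D) (γ := γ)
      (fun x hx => ?_) hγ2
    rw [abs_mul, Real.abs_exp]
    refine (mul_le_mul_of_nonneg_right (hD x hx) (Real.exp_nonneg _)).trans (le_of_eq ?_)
    rw [mul_assoc, ← Real.exp_add]
    congr 2; ring
  have hexp : MemLp (fun y => Real.exp (-(γ + b) * y)) 2 (volume.restrict (Ici u)) :=
    (memLp_exp_halfLine (by linarith)).mono_measure (halfLine_mono hu)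
  have hcancel : ∀ V y, rightFactor Q lam δ V y * (dressedExp P c b y *
      Real.exp ((γ + b) * y)) * Real.exp (-(γ + b) * y) =
        rightFactor Q lam δ V y * dressedExp P c b y := by
    intro V y
    rw [mul_assoc, mul_assoc, ← Real.exp_add, neg_mul, add_neg_cancel, Real.exp_zero, mul_one]
  have hYg := memLp_integral_mul hg' hexp
  simp only [hcancel] at hYg
  have hint : ∀ h : ℝ → ℝ, MemLp h 2 halfLine → Integrable (fun q : ℝ × ℝ =>
      h q.1 * (rightFactor Q lam δ q.1 q.2 * dressedExp P c b q.2))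
      (halfLine.prod (volume.restrict (Ici u))) := by
    intro h hh
    simpa only [hcancel] using integrable_mul_of_memLp hg' hexp h hh
  have hf : MemLp (cutRemainder P Q c⁻¹ u (-b)) 2 (volume.restrict (Ici u)) :=
    memLp_cutRemainder P Q c⁻¹ hu hnb
  have key := resolventPairing_factor hX hY (f := cutRemainder P Q c⁻¹ u (-b))
    (g := dressedExp P c b)
  simp only [leftFactor_mul_rightFactor P Q hlam,
    rightFactor_mul_leftFactor hlam hc.ne' hα hβ hδ,
    integral_leftFactor_mul hlam hc.ne' hα hβ hδ,
    integral_rightFactor_mul hlam hc.ne' hα hβ hδ] at key hYg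
  replace key := key hunit hf hfg hint hYg
  have hsq : √lam ≠ 0 := (Real.sqrt_pos.2 hlam).ne'
  rw [toL2_const_mul_of_ne_zero hsq, toL2_const_mul_of_ne_zero (mul_ne_zero hsq hc.ne'),
    map_smul, real_inner_smul_left, real_inner_smul_right] at key
  have hpair : ∫ x in Ici u, cutRemainder P Q c⁻¹ u (-b) x * dressedExp P c b x =
      lam * c * ∫ x, hankel β (edgePsi α) x * edgePsi α x ∂halfLine := by
    rw [integral_Ici_comp_mul _ u hlam, mul_assoc, ← integral_const_mul c]
    congr 2; funext Y
    have h : Real.exp (b * (u + lam * Y)) * Real.exp (-b * (u + lam * Y)) = 1 := by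
      rw [← Real.exp_add, neg_mul, add_neg_cancel, Real.exp_zero]
    rw [cutRemainder_eq_hankel hlam hc.ne' hα hβ, dressedExp_eq_edgePsi hlam hc.ne' hα]
    linear_combination (c * hankel β (edgePsi α) Y * edgePsi α Y) * h
  have hfree := extFree_neg n p u (-b) hnb
  rw [neg_neg, ← sub_eq_add_neg, sub_neg_eq_add] at hfree
  have h2 := Real.mul_self_sqrt hlam.le
  rw [extG]
  simp only
  rw [hfree, hca, hcb, key, hpair, integral_psi_mul_expTail_eq_hankel hlam hc.ne' hα, edgeForm,
    inv_inv]
  generalize inner ℝ (toL2 halfLine fun x => Real.exp (-w * x) * hankel α (hankel β (edgePsi α)) x)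
    _ = I
  generalize (∫ x, hankel β (edgePsi α) x * edgePsi α x ∂halfLine) = J
  generalize (∫ x, hankel α (fun _ => 1) x ∂halfLine) = K
  have hcc : c⁻¹ * c = 1 := inv_mul_cancel₀ hc.ne'
  have hl : lam * ((u - (p / (1 / 2 - b) + n / (1 / 2 + b))) / lam) =
    u - (p / (1 / 2 - b) + n / (1 / 2 + b)) := mul_div_cancel₀ _ hlam.ne'
  linear_combination (lam * K + lam * J + √lam * √lam * I) * hcc + I * h2 - hl

end Rescaling

end StationaryTASEP

end


noncomputable section

namespace StationaryTASEP

/-! ### The edge limit -/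

/-- The quantity `G_0(u)` as an edge functional. -/
lemma GZero_eq_edgeForm {ρ : ℝ} (hρ0 : 0 < ρ) (hρ1 : ρ < 1) {m d : ℤ} {n p : ℕ} (hn : m - d = n)
    (hp : m + d = p) (hn0 : 0 < n) (hp0 : 0 < p) {u lam w : ℝ} (hu : 0 ≤ u) (hlam : 0 < lam)
    (hδ : |-(1 / 2 - ρ) - w / lam| < 1 / 2)
    (hunit : IsUnit (1 - kernelOp halfLine (edgeKernel (edgeAlpha ρ (1 - ρ) n p u lam)
      (edgeAlpha (1 - ρ) ρ p n u lam) w))) :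
    (∃ H, IsAnalyticExtension ρ m d u H) ∧ GZero ρ m d u =
      lam * edgeForm (edgeAlpha ρ (1 - ρ) n p u lam) (edgeAlpha (1 - ρ) ρ p n u lam) w
        ((u - (n / ρ + p / (1 - ρ))) / lam) := by
  have hρ1' : 0 < 1 - ρ := sub_pos.2 hρ1
  obtain ⟨P, hP⟩ := exists_polynomial_laguerre ρ (1 - ρ) n hp0
  obtain ⟨Q, hQ⟩ := exists_polynomial_laguerre (1 - ρ) ρ p hn0
  have hL : ∀ r, kernelL ρ m d r = expPoly P r := by
    intro r
    rw [kernelL_eq ρ hn hp, hP, expPoly, ← mul_assoc, ← Real.exp_add]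
    congr 2; ring
  have hR : ∀ r, kernelR ρ m d (-r) = expPoly Q r := by
    intro r
    rw [kernelR_neg_eq ρ hn hp, hQ, expPoly, ← mul_assoc, ← Real.exp_add]
    congr 2; ring
  have hc : (1 - ρ) ^ p / ρ ^ n ≠ 0 := by positivity
  have hb : -(1 / 2 - ρ) ∈ Ioo (-1 / 2 : ℝ) (1 / 2) := ⟨by linarith, by linarith⟩
  have hcb : expEigen n p (-(1 / 2 - ρ)) = (1 - ρ) ^ p / ρ ^ n := by
    rw [expEigen]; congr 2 <;> ring
  have hα : ∀ X, edgeAlpha ρ (1 - ρ) n p u lam X = lam * ((1 - ρ) ^ p / ρ ^ n) *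
      Real.exp (-(1 / 2 - ρ) * (u + lam * X)) * expPoly P (u + lam * X) := by
    intro X
    rw [edgeAlpha, hP, expPoly, mul_assoc _ (Real.exp _) (_ * _), ← mul_assoc (Real.exp _),
      ← Real.exp_add]
    congr 3; ring
  have hβ : ∀ X, edgeAlpha (1 - ρ) ρ p n u lam X = lam * ((1 - ρ) ^ p / ρ ^ n)⁻¹ *
      Real.exp (- -(1 / 2 - ρ) * (u + lam * X)) * expPoly Q (u + lam * X) := by
    intro X
    rw [edgeAlpha, hQ, expPoly, mul_assoc _ (Real.exp _) (_ * _), ← mul_assoc (Real.exp _),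
      ← Real.exp_add, inv_div]
    congr 3; ring
  -- Here b = ρ - 1/2 and δ = b - w/λ.
  have hw : (-(1 / 2 - ρ) - (-(1 / 2 - ρ) - w / lam)) * lam = w := by
    field_simp; ring
  have hH := isAnalyticExtension_extG hn hp hL hR hu
    (isUnit_one_sub_expKernel hlam hc hu hα hβ hw hδ hunit)
  refine ⟨⟨_, hH⟩, ?_⟩
  have key := extG_eq_edgeForm hb hcb hlam hu hα hβ hw hδ hunit
  rw [neg_neg] at key
  rw [hH.GZero_eq hρ0 hρ1, key]
  congr 3
  rw [show 1 / 2 - -(1 / 2 - ρ) = 1 - ρ by ring, show 1 / 2 + -(1 / 2 - ρ) = ρ by ring]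
  ring

/-- The limit theorem for `G_0` under edge scaling. -/
lemma tendsto_GZero_of_edgeScaling {ι : Type*} {l : Filter ι} [l.IsCountablyGenerated] [l.NeBot]
    {ρ : ℝ} {m d : ι → ℤ} {n p : ι → ℕ} {u lam : ι → ℝ} {w s : ℝ}
    (h : EdgeScaling l ρ (1 - ρ) n p u lam w s)
    (hn : ∀ᶠ i in l, m i - d i = n i ∧ 0 < n i) (hp : ∀ᶠ i in l, m i + d i = p i ∧ 0 < p i)
    (hu : ∀ᶠ i in l, 0 ≤ u i) :
    (∀ᶠ i in l, ∃ H, IsAnalyticExtension ρ (m i) (d i) (u i) H) ∧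
      Tendsto (fun i => (lam i)⁻¹ * GZero ρ (m i) (d i) (u i)) l (𝓝 (edgeLimit w s)) := by
  have hρ0 : 0 < ρ := h.ha
  have hρ1 : ρ < 1 := sub_pos.1 h.hb
  have hsym := h.symm
  obtain ⟨C, hα⟩ := h.dominatedLimit_edgeAlpha (hp.mono fun _ hi => hi.2) (κ := |w| + 1)
    (by positivity) (by linarith [neg_abs_le w])
  obtain ⟨D, hβ⟩ := hsym.dominatedLimit_edgeAlpha (hn.mono fun _ hi => hi.2) (κ := |w| + 1)
    (by positivity) (by linarith [le_abs_self w])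
  have hs : Tendsto (fun i => (u i - (n i / ρ + p i / (1 - ρ))) / lam i) l (𝓝 s) := by
    have := h.first.neg
    rw [neg_neg] at this
    refine this.congr fun i => ?_
    rw [← neg_div, neg_sub]
  obtain ⟨h1, h2⟩ := tendsto_edgeForm hα hβ (tendsto_const_nhds (x := w)) hs
    (Eventually.of_forall fun _ => le_rfl) le_rfl (lt_add_one |w|)
    (by rw [edgeKernel_phi]; exact isUnit_one_sub_airyKernel _)
  -- δ tends to ρ - 1/2, which lies strictly inside (-1/2,1/2) because 0 < ρ < 1.
  have hδ : ∀ᶠ i in l, |-(1 / 2 - ρ) - w / lam i| < 1 / 2 := by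
    have : Tendsto (fun i => |-(1 / 2 - ρ) - w / lam i|) l (𝓝 |-(1 / 2 - ρ) - w * 0|) :=
      (tendsto_const_nhds.sub (h.inv_lam.const_mul w)).abs
    refine this.eventually_lt_const ?_
    rw [mul_zero, sub_zero, abs_lt]
    constructor <;> linarith
  have key : ∀ᶠ i in l, (∃ H, IsAnalyticExtension ρ (m i) (d i) (u i) H) ∧
      GZero ρ (m i) (d i) (u i) = lam i * edgeForm (edgeAlpha ρ (1 - ρ) (n i) (p i) (u i) (lam i))
        (edgeAlpha (1 - ρ) ρ (p i) (n i) (u i) (lam i)) w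
        ((u i - (n i / ρ + p i / (1 - ρ))) / lam i) := by
    filter_upwards [hn, hp, hu, h.lam_pos, hδ, h2] with i hn hp hu hlam hδ hunit
    exact GZero_eq_edgeForm hρ0 hρ1 hn.1 hp.1 hn.2 hp.2 hu hlam hδ hunit
  refine ⟨key.mono fun _ hi => hi.1, ?_⟩
  rw [edgeLimit_eq_edgeForm]
  refine h1.congr' ?_
  filter_upwards [key, h.lam_pos] with i hi hlam
  rw [hi.2, inv_mul_cancel_left₀ hlam.ne']

/-- The edge scaling regime in terms of `x = t^{1/3}` and `k = χ^{1/3}`. -/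
lemma edgeScaling_of_tendsto {ι : Type*} {l : Filter ι} {ρ k w s σ : ℝ} (hρ0 : 0 < ρ) (hρ1 : ρ < 1)
    (hk : 0 < k) (hk3 : k ^ 3 = ρ * (1 - ρ)) {n p : ι → ℕ} {x : ι → ℝ}
    (hx : Tendsto x l atTop)
    (hn : Tendsto (fun i => (n i - (ρ ^ 2 * x i ^ 3 - 2 * ρ * w * k * x i ^ 2 - σ * k ^ 2 * x i)) *
      (x i)⁻¹) l (𝓝 0))
    (hp : Tendsto (fun i => (p i - ((1 - ρ) ^ 2 * x i ^ 3 + 2 * (1 - ρ) * w * k * x i ^ 2 -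
      σ * k ^ 2 * x i)) * (x i)⁻¹) l (𝓝 0)) :
    EdgeScaling l ρ (1 - ρ) n p (fun i => x i ^ 3 + (s - σ) * k⁻¹ * x i) (fun i => k⁻¹ * x i)
      w s := by
  have hρ1' : 0 < 1 - ρ := sub_pos.2 hρ1
  have hy : Tendsto (fun i => (x i)⁻¹) l (𝓝 0) := tendsto_inv_atTop_zero.comp hx
  have hx0 : ∀ᶠ i in l, x i ≠ 0 := (hx.eventually_gt_atTop 0).mono fun _ h => h.ne'
  -- In each condition the powers of x combine by k³ = ρ(1-ρ) to the claimed limit, plus rounding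
  -- and lower order terms that vanish.
  refine ⟨hρ0, hρ1', by ring, hx.const_mul_atTop (inv_pos.2 hk), ?_, ?_, ?_⟩
  · have h : Tendsto (fun i => -s + k * ((n i - (ρ ^ 2 * x i ^ 3 - 2 * ρ * w * k * x i ^ 2 -
        σ * k ^ 2 * x i)) * (x i)⁻¹ / ρ + (p i - ((1 - ρ) ^ 2 * x i ^ 3 +
        2 * (1 - ρ) * w * k * x i ^ 2 - σ * k ^ 2 * x i)) * (x i)⁻¹ / (1 - ρ))) l
        (𝓝 (-s + k * (0 / ρ + 0 / (1 - ρ)))) :=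
      (((hn.div_const _).add (hp.div_const _)).const_mul k).const_add _
    rw [zero_div, zero_div, add_zero, mul_zero, add_zero] at h
    refine h.congr' (hx0.mono fun i hi => ?_)
    have hσ : σ * k ^ 3 = σ * (ρ * (1 - ρ)) := by rw [hk3]
    field_simp
    linear_combination x i * hσ
  · have h : Tendsto (fun i => w + k ^ 2 / 2 * (σ * k ^ 2 * (1 / ρ ^ 2 - 1 / (1 - ρ) ^ 2) * (x i)⁻¹ +
        (x i)⁻¹ * ((p i - ((1 - ρ) ^ 2 * x i ^ 3 +
        2 * (1 - ρ) * w * k * x i ^ 2 - σ * k ^ 2 * x i)) * (x i)⁻¹ / (1 - ρ) ^ 2 -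
        (n i - (ρ ^ 2 * x i ^ 3 - 2 * ρ * w * k * x i ^ 2 -
        σ * k ^ 2 * x i)) * (x i)⁻¹ / ρ ^ 2))) l
        (𝓝 (w + k ^ 2 / 2 * (σ * k ^ 2 * (1 / ρ ^ 2 - 1 / (1 - ρ) ^ 2) * 0 +
          0 * (0 / (1 - ρ) ^ 2 - 0 / ρ ^ 2)))) :=
      (((hy.const_mul _).add (hy.mul ((hp.div_const _).sub (hn.div_const _)))).const_mul _).const_add _
    rw [mul_zero, zero_mul, add_zero, mul_zero, add_zero] at h
    refine h.congr' (hx0.mono fun i hi => ?_)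
    field_simp
    linear_combination (-2 * w * ρ * (1 - ρ) * x i ^ 2) * hk3
  · have h : Tendsto (fun i => 1 + k ^ 3 * ((2 * w * k * (1 / (1 - ρ) ^ 2 - 1 / ρ ^ 2)) * (x i)⁻¹ -
        (σ * k ^ 2 * (1 / ρ ^ 3 + 1 / (1 - ρ) ^ 3)) * ((x i)⁻¹ * (x i)⁻¹) +
        (x i)⁻¹ * (x i)⁻¹ * ((p i - ((1 - ρ) ^ 2 * x i ^ 3 +
        2 * (1 - ρ) * w * k * x i ^ 2 - σ * k ^ 2 * x i)) * (x i)⁻¹ / (1 - ρ) ^ 3 +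
        (n i - (ρ ^ 2 * x i ^ 3 - 2 * ρ * w * k * x i ^ 2 -
        σ * k ^ 2 * x i)) * (x i)⁻¹ / ρ ^ 3))) l
        (𝓝 (1 + k ^ 3 * ((2 * w * k * (1 / (1 - ρ) ^ 2 - 1 / ρ ^ 2)) * 0 -
        (σ * k ^ 2 * (1 / ρ ^ 3 + 1 / (1 - ρ) ^ 3)) * (0 * 0) +
          0 * 0 * (0 / (1 - ρ) ^ 3 + 0 / ρ ^ 3)))) :=
      ((((hy.const_mul _).sub ((hy.mul hy).const_mul _)).add ((hy.mul hy).mul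
        ((hp.div_const _).add (hn.div_const _)))).const_mul _).const_add _
    rw [mul_zero, mul_zero, zero_mul, mul_zero, sub_zero, add_zero, mul_zero, add_zero] at h
    refine h.congr' (hx0.mono fun i hi => ?_)
    field_simp
    linear_combination (-ρ ^ 2 * (1 - ρ) ^ 2 * x i ^ 3) * hk3

/-- A quantity growing like `c x³` is eventually positive. -/
lemma eventually_pos_of_tendsto {ι : Type*} {l : Filter ι} {c e f : ℝ} (hc : 0 < c) {x r : ι → ℝ}
    (hx : Tendsto x l atTop)
    (hr : Tendsto (fun i => (r i - (c * x i ^ 3 + e * x i ^ 2 + f * x i)) * (x i)⁻¹) l (𝓝 0)) :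
    ∀ᶠ i in l, 0 < r i := by
  have hy : Tendsto (fun i => (x i)⁻¹) l (𝓝 0) := tendsto_inv_atTop_zero.comp hx
  have h : Tendsto (fun i => c + e * (x i)⁻¹ + f * ((x i)⁻¹ * (x i)⁻¹) + (x i)⁻¹ * (x i)⁻¹ *
      ((r i - (c * x i ^ 3 + e * x i ^ 2 + f * x i)) * (x i)⁻¹)) l
      (𝓝 (c + e * 0 + f * (0 * 0) + 0 * 0 * 0)) :=
    (((hy.const_mul e).const_add c).add ((hy.mul hy).const_mul f)).add ((hy.mul hy).mul hr)
  have hc' : 0 < c + e * 0 + f * (0 * 0) + 0 * 0 * 0 := by linarith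
  filter_upwards [h.eventually_const_lt hc', hx.eventually_gt_atTop 0] with i hi hxi
  have e1 : r i = x i ^ 3 * (c + e * (x i)⁻¹ + f * ((x i)⁻¹ * (x i)⁻¹) + (x i)⁻¹ * (x i)⁻¹ *
      ((r i - (c * x i ^ 3 + e * x i ^ 2 + f * x i)) * (x i)⁻¹)) := by
    field_simp
    ring
  rw [e1]
  positivity

lemma tendsto_mul_inv_of_abs_le {ι : Type*} {l : Filter ι} {x f : ι → ℝ} {C : ℝ}
    (hx : Tendsto x l atTop) (hf : ∀ᶠ i in l, |f i| ≤ C) :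
    Tendsto (fun i => f i * (x i)⁻¹) l (𝓝 0) := by
  have h0 : Tendsto (fun i => C * |(x i)⁻¹|) l (𝓝 0) := by
    simpa using ((tendsto_inv_atTop_zero.comp hx).abs.const_mul C)
  refine squeeze_zero_norm' (hf.mono fun i hi => ?_) h0
  rw [Real.norm_eq_abs, abs_mul]
  exact mul_le_mul_of_nonneg_right hi (abs_nonneg _)

/-- The limit theorem with the integer parameters given by rounding. -/
lemma tendsto_GZero_of_floor {ι : Type*} {l : Filter ι} [l.IsCountablyGenerated] [l.NeBot]
    {ρ k w s σ : ℝ} (hρ0 : 0 < ρ) (hρ1 : ρ < 1) (hk : 0 < k) (hk3 : k ^ 3 = ρ * (1 - ρ))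
    {m d : ι → ℤ} {x : ι → ℝ} (hx : Tendsto x l atTop)
    (hm : ∀ᶠ i in l, |2 * m i - ⌊(1 - 2 * k ^ 3) * x i ^ 3 + 2 * w * (1 - 2 * ρ) * k * x i ^ 2
      - 2 * σ * k ^ 2 * x i⌋| ≤ 1)
    (hd : ∀ᶠ i in l, |2 * d i - ⌊(1 - 2 * ρ) * x i ^ 3 + 2 * w * k * x i ^ 2⌋| ≤ 1) :
    (∀ᶠ i in l, ∃ H, IsAnalyticExtension ρ (m i) (d i) (x i ^ 3 + (s - σ) * k⁻¹ * x i) H) ∧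
      Tendsto (fun i => (k⁻¹ * x i)⁻¹ *
        GZero ρ (m i) (d i) (x i ^ 3 + (s - σ) * k⁻¹ * x i)) l (𝓝 (edgeLimit w s)) := by
  have hρ1' : 0 < 1 - ρ := sub_pos.2 hρ1
  -- The floor and the parity tolerance each cost at most 1, so m ± d are known up to a bounded
  -- error, negligible against x = t^{1/3}.
  have hround : ∀ {j : ℤ} {y : ℝ}, |2 * j - ⌊y⌋| ≤ 1 → |2 * (j : ℝ) - y| ≤ 2 := by
    intro j y h
    have h' : |2 * (j : ℝ) - ⌊y⌋| ≤ 1 := by exact_mod_cast h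
    rw [abs_le] at h' ⊢
    have h1 := Int.floor_le y
    have h2 := Int.lt_floor_add_one y
    constructor <;> linarith [h'.1, h'.2]
  have hnr : Tendsto (fun i => (((m i - d i : ℤ) : ℝ) - (ρ ^ 2 * x i ^ 3 + (-2 * ρ * w * k) * x i ^ 2 +
      (-σ * k ^ 2) * x i)) * (x i)⁻¹) l (𝓝 0) := by
    refine tendsto_mul_inv_of_abs_le (C := 2) hx ?_
    filter_upwards [hm, hd] with i h1 h2
    have h1 := abs_le.1 (hround h1)
    have h2 := abs_le.1 (hround h2)
    rw [hk3] at h1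
    push_cast
    rw [abs_le]
    constructor <;> linarith [h1.1, h1.2, h2.1, h2.2]
  have hpr : Tendsto (fun i => (((m i + d i : ℤ) : ℝ) - ((1 - ρ) ^ 2 * x i ^ 3 +
      (2 * (1 - ρ) * w * k) * x i ^ 2 + (-σ * k ^ 2) * x i)) * (x i)⁻¹) l (𝓝 0) := by
    refine tendsto_mul_inv_of_abs_le (C := 2) hx ?_
    filter_upwards [hm, hd] with i h1 h2
    have h1 := abs_le.1 (hround h1)
    have h2 := abs_le.1 (hround h2)
    rw [hk3] at h1
    push_cast
    rw [abs_le]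
    constructor <;> linarith [h1.1, h1.2, h2.1, h2.2]
  have hn0 : ∀ᶠ i in l, 0 < m i - d i :=
    (eventually_pos_of_tendsto (pow_pos hρ0 2) hx hnr).mono fun i hi => by exact_mod_cast hi
  have hp0 : ∀ᶠ i in l, 0 < m i + d i :=
    (eventually_pos_of_tendsto (pow_pos hρ1' 2) hx hpr).mono fun i hi => by exact_mod_cast hi
  have hu : ∀ᶠ i in l, 0 ≤ x i ^ 3 + (s - σ) * k⁻¹ * x i := by
    refine (eventually_pos_of_tendsto (c := 1) (e := 0) (f := (s - σ) * k⁻¹) one_pos hx ?_).mono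
      fun i hi => hi.le
    refine tendsto_const_nhds.congr fun i => ?_
    ring
  have hcast : ∀ {z : ℤ}, 0 < z → z = (z.toNat : ℤ) := fun h => (Int.toNat_of_nonneg h.le).symm
  have hE : EdgeScaling l ρ (1 - ρ) (fun i => (m i - d i).toNat) (fun i => (m i + d i).toNat)
      (fun i => x i ^ 3 + (s - σ) * k⁻¹ * x i) (fun i => k⁻¹ * x i) w s := by
    refine edgeScaling_of_tendsto hρ0 hρ1 hk hk3 hx (hnr.congr' ?_) (hpr.congr' ?_)
    · filter_upwards [hn0] with i hi
      have : ((m i - d i : ℤ) : ℝ) = ((m i - d i).toNat : ℝ) := by exact_mod_cast hcast hi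
      rw [this]
      ring
    · filter_upwards [hp0] with i hi
      have : ((m i + d i : ℤ) : ℝ) = ((m i + d i).toNat : ℝ) := by exact_mod_cast hcast hi
      rw [this]
      ring
  exact tendsto_GZero_of_edgeScaling hE (hn0.mono fun i hi => ⟨hcast hi, by omega⟩)
    (hp0.mono fun i hi => ⟨hcast hi, by omega⟩) hu

end StationaryTASEP

end

/-! ### The theorem in the variable t -/

theorem theorem6p2 (ρ χ : ℝ) (hρ0 : 0 < ρ) (hρ1 : ρ < 1) (hχ : χ = ρ * (1 - ρ))
    (w s σ : ℝ) (m d : ℝ → ℤ)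
    (hm : ∀ᶠ t : ℝ in atTop,
      |2 * m t - ⌊(1 - 2 * χ) * t + 2 * w * (1 - 2 * ρ) * χ ^ (1 / 3 : ℝ) * t ^ (2 / 3 : ℝ)
        - 2 * σ * χ ^ (2 / 3 : ℝ) * t ^ (1 / 3 : ℝ)⌋| ≤ 1)
    (hd : ∀ᶠ t : ℝ in atTop,
      |2 * d t - ⌊(1 - 2 * ρ) * t + 2 * w * χ ^ (1 / 3 : ℝ) * t ^ (2 / 3 : ℝ)⌋| ≤ 1) :
    (∀ᶠ t : ℝ in atTop, ∃ H : ℝ × ℝ → ℝ, StationaryTASEP.IsAnalyticExtension ρ (m t) (d t)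
      (t + (s - σ) * χ ^ (-(1 / 3) : ℝ) * t ^ (1 / 3 : ℝ)) H) ∧
    Tendsto (fun t : ℝ => χ ^ (1 / 3 : ℝ) * t ^ (-(1 / 3) : ℝ) *
        StationaryTASEP.GZero ρ (m t) (d t)
          (t + (s - σ) * χ ^ (-(1 / 3) : ℝ) * t ^ (1 / 3 : ℝ)))
      atTop (𝓝 (StationaryTASEP.edgeLimit |w| s)) ∧
    StationaryTASEP.edgeLimit |w| s = StationaryTASEP.scalingG (s + w ^ 2) w ∧
    ContinuousAt (fun v : ℝ => StationaryTASEP.scalingG (s + w ^ 2) v) 0 := by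
  have hχ0 : 0 < χ := hχ ▸ mul_pos hρ0 (sub_pos.2 hρ1)
  have hk : 0 < χ ^ (1 / 3 : ℝ) := Real.rpow_pos_of_pos hχ0 _
  have hcube : ∀ {y : ℝ}, 0 ≤ y → (y ^ (1 / 3 : ℝ)) ^ 3 = y := fun {y} hy => by
    rw [← Real.rpow_natCast, ← Real.rpow_mul hy]
    norm_num
  have hsq : ∀ {y : ℝ}, 0 ≤ y → y ^ (2 / 3 : ℝ) = (y ^ (1 / 3 : ℝ)) ^ 2 := fun {y} hy => by
    rw [← Real.rpow_natCast, ← Real.rpow_mul hy]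
    norm_num
  have hinv : ∀ {y : ℝ}, 0 ≤ y → y ^ (-(1 / 3) : ℝ) = (y ^ (1 / 3 : ℝ))⁻¹ := fun hy =>
    Real.rpow_neg hy _
  have hx : Tendsto (fun t : ℝ => t ^ (1 / 3 : ℝ)) atTop atTop :=
    tendsto_rpow_atTop (by norm_num)
  obtain ⟨h1, h2⟩ := StationaryTASEP.tendsto_GZero_of_floor (l := atTop) (w := w) (s := s) (σ := σ)
    (m := m) (d := d) hρ0 hρ1 hk ((hcube hχ0.le).trans hχ) hx
    (by
      filter_upwards [hm, eventually_ge_atTop 0] with t ht ht0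
      rw [hcube hχ0.le, hcube ht0, ← hsq ht0, ← hsq hχ0.le]
      exact ht)
    (by
      filter_upwards [hd, eventually_ge_atTop 0] with t ht ht0
      rw [hcube ht0, ← hsq ht0]
      exact ht)
  refine ⟨?_, ?_, ?_, StationaryTASEP.continuousAt_scalingG _⟩
  · filter_upwards [h1, eventually_ge_atTop 0] with t ht ht0
    rw [hinv hχ0.le]
    rw [hcube ht0] at ht
    exact ht
  -- The asymptotics produce the functional at the signed w; evenness replaces it by |w|.
  · rw [StationaryTASEP.edgeLimit_abs]
    refine h2.congr' ?_
    filter_upwards [eventually_ge_atTop 0] with t ht0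
    rw [hinv hχ0.le, hinv ht0, hcube ht0, mul_inv, inv_inv]
  · rw [StationaryTASEP.scalingG_eq, add_sub_cancel_right]
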